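/- Identify tilings with their data up to Lebesgue-negligible sets. A periodic $2$-tiling $\mathbf T$ of $\mathbb R^2$ is given by a lattice $G\subset\mathbb R^2$ (of rank two) and two measurable generators $E_1,E_2$ such that the sets $E_k+g$ ($k=1,2$, $g\in G$) have pairwise negligible intersections and cover the plane up to a negligible set. It is non-degenerate if $|E_1|,|E_2|>0$. Its perimeter is $\mathrm{Per}(\mathbf T)=\frac12(\mathrm{Per}(E_1)+\mathrm{Per}(E_2))$, with $\mathrm{Per}(E)$ the Caccioppoli perimeter. It is isoperimetric if $\mathrm{Per}(\mathbf T)\le\mathrm{Per}(\mathbf T')$ for every periodic $2$-tiling $\mathbf T'$, with any lattice, whose generators satisfy $|E_k'|=|E_k|$, $k=1,2$. It is a $(4;8)$ configuration if for some $p>0$ (all interior angles of the tiles being of $120^\circ$) $E_1$ is a curvilinear rectangle, i.e. it is bounded by four convex circular arcs of curvature $p$ whose endpoints are the vertices of a rectangle, and $E_2$ is a chipped parallelogram, i.e. a curvilinear octagon whose edges are alternately straight segments and concave circular arcs of curvature $p$, opposite straight edges being parallel. $E_1$ is called a curvilinear square if the endpoints of its arcs are the vertices of a square, and $E_2$ a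 chipped square if consecutive straight edges are orthogonal, the straight edges have equal lengths and the arcs have equal lengths. **Theorem 3.4 (optimal lattice for the $(4;8)$ configuration).** Let $\mathbf T$ be a non-degenerate isoperimetric periodic $2$-tiling of $\mathbb R^2$ which is a $(4;8)$ configuration. Then $G$ has two generators $g,g'$ which are orthogonal and of equal length, a suitable square $D$ with sides $g,g'$ is a fundamental domain of $G$ with $E_2=D\setminus\bigcup_{h\in G}(E_1+h)$ up to a negligible set, $E_1$ is a curvilinear square and $E_2$ is a chipped square. Moreover $$0<\frac{|E_1|}{|E_1|+|E_2|}<\frac{(2+\sqrt3)\left(1-\sqrt3+\frac\pi3\right)}{2},$$ $$\mathrm{Per}(\mathbf T)=2\sqrt{\tfrac\pi3+1-\sqrt3}\,\sqrt{|E_1|}+2\sqrt{|E_1|+|E_2|}.$$ Given $|E_1|$ and $|E_2|$, the configuration is unique up to isometries: for any two non-degenerate isoperimetric periodic $2$-tilings which are $(4;8)$ configurations with the same values of $|E_1|$ and $|E_2|$, an isometry of the plane maps the translates $E_k+g$ of the first onto those of the second, up to negligible sets, for $k=1,2$. -/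

import Mathlib

open MeasureTheory Set Filter Topology Complex
open scoped Pointwise ENNReal

/-! The Euclidean plane is identified with `ℂ` (Euclidean norm, Lebesgue measure). -/

/-- The divergence of a planar vector field. -/
noncomputable def planeDiv (φ : ℂ → ℂ) (z : ℂ) : ℝ :=
  (fderiv ℝ φ z 1).re + (fderiv ℝ φ z I).im

/-- The Caccioppoli perimeter of a planar set: the supremum of `∫_E div φ` over the compactly
supported `C¹` vector fields `φ` with `|φ| ≤ 1`. -/
noncomputable def caccioppoliPerimeter (E : Set ℂ) : ℝ≥0∞ :=
  ⨆ (φ : ℂ → ℂ) (_ : ContDiff ℝ 1 φ) (_ : HasCompactSupport φ) (_ : ∀ z, ‖φ z‖ ≤ 1),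
    ENNReal.ofReal (∫ z in E, planeDiv φ z)

/-- `g` and `g'` generate the planar lattice `G`: they are linearly independent vectors, and `G`
consists of their integer combinations. -/
def IsLatticeBasis (G : AddSubgroup ℂ) (g g' : ℂ) : Prop :=
  LinearIndependent ℝ ![g, g'] ∧ AddSubgroup.closure {g, g'} = G

/-- A periodic `2`-tiling of the plane, given by its lattice and its two generators: the
translates of the two generators by the lattice vectors have pairwise negligible intersections and
cover the plane up to a negligible set. -/
structure PeriodicTwoTiling where
  lattice : AddSubgroup ℂ
  isLattice : ∃ g g' : ℂ, IsLatticeBasis lattice g g'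
  tile : Fin 2 → Set ℂ
  measurable : ∀ k, NullMeasurableSet (tile k) volume
  disjoint : ∀ k j, ∀ g ∈ lattice, ∀ h ∈ lattice, (k, g) ≠ (j, h) →
    volume ((g +ᵥ tile k) ∩ (h +ᵥ tile j)) = 0
  cover : volume (⋃ k, ⋃ g ∈ lattice, g +ᵥ tile k)ᶜ = 0

namespace PeriodicTwoTiling

/-- Both generators have positive area. -/
def NonDegenerate (T : PeriodicTwoTiling) : Prop :=
  ∀ k, 0 < volume (T.tile k)

/-- The perimeter of the tiling: half the sum of the perimeters of the generators. -/
noncomputable def perimeter (T : PeriodicTwoTiling) : ℝ≥0∞ :=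
  (1 / 2) * ∑ k, caccioppoliPerimeter (T.tile k)

/-- The tiling has least perimeter among all periodic `2`-tilings with the same areas, whatever
their lattices. -/
def Isoperimetric (T : PeriodicTwoTiling) : Prop :=
  ∀ T' : PeriodicTwoTiling, (∀ k, volume (T'.tile k) = volume (T.tile k)) →
    T.perimeter ≤ T'.perimeter

/-- Some isometry of the plane carries the tiles of `T` onto those of `T'`, up to negligible sets,
translates of the `k`-th generator to translates of the `k`-th generator. -/
def Congruent (T T' : PeriodicTwoTiling) : Prop :=
  ∃ φ : ℂ ≃ᵢ ℂ, ∀ k,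
    (∀ g ∈ T.lattice, ∃ g' ∈ T'.lattice, φ '' (g +ᵥ T.tile k) =ᵐ[volume] (g' +ᵥ T'.tile k : Set ℂ)) ∧
    (∀ g' ∈ T'.lattice, ∃ g ∈ T.lattice, φ '' (g +ᵥ T.tile k) =ᵐ[volume] (g' +ᵥ T'.tile k : Set ℂ))

end PeriodicTwoTiling

/-- The unit-speed curve of constant signed curvature `κ` (a segment if `κ = 0`, a circular arc
otherwise) that starts at `v` with unit tangent `τ`, at arc length `s`. -/
noncomputable def arcPoint (v τ : ℂ) (κ s : ℝ) : ℂ :=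
  v + ∫ t in (0 : ℝ)..s, τ * exp ((κ * t : ℝ) * I)

/-- A simple closed curve made of `n` edges (circular arcs or segments) in which the tangent jumps
by `60` degrees to the left at every vertex. When the region enclosed lies on the left, this
says that all interior angles are of `120` degrees. -/
structure CurvedPolygon (n : ℕ) [NeZero n] where
  /-- The vertices, in cyclic order; edge `i` goes from vertex `i` to vertex `i + 1`. -/
  vertex : Fin n → ℂ
  /-- The unit tangent at the start of each edge. -/
  dir : Fin n → ℂ
  /-- The signed curvature of each edge, positive when the edge turns left. -/
  curv : Fin n → ℝ
  /-- The length of each edge. -/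
  len : Fin n → ℝ
  norm_dir : ∀ i, ‖dir i‖ = 1
  len_pos : ∀ i, 0 < len i
  vertex_succ : ∀ i, arcPoint (vertex i) (dir i) (curv i) (len i) = vertex (i + 1)
  dir_succ : ∀ i, dir (i + 1) = dir i * exp ((curv i * len i + Real.pi / 3 : ℝ) * I)
  simple : ∀ i j, ∀ s ∈ Ico 0 (len i), ∀ t ∈ Ico 0 (len j),
    arcPoint (vertex i) (dir i) (curv i) s = arcPoint (vertex j) (dir j) (curv j) t →
      i = j ∧ s = t

namespace CurvedPolygon

variable {n : ℕ} [NeZero n]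

/-- The `i`-th edge. -/
noncomputable def edge (P : CurvedPolygon n) (i : Fin n) : Set ℂ :=
  arcPoint (P.vertex i) (P.dir i) (P.curv i) '' Icc 0 (P.len i)

/-- `R` is the closed region enclosed by `P`, run through counterclockwise: `R` is compact, it is
the closure of its interior, its boundary is the curve, and its interior is on the left of each
edge. So an edge of `R` is convex, flat or concave according to the sign of its curvature. -/
def Encloses (P : CurvedPolygon n) (R : Set ℂ) : Prop :=
  IsCompact R ∧ closure (interior R) = R ∧ frontier R = ⋃ i, P.edge i ∧
  ∀ i, ∀ s ∈ Ioo 0 (P.len i), ∀ᶠ ε : ℝ in 𝓝[>] 0,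
    arcPoint (P.vertex i) (P.dir i) (P.curv i) s +
      ε * (I * (P.dir i * exp ((P.curv i * s : ℝ) * I))) ∈ interior R

end CurvedPolygon

/-- A curvilinear rectangle: four arcs of the same curvature `p > 0` meeting with angles of `120`
degrees, whose endpoints are the vertices of a rectangle. -/
def IsCurvilinearRectangle (p : ℝ) (R : Set ℂ) : Prop :=
  0 < p ∧ ∃ P : CurvedPolygon 4, P.Encloses R ∧ (∀ i, P.curv i = p) ∧
    ∀ i, inner ℝ (P.vertex (i + 1) - P.vertex i) (P.vertex (i + 2) - P.vertex (i + 1)) = 0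

/-- A curvilinear square: four arcs of the same curvature `p > 0` meeting with angles of `120`
degrees, whose endpoints are the vertices of a square. -/
def IsCurvilinearSquare (p : ℝ) (R : Set ℂ) : Prop :=
  0 < p ∧ ∃ P : CurvedPolygon 4, P.Encloses R ∧ (∀ i, P.curv i = p) ∧
    ∀ i, P.vertex (i + 2) - P.vertex (i + 1) = I * (P.vertex (i + 1) - P.vertex i)

/-- A chipped parallelogram: eight edges meeting with angles of `120` degrees, alternately flat and
concave of curvature `-p < 0`, such that opposite flat edges are parallel (that is, the flat edges
are contained in the sides of a parallelogram, whose corners are cut off by the concave edges). -/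
def IsChippedParallelogram (p : ℝ) (R : Set ℂ) : Prop :=
  0 < p ∧ ∃ P : CurvedPolygon 8, P.Encloses R ∧
    (∀ i : Fin 8, P.curv i = if Even (i : ℕ) then 0 else -p) ∧
    ∀ i : Fin 8, Even (i : ℕ) → P.dir (i + 4) = -P.dir i

/-- A chipped square: eight edges meeting with angles of `120` degrees, alternately flat and
concave of curvature `-p < 0`, such that consecutive flat edges are orthogonal, the flat edges have
equal lengths and the concave edges have equal lengths. -/
def IsChippedSquare (p : ℝ) (R : Set ℂ) : Prop :=
  0 < p ∧ ∃ P : CurvedPolygon 8, P.Encloses R ∧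
    (∀ i : Fin 8, P.curv i = if Even (i : ℕ) then 0 else -p) ∧
    (∀ i : Fin 8, Even (i : ℕ) → P.dir (i + 2) = I * P.dir i) ∧
    ∀ i, P.len (i + 2) = P.len i

/-- The tiling is a `(4;8)` configuration: up to negligible sets, for one and the same `p > 0`, the
first generator is a curvilinear rectangle with edges of curvature `p`, and the second one is a
chipped parallelogram with concave edges of curvature `-p`. -/
def PeriodicTwoTiling.IsType48 (T : PeriodicTwoTiling) : Prop :=
  ∃ (p : ℝ) (R₁ R₂ : Set ℂ), T.tile 0 =ᵐ[volume] R₁ ∧ T.tile 1 =ᵐ[volume] R₂ ∧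
    IsCurvilinearRectangle p R₁ ∧ IsChippedParallelogram p R₂

/-- The closed parallelogram with corner `z` and sides `g`, `g'`. -/
def parallelogram (z g g' : ℂ) : Set ℂ :=
  {w | ∃ s ∈ Icc (0 : ℝ) 1, ∃ t ∈ Icc (0 : ℝ) 1, w = z + s • g + t • g'}

/-! The proof squeezes the perimeter of `T` between two bounds that coincide, reads the shapes off
from the equality case, and recovers the lattice from the way the pieces fit together. Write `A₁`,
`A₂` for the two areas, `r = 1/p`, and `c = squareConst = π/3 + 1 - √3`, so that the curvilinear
square with arcs of radius `r` has area `c r²`.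

Lower bound. The divergence theorem holds on every region enclosed by a curved polygon
(`CurvedPolygon.Encloses.gaussGreen`). Tested against fields that approximate the outer normal, it
shows that the Caccioppoli perimeter is at least the length of the polygon; applied to the identity
field, it gives the area as a shoelace sum plus circular segments. With the angles forced by the
`120` degree condition, areas and lengths become explicit: the rectangle satisfies `A₁ ≤ c r²`
(`rectangle_area_bounds`), and half the length of the octagon is bounded below in terms of `A₂ + c
r²` (`chipped_half_length`). Together they give half the total length `≥ 2√(A₁ + A₂) + 2√(c A₁)`,
with equality only for square shapes (`rectangle_chipped_length`). The angle equations are only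
solved modulo `2π`; the spurious solution, with adjacent arcs of total angle `7π/3`, is never
excluded geometrically but is shown to be too long (`exotic_rectangle_bound`).

Upper bound. If the area ratio is below the stated threshold, curvilinear squares placed at the
points of a square lattice and the rest of the plane form a competitor of perimeter at most that
value (`exists_squareTiling`). The threshold says exactly that neighbouring squares do not touch.
Above it, the competitor with the two areas exchanged exists and is strictly shorter, which
contradicts the lower bound. Hence the ratio is below the threshold and all the inequalities are
equalities (`isoperimetric_rectangle_chipped`): all arcs have angle `π/6` and all flat edges have
the same length.

Lattice. Across almost every point of a concave edge of the octagon lies an arc of a translate of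
the first tile, because two edges in contact must have curvatures of sum `≥ 0`. Comparing tangents
at two well chosen contact points shows that the arcs face each other in full
(`exists_matching_edge`). So the four cut corners of the octagon are centers of translates of the
first tile, their differences lie in `G`, and `G` contains a square lattice of covolume `A₁ + A₂`;
by area it is all of `G` (`PeriodicTwoTiling.lattice_eq_squareLattice`). The octagon lies in a
fundamental square and has the area left over there by the first tile, so it is the complement. This
standard form depends, up to a motion, only on the side `L` and the radius `r`, and these are
determined by the areas. -/

/-! ### Arcs and normal coordinates along them -/

/-- The unit tangent of `arcPoint v τ κ` at arc length `s`. -/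
noncomputable def arcTangent (τ : ℂ) (κ s : ℝ) : ℂ := τ * exp ((κ * s : ℝ) * I)

theorem continuous_arcTangent (τ : ℂ) (κ : ℝ) : Continuous (arcTangent τ κ) := by
  unfold arcTangent; fun_prop

theorem norm_arcTangent {τ : ℂ} (hτ : ‖τ‖ = 1) (κ s : ℝ) : ‖arcTangent τ κ s‖ = 1 := by
  rw [arcTangent, norm_mul, hτ, Complex.norm_exp_ofReal_mul_I, one_mul]

theorem hasDerivAt_arcTangent (τ : ℂ) (κ s : ℝ) :
    HasDerivAt (arcTangent τ κ) (κ * (I * arcTangent τ κ s)) s := by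
  have h1 : HasDerivAt (fun s : ℝ => ((κ * s : ℝ) : ℂ) * I) ((κ * 1 : ℝ) * I) s :=
    (HasDerivAt.ofReal_comp ((hasDerivAt_id s).const_mul κ)).mul_const I
  refine ((h1.cexp).const_mul τ).congr_deriv ?_
  rw [arcTangent]
  push_cast; ring

theorem hasDerivAt_arcPoint (v τ : ℂ) (κ s : ℝ) :
    HasDerivAt (arcPoint v τ κ) (arcTangent τ κ s) s := by
  unfold arcPoint
  refine HasDerivAt.const_add v ?_
  exact intervalIntegral.integral_hasDerivAt_right
    ((continuous_arcTangent τ κ).intervalIntegrable _ _)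
    ((continuous_arcTangent τ κ).stronglyMeasurableAtFilter _ _)
    (continuous_arcTangent τ κ).continuousAt

theorem continuous_arcPoint (v τ : ℂ) (κ : ℝ) : Continuous (arcPoint v τ κ) :=
  continuous_iff_continuousAt.2 fun s => (hasDerivAt_arcPoint v τ κ s).continuousAt

@[simp] theorem arcPoint_zero (v τ : ℂ) (κ : ℝ) : arcPoint v τ κ 0 = v := by simp [arcPoint]

theorem arcPoint_flat (v τ : ℂ) (s : ℝ) : arcPoint v τ 0 s = v + s * τ := by
  simp [arcPoint]

theorem arcPoint_curved (v τ : ℂ) {κ : ℝ} (hκ : κ ≠ 0) (s : ℝ) :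
    arcPoint v τ κ s = v + I * τ / κ - I * arcTangent τ κ s / κ := by
  have hκ' : (κ : ℂ) ≠ 0 := by exact_mod_cast hκ
  have : (fun t : ℝ => τ * exp ((κ * t : ℝ) * I)) = fun t : ℝ => τ * exp ((κ * I) * t) := by
    ext t; push_cast; ring_nf
  rw [arcPoint, this, intervalIntegral.integral_const_mul, integral_exp_mul_complex (by simp [hκ]),
    arcTangent]
  have h3 : exp ((κ * s : ℝ) * I) = exp (κ * I * s) := by congr 1; push_cast; ring
  rw [h3]
  field_simp
  simp
  linear_combination (τ * exp (κ * I * s) - τ) * I_sq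

theorem contDiff_arcTangent (τ : ℂ) (κ : ℝ) : ContDiff ℝ 1 (arcTangent τ κ) := by
  unfold arcTangent
  have : ContDiff ℝ 1 (fun s : ℝ => ((κ * s : ℝ) : ℂ)) :=
    ofRealCLM.contDiff.comp (contDiff_const.mul contDiff_id)
  exact contDiff_const.mul ((this.mul contDiff_const).cexp)

theorem contDiff_arcPoint (v τ : ℂ) (κ : ℝ) : ContDiff ℝ 1 (arcPoint v τ κ) := by
  have h : deriv (arcPoint v τ κ) = arcTangent τ κ :=
    funext fun s => (hasDerivAt_arcPoint v τ κ s).deriv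
  refine contDiff_one_iff_deriv.2 ⟨fun s => (hasDerivAt_arcPoint v τ κ s).differentiableAt, ?_⟩
  rw [h]; exact continuous_arcTangent τ κ

/-- Normal coordinates along an arc: `s + i t` is sent to the point at distance `t` to the left of
the point at arc length `s`. -/
noncomputable def arcChart (v τ : ℂ) (κ : ℝ) (z : ℂ) : ℂ :=
  arcPoint v τ κ z.re + z.im * (I * arcTangent τ κ z.re)

theorem arcChart_ofReal (v τ : ℂ) (κ s : ℝ) : arcChart v τ κ s = arcPoint v τ κ s := by
  simp [arcChart]

/-- The derivative of `arcChart` at `z`. -/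
noncomputable def arcChartDeriv (τ : ℂ) (κ : ℝ) (z : ℂ) : ℂ →L[ℝ] ℂ :=
  reCLM.smulRight ((1 - κ * z.im : ℝ) * arcTangent τ κ z.re) +
    imCLM.smulRight (I * arcTangent τ κ z.re)

theorem contDiff_arcChart (v τ : ℂ) (κ : ℝ) : ContDiff ℝ 1 (arcChart v τ κ) := by
  unfold arcChart
  have hre : ContDiff ℝ 1 (fun z : ℂ => z.re) := reCLM.contDiff
  have him : ContDiff ℝ 1 (fun z : ℂ => (z.im : ℂ)) := ofRealCLM.contDiff.comp imCLM.contDiff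
  exact ((contDiff_arcPoint v τ κ).comp hre).add
    (him.mul (contDiff_const.mul ((contDiff_arcTangent τ κ).comp hre)))

theorem hasFDerivAt_arcChart (v τ : ℂ) (κ : ℝ) (z : ℂ) :
    HasFDerivAt (arcChart v τ κ) (arcChartDeriv τ κ z) z := by
  have hre : HasFDerivAt (fun z : ℂ => z.re) reCLM z := reCLM.hasFDerivAt
  have him : HasFDerivAt (fun z : ℂ => (z.im : ℂ)) (ofRealCLM.comp imCLM) z :=
    (ofRealCLM.comp imCLM).hasFDerivAt
  have h1 := (hasDerivAt_arcPoint v τ κ z.re).hasFDerivAt.comp z hre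
  have h2 := ((hasDerivAt_arcTangent τ κ z.re).hasFDerivAt.comp z hre).const_mul I
  have h3 := h1.add (him.mul h2)
  refine h3.congr_fderiv ?_
  ext <;> simp [arcChartDeriv]
  rename_i x
  linear_combination x.re * κ * z.im * arcTangent τ κ z.re * I_sq

theorem det_arcChartDeriv {τ : ℂ} (hτ : ‖τ‖ = 1) (κ : ℝ) (z : ℂ) :
    (arcChartDeriv τ κ z).det = 1 - κ * z.im := by
  have h1 := norm_arcTangent hτ κ z.re
  have h2 : (arcTangent τ κ z.re).re ^ 2 + (arcTangent τ κ z.re).im ^ 2 = 1 := by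
    have := Complex.sq_norm (arcTangent τ κ z.re)
    rw [h1, normSq_apply] at this; linarith
  rw [ContinuousLinearMap.det, ← LinearMap.det_toMatrix Complex.basisOneI, Matrix.det_fin_two]
  simp [LinearMap.toMatrix_apply, arcChartDeriv]
  linear_combination (1 - κ * z.im) * h2

/-- The left side is a multiple of the power of the point with respect to the circle carrying the
arc, normalised so that it also makes sense for a line. It therefore does not depend on the base
point `s₀`, only on the signed distance `z.im` to the arc. -/
theorem arcChart_sub_arcPoint {τ : ℂ} (hτ : ‖τ‖ = 1) (v : ℂ) (κ s₀ : ℝ) (z : ℂ) :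
    inner ℝ (I * arcTangent τ κ s₀) (arcChart v τ κ z - arcPoint v τ κ s₀)
      - κ / 2 * ‖arcChart v τ κ z - arcPoint v τ κ s₀‖ ^ 2 = z.im - κ / 2 * z.im ^ 2 := by
  have hn : ∀ s, (arcTangent τ κ s).re ^ 2 + (arcTangent τ κ s).im ^ 2 = 1 := fun s => by
    have := Complex.sq_norm (arcTangent τ κ s)
    rw [norm_arcTangent hτ, normSq_apply] at this; linarith
  rw [Complex.inner, Complex.sq_norm, normSq_apply]
  by_cases hκ : κ = 0
  · subst hκ
    have h0 : ∀ s, arcTangent τ 0 s = τ := fun s => by simp [arcTangent]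
    have h := hn 0
    simp only [arcChart, arcPoint_flat, h0] at h ⊢
    simp
    linear_combination z.im * h
  · have h0 := hn s₀
    have h1 := hn z.re
    set a := arcTangent τ κ s₀ with ha
    set b := arcTangent τ κ z.re with hb
    have e : arcChart v τ κ z - arcPoint v τ κ s₀ = I * ((a - b) * ((κ⁻¹ : ℝ) : ℂ) + z.im * b) := by
      rw [arcChart, arcPoint_curved v τ hκ, arcPoint_curved v τ hκ, ← ha, ← hb]
      push_cast
      field_simp
      ring
    rw [e]
    simp
    field_simp
    linear_combination (1 : ℝ) * h0 + (-1 + 2 * κ * z.im - κ ^ 2 * z.im ^ 2) * h1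

/-! ### Local structure of an enclosed region along its edges -/

/-- The open rectangle of half-width `ε` around the real point `s`. -/
def boxAround (s ε : ℝ) : Set ℂ := Ioo (s - ε) (s + ε) ×ℂ Ioo (-ε) ε

theorem mem_boxAround {s ε : ℝ} {z : ℂ} :
    z ∈ boxAround s ε ↔ (s - ε < z.re ∧ z.re < s + ε) ∧ -ε < z.im ∧ z.im < ε := by
  simp [boxAround, mem_reProdIm]

theorem isOpen_boxAround (s ε : ℝ) : IsOpen (boxAround s ε) := isOpen_Ioo.reProdIm isOpen_Ioo

theorem boxAround_mono (s : ℝ) {ε ε' : ℝ} (h : ε ≤ ε') : boxAround s ε ⊆ boxAround s ε' := by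
  intro z; simp only [mem_boxAround]; rintro ⟨⟨h1, h2⟩, h3, h4⟩
  refine ⟨⟨?_, ?_⟩, ?_, ?_⟩ <;> linarith

theorem exists_boxAround_subset {s : ℝ} {U : Set ℂ} (hU : U ∈ 𝓝 (s : ℂ)) :
    ∃ ε > 0, boxAround s ε ⊆ U := by
  obtain ⟨ρ, hρ, h⟩ := Metric.mem_nhds_iff.1 hU
  refine ⟨ρ / 2, by positivity, fun z hz => h ?_⟩
  rw [mem_boxAround] at hz
  rw [Metric.mem_ball, dist_eq_norm]
  refine (Complex.norm_le_abs_re_add_abs_im _).trans_lt ?_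
  have h1 : |(z - s).re| < ρ / 2 := by rw [abs_lt]; simp; constructor <;> linarith [hz.1.1, hz.1.2]
  have h2 : |(z - s).im| < ρ / 2 := by rw [abs_lt]; simp; constructor <;> linarith [hz.2.1, hz.2.2]
  linarith

theorem IsPreconnected.subset_interior_or_disjoint {X : Type*} [TopologicalSpace X] {s R : Set X}
    (hs : IsPreconnected s) (h : Disjoint s (frontier R)) : s ⊆ interior R ∨ Disjoint s R := by
  have hcov : s ⊆ interior R ∪ (closure R)ᶜ := by
    intro x hx
    by_cases h1 : x ∈ interior R
    · exact Or.inl h1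
    · exact Or.inr fun h2 => h.le_bot ⟨hx, h2, h1⟩
  by_cases hne : (s ∩ interior R).Nonempty
  · left
    refine hs.subset_left_of_subset_union isOpen_interior isClosed_closure.isOpen_compl ?_ hcov hne
    exact disjoint_compl_right.mono_left (interior_subset.trans subset_closure)
  · right
    rw [Set.disjoint_left]
    intro x hx hR
    rcases hcov hx with h1 | h1
    · exact hne ⟨x, hx, h1⟩
    · exact h1 (subset_closure hR)

theorem convex_reProdIm {s t : Set ℝ} (hs : Convex ℝ s) (ht : Convex ℝ t) : Convex ℝ (s ×ℂ t) :=
  (hs.linear_preimage reLm).inter (ht.linear_preimage imLm)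

namespace CurvedPolygon

variable {n : ℕ} [NeZero n] (P : CurvedPolygon n)

/-- The point of the `i`-th edge at arc length `s`. -/
noncomputable def point (i : Fin n) (s : ℝ) : ℂ :=
  arcPoint (P.vertex i) (P.dir i) (P.curv i) s

/-- The unit tangent of the `i`-th edge at arc length `s`. -/
noncomputable def tangent (i : Fin n) (s : ℝ) : ℂ := arcTangent (P.dir i) (P.curv i) s

/-- Normal coordinates along the `i`-th edge. -/
noncomputable def chart (i : Fin n) : ℂ → ℂ := arcChart (P.vertex i) (P.dir i) (P.curv i)

theorem continuous_point (i : Fin n) : Continuous (P.point i) := continuous_arcPoint _ _ _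

theorem continuous_tangent (i : Fin n) : Continuous (P.tangent i) := continuous_arcTangent _ _

theorem norm_tangent (i : Fin n) (s : ℝ) : ‖P.tangent i s‖ = 1 := norm_arcTangent (P.norm_dir i) _ _

theorem continuous_chart (i : Fin n) : Continuous (P.chart i) := (contDiff_arcChart _ _ _).continuous

theorem chart_ofReal (i : Fin n) (s : ℝ) : P.chart i s = P.point i s := arcChart_ofReal _ _ _ _

theorem point_zero (i : Fin n) : P.point i 0 = P.vertex i := arcPoint_zero _ _ _

theorem point_len (i : Fin n) : P.point i (P.len i) = P.vertex (i + 1) := P.vertex_succ i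

theorem isCompact_edge (i : Fin n) : IsCompact (P.edge i) :=
  isCompact_Icc.image (P.continuous_point i)

/-- `simple` only compares half-open edges. The missing endpoint of edge `j` is the start of edge `j
+ 1`, and a start is never an inner point of an edge. -/
theorem eq_of_point_eq {i j : Fin n} {s t : ℝ} (hs : s ∈ Ioo 0 (P.len i))
    (ht : t ∈ Icc 0 (P.len j)) (h : P.point i s = P.point j t) : i = j ∧ s = t := by
  rcases ht.2.lt_or_eq with h1 | h1
  · exact P.simple i j s ⟨hs.1.le, hs.2⟩ t ⟨ht.1, h1⟩ h
  · rw [h1, P.point_len, ← P.point_zero] at h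
    have := P.simple i (j + 1) s ⟨hs.1.le, hs.2⟩ 0 ⟨le_rfl, P.len_pos _⟩ h
    exact absurd this.2 hs.1.ne'

variable {P} {R : Set ℂ}

theorem Encloses.isCompact (h : P.Encloses R) : IsCompact R := h.1

theorem Encloses.closure_interior (h : P.Encloses R) : closure (interior R) = R := h.2.1

theorem Encloses.frontier_eq (h : P.Encloses R) : frontier R = ⋃ i, P.edge i := h.2.2.1

theorem Encloses.point_mem_frontier (h : P.Encloses R) {i : Fin n} {s : ℝ}
    (hs : s ∈ Icc 0 (P.len i)) : P.point i s ∈ frontier R := by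
  rw [h.frontier_eq]
  exact mem_iUnion.2 ⟨i, s, hs, rfl⟩

theorem Encloses.eventually_chart_mem (h : P.Encloses R) {i : Fin n} {s : ℝ}
    (hs : s ∈ Ioo 0 (P.len i)) : ∀ᶠ ε : ℝ in 𝓝[>] 0, P.chart i (s + ε * I) ∈ interior R := by
  filter_upwards [h.2.2.2 i s hs] with ε hε
  simpa [chart, arcChart, arcTangent] using hε

/-- Inverse function theorem: the Jacobian `1 - κ t` of normal coordinates is `1` on the curve
itself. -/
theorem exists_injOn_chart (P : CurvedPolygon n) (i : Fin n) (s : ℝ) :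
    ∃ ε > 0, InjOn (P.chart i) (boxAround s ε) ∧
      ∀ ε' ≤ ε, IsOpen (P.chart i '' boxAround s ε') := by
  have hd : HasStrictFDerivAt (P.chart i) (arcChartDeriv (P.dir i) (P.curv i) s) (s : ℂ) :=
    (contDiff_arcChart _ _ _).contDiffAt.hasStrictFDerivAt' (hasFDerivAt_arcChart _ _ _ _) (by simp)
  have hdet : (arcChartDeriv (P.dir i) (P.curv i) s).det ≠ 0 := by
    rw [det_arcChartDeriv (P.norm_dir i)]; simp
  let e := ContinuousLinearMap.toContinuousLinearEquivOfDetNeZero _ hdet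
  have hd' : HasStrictFDerivAt (P.chart i) (e : ℂ →L[ℝ] ℂ) (s : ℂ) := hd
  obtain ⟨ε, hε, hsub⟩ := exists_boxAround_subset 
    ((hd'.toOpenPartialHomeomorph (P.chart i)).open_source.mem_nhds
      hd'.mem_toOpenPartialHomeomorph_source)
  refine ⟨ε, hε, ?_, fun ε' h => ?_⟩
  · exact (hd'.toOpenPartialHomeomorph (P.chart i)).injOn.mono hsub
  · exact (hd'.toOpenPartialHomeomorph (P.chart i)).isOpen_image_of_subset_source
      (isOpen_boxAround _ _) ((boxAround_mono s h).trans hsub)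

theorem mem_nhds_boxAround (s : ℝ) {ε : ℝ} (hε : 0 < ε) : boxAround s ε ∈ 𝓝 (s : ℂ) :=
  (isOpen_boxAround s ε).mem_nhds (by rw [mem_boxAround]; simp [hε])

/-- Near an inner point of an edge, the region is the left side of the edge. -/
theorem Encloses.exists_chart (h : P.Encloses R) {i : Fin n} {s : ℝ} (hs : s ∈ Ioo 0 (P.len i)) :
    ∃ ε > 0, ε ≤ s ∧ s + ε ≤ P.len i ∧ |P.curv i| * ε ≤ 1 ∧ InjOn (P.chart i) (boxAround s (2 * ε)) ∧
      IsOpen (P.chart i '' boxAround s ε) ∧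
      (∀ z ∈ boxAround s ε, 0 < z.im → P.chart i z ∈ interior R) ∧
      (∀ z ∈ boxAround s ε, z.im < 0 → P.chart i z ∉ R) := by
  obtain ⟨ε₁, hε₁, hinj, hopen⟩ := P.exists_injOn_chart i s
  -- All of the boundary except a short piece of edge `i` around `s`. It is closed and misses the
  -- point at `s`, so a small box stays away from it.
  let C : Set ℂ := (⋃ j ∈ ({i}ᶜ : Set (Fin n)), P.edge j) ∪
    (P.point i '' Icc 0 (s - ε₁ / 2) ∪ P.point i '' Icc (s + ε₁ / 2) (P.len i))
  have hCc : IsClosed C :=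
    ((toFinite _).isClosed_biUnion fun j _ => (P.isCompact_edge j).isClosed).union
      (((isCompact_Icc.image (P.continuous_point i)).isClosed).union
        ((isCompact_Icc.image (P.continuous_point i)).isClosed))
  have hq : P.chart i s ∉ C := by
    rw [chart_ofReal]
    rintro (hc | ⟨t, ht, hc⟩ | ⟨t, ht, hc⟩)
    · simp only [mem_iUnion] at hc
      obtain ⟨j, hj, t, ht, hc⟩ := hc
      exact hj (P.eq_of_point_eq hs ht hc.symm).1.symm
    · have := (P.eq_of_point_eq hs ⟨ht.1, by linarith [ht.2, hs.2]⟩ hc.symm).2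
      linarith [ht.2]
    · have := (P.eq_of_point_eq hs ⟨by linarith [ht.1, hs.1], ht.2⟩ hc.symm).2
      linarith [ht.1]
  obtain ⟨ε₂, hε₂, hsub⟩ := exists_boxAround_subset
    ((P.continuous_chart i).continuousAt.preimage_mem_nhds (hCc.isOpen_compl.mem_nhds hq))
  obtain ⟨ε, hε, he1, he2, he3, he4, he5⟩ : ∃ ε > 0, ε ≤ ε₁ ∧ ε ≤ ε₂ ∧ ε ≤ s ∧ ε ≤ P.len i - s ∧
      |P.curv i| * ε ≤ 1 := by
    have h0 : 0 < |P.curv i| + 1 := by positivity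
    refine ⟨min (min ε₁ ε₂) (min (min s (P.len i - s)) (1 / (|P.curv i| + 1))), ?_, ?_, ?_, ?_, ?_, ?_⟩
    · have := hs.1; have := sub_pos.2 hs.2; positivity
    · exact (min_le_left _ _).trans (min_le_left _ _)
    · exact (min_le_left _ _).trans (min_le_right _ _)
    · exact (min_le_right _ _).trans ((min_le_left _ _).trans (min_le_left _ _))
    · exact (min_le_right _ _).trans ((min_le_left _ _).trans (min_le_right _ _))
    · refine (mul_le_mul_of_nonneg_left ((min_le_right _ _).trans (min_le_right _ _))
        (abs_nonneg _)).trans ?_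
      rw [mul_one_div, div_le_one h0]; linarith
  have hinj' : InjOn (P.chart i) (boxAround s ε) := hinj.mono (boxAround_mono s he1)
  have hfr : ∀ z ∈ boxAround s ε, P.chart i z ∈ frontier R → z.im = 0 := by
    intro z hz hf
    have hz' := hsub (boxAround_mono s he2 hz)
    rw [h.frontier_eq] at hf
    obtain ⟨j, t, ht, htz⟩ := mem_iUnion.1 hf
    have hz'' : P.chart i z ∉ C := hz'
    by_cases hj : j = i
    · subst hj
      have h1 : s - ε₁ / 2 < t := by
        by_contra hcon
        exact hz'' (Or.inr (Or.inl ⟨t, ⟨ht.1, not_lt.1 hcon⟩, htz⟩))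
      have h2 : t < s + ε₁ / 2 := by
        by_contra hcon
        exact hz'' (Or.inr (Or.inr ⟨t, ⟨not_lt.1 hcon, ht.2⟩, htz⟩))
      have h3 : z = (t : ℂ) := by
        refine hinj (boxAround_mono s he1 hz) ?_ ?_
        · rw [mem_boxAround]; simp [hε₁]; constructor <;> linarith
        · rw [chart_ofReal]; exact htz.symm
      rw [h3]; simp
    · exact (hz'' (Or.inl (mem_biUnion (show j ∈ ({i}ᶜ : Set _) from hj)
        (show _ ∈ P.edge j from ⟨t, ht, htz⟩)))).elim
  -- The upper half box is connected and misses the frontier, so it is inside or outside; the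
  -- orientation clause of `Encloses` decides.
  have hup : P.chart i '' (Ioo (s - ε) (s + ε) ×ℂ Ioo 0 ε) ⊆ interior R := by
    have hc : IsPreconnected (P.chart i '' (Ioo (s - ε) (s + ε) ×ℂ Ioo 0 ε)) :=
      ((convex_reProdIm (convex_Ioo _ _) (convex_Ioo _ _)).isPreconnected).image _
        (P.continuous_chart i).continuousOn
    have hd : Disjoint (P.chart i '' (Ioo (s - ε) (s + ε) ×ℂ Ioo 0 ε)) (frontier R) := by
      rw [Set.disjoint_left]
      rintro _ ⟨z, hz, rfl⟩ hzf
      rw [mem_reProdIm] at hz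
      have := hfr z (by rw [mem_boxAround]; exact ⟨hz.1, by linarith [hz.2.1], hz.2.2⟩) hzf
      linarith [hz.2.1]
    rcases hc.subset_interior_or_disjoint hd with h1 | h1
    · exact h1
    · exfalso
      have hev : ∀ᶠ δ : ℝ in 𝓝[>] 0, δ ∈ Ioo 0 ε := Ioo_mem_nhdsGT hε
      obtain ⟨δ, hδ, hδ'⟩ := (hev.and (h.eventually_chart_mem hs)).exists
      refine h1.le_bot ⟨⟨s + δ * I, ?_, rfl⟩, interior_subset hδ'⟩
      simp only [mem_reProdIm]; simp [hε]; exact hδ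
  -- If the lower half were inside too, the whole open box would lie in `R`, and the boundary point
  -- at `s` would be interior.
  have hdown : Disjoint (P.chart i '' (Ioo (s - ε) (s + ε) ×ℂ Ioo (-ε) 0)) R := by
    have hc : IsPreconnected (P.chart i '' (Ioo (s - ε) (s + ε) ×ℂ Ioo (-ε) 0)) :=
      ((convex_reProdIm (convex_Ioo _ _) (convex_Ioo _ _)).isPreconnected).image _
        (P.continuous_chart i).continuousOn
    have hd : Disjoint (P.chart i '' (Ioo (s - ε) (s + ε) ×ℂ Ioo (-ε) 0)) (frontier R) := by
      rw [Set.disjoint_left]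
      rintro _ ⟨z, hz, rfl⟩ hzf
      rw [mem_reProdIm] at hz
      have := hfr z (by rw [mem_boxAround]; exact ⟨hz.1, hz.2.1, by linarith [hz.2.2]⟩) hzf
      linarith [hz.2.2]
    rcases hc.subset_interior_or_disjoint hd with h1 | h1
    · exfalso
      have hsubR : P.chart i '' boxAround s ε ⊆ R := by
        rintro _ ⟨z, hz, rfl⟩
        have hz' := hz
        rw [mem_boxAround] at hz'
        rcases lt_trichotomy z.im 0 with h2 | h2 | h2
        · exact interior_subset (h1 ⟨z, ⟨hz'.1, hz'.2.1, h2⟩, rfl⟩)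
        · have : z = (z.re : ℂ) := by apply Complex.ext <;> simp [h2]
          rw [this, chart_ofReal]
          refine h.isCompact.isClosed.frontier_subset (h.point_mem_frontier ⟨?_, ?_⟩) <;>
            linarith [hz'.1.1, hz'.1.2]
        · exact interior_subset (hup ⟨z, ⟨hz'.1, h2, hz'.2.2⟩, rfl⟩)
      have hmem : P.chart i s ∈ interior R :=
        interior_maximal hsubR (hopen ε he1) ⟨s, mem_of_mem_nhds (mem_nhds_boxAround s hε), rfl⟩
      rw [chart_ofReal] at hmem
      exact (h.point_mem_frontier ⟨hs.1.le, hs.2.le⟩).2 hmem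
    · exact h1
  -- The box is halved because injectivity is wanted on a box twice as large.
  have hhalf : boxAround s (ε / 2) ⊆ boxAround s ε := boxAround_mono s (by linarith)
  refine ⟨ε / 2, half_pos hε, by linarith, by linarith, ?_, ?_, hopen _ (by linarith), ?_, ?_⟩
  · exact (mul_le_mul_of_nonneg_left (half_le_self hε.le) (abs_nonneg _)).trans he5
  · rwa [mul_div_cancel₀ _ (two_ne_zero' ℝ)]
  · intro z hz hzi
    replace hz := hhalf hz
    rw [mem_boxAround] at hz
    exact hup ⟨z, ⟨hz.1, hzi, hz.2.2⟩, rfl⟩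
  · intro z hz hzi hR
    replace hz := hhalf hz
    rw [mem_boxAround] at hz
    exact hdown.le_bot ⟨⟨z, ⟨hz.1, hz.2.1, hzi⟩, rfl⟩, hR⟩

/-- The edge through a boundary point with inward unit normal `m` and curvature `κ` is described
near that point by the sign of `⟪w, m⟫ - κ |w|² / 2`. -/
theorem Encloses.eventually_mem_interior_iff (h : P.Encloses R) {i : Fin n} {s : ℝ}
    (hs : s ∈ Ioo 0 (P.len i)) : ∀ᶠ w in 𝓝 (0 : ℂ),
      (0 < inner ℝ (I * P.tangent i s) w - P.curv i / 2 * ‖w‖ ^ 2 → P.point i s + w ∈ interior R) ∧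
      (inner ℝ (I * P.tangent i s) w - P.curv i / 2 * ‖w‖ ^ 2 < 0 → P.point i s + w ∉ R) := by
  obtain ⟨ε, hε, -, -, h3, -, hop, hpos, hneg⟩ := h.exists_chart hs
  have hnh : P.chart i '' boxAround s ε ∈ 𝓝 (P.point i s + 0) := by
    rw [add_zero, ← chart_ofReal]
    exact hop.mem_nhds ⟨s, mem_of_mem_nhds (mem_nhds_boxAround s hε), rfl⟩
  filter_upwards [(continuous_const_add (P.point i s)).continuousAt.preimage_mem_nhds hnh] with w hw
  obtain ⟨z, hz, hzw⟩ := hw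
  have hzw : P.chart i z = P.point i s + w := hzw
  have hw' : w = P.chart i z - P.point i s := by rw [hzw]; ring
  have key := arcChart_sub_arcPoint (P.norm_dir i) (P.vertex i) (P.curv i) s z
  change inner ℝ (I * P.tangent i s) (P.chart i z - P.point i s)
      - P.curv i / 2 * ‖P.chart i z - P.point i s‖ ^ 2 = _ at key
  rw [← hw'] at key
  rw [key, ← hzw]
  have hz' := hz
  rw [mem_boxAround] at hz'
  -- Since `|κ| ε ≤ 1`, the function `t - κ t² / 2` has the sign of `t` in the box.
  have hfac : 0 < 1 - P.curv i / 2 * z.im := by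
    have h4 : |P.curv i * z.im| ≤ 1 := by
      rw [abs_mul]
      exact (mul_le_mul_of_nonneg_left (abs_le.2 ⟨hz'.2.1.le, hz'.2.2.le⟩) (abs_nonneg _)).trans h3
    have := (abs_le.1 h4).2
    linarith
  have hid : z.im - P.curv i / 2 * z.im ^ 2 = z.im * (1 - P.curv i / 2 * z.im) := by ring
  rw [hid]
  refine ⟨fun hp => hpos z hz (pos_of_mul_pos_left hp hfac.le), fun hn => hneg z hz ?_⟩
  by_contra hcon
  exact absurd (mul_nonneg (not_lt.1 hcon) hfac.le) (not_le.2 hn)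

end CurvedPolygon

/-! ### Divergence of plane fields and the divergence theorem in a chart -/

/-- The divergence is the trace of the derivative, here computed in the orthonormal basis `τ`, `I *
τ`. -/
theorem planeDiv_eq_inner (φ : ℂ → ℂ) (z : ℂ) {τ : ℂ} (hτ : ‖τ‖ = 1) :
    planeDiv φ z = inner ℝ (fderiv ℝ φ z τ) τ + inner ℝ (fderiv ℝ φ z (I * τ)) (I * τ) := by
  have h2 : τ.re ^ 2 + τ.im ^ 2 = 1 := by
    have := Complex.sq_norm τ
    rw [hτ, normSq_apply] at this; linarith
  have e1 : τ = τ.re • (1 : ℂ) + τ.im • I := by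
    apply Complex.ext <;> simp
  have e2 : I * τ = (-τ.im) • (1 : ℂ) + τ.re • I := by
    apply Complex.ext <;> simp
  have f1 : fderiv ℝ φ z τ = τ.re • fderiv ℝ φ z 1 + τ.im • fderiv ℝ φ z I := by
    conv_lhs => rw [e1]
    simp only [map_add, map_smul]
  have f2 : fderiv ℝ φ z (I * τ) = (-τ.im) • fderiv ℝ φ z 1 + τ.re • fderiv ℝ φ z I := by
    conv_lhs => rw [e2]
    simp only [map_add, map_smul]
  rw [f1, f2, planeDiv, Complex.inner, Complex.inner]
  simp
  linear_combination -((fderiv ℝ φ z 1).re + (fderiv ℝ φ z I).im) * h2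

theorem continuous_planeDiv {φ : ℂ → ℂ} (hφ : ContDiff ℝ 1 φ) : Continuous (planeDiv φ) := by
  have h := hφ.continuous_fderiv (by norm_num)
  unfold planeDiv
  exact (continuous_re.comp (h.clm_apply continuous_const)).add
    (continuous_im.comp (h.clm_apply continuous_const))

theorem planeDiv_eq_zero_of_notMem_tsupport {φ : ℂ → ℂ} {z : ℂ} (hz : z ∉ tsupport φ) :
    planeDiv φ z = 0 := by
  have : fderiv ℝ φ z = 0 := by
    by_contra hne
    exact hz (support_fderiv_subset ℝ hne)
  simp [planeDiv, this]

theorem planeDiv_add {φ ψ : ℂ → ℂ} (hφ : ContDiff ℝ 1 φ) (hψ : ContDiff ℝ 1 ψ) (z : ℂ) :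
    planeDiv (fun z => φ z + ψ z) z = planeDiv φ z + planeDiv ψ z := by
  have h : fderiv ℝ (fun z => φ z + ψ z) z = fderiv ℝ φ z + fderiv ℝ ψ z :=
    fderiv_fun_add (hφ.differentiable (by norm_num) z) (hψ.differentiable (by norm_num) z)
  simp only [planeDiv, h]
  simp; ring

theorem planeDiv_smul {f : ℂ → ℝ} {φ : ℂ → ℂ} (hf : ContDiff ℝ 1 f) (hφ : ContDiff ℝ 1 φ) (z : ℂ) :
    planeDiv (fun z => f z • φ z) z = f z * planeDiv φ z + fderiv ℝ f z (φ z) := by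
  have h : fderiv ℝ (fun z => f z • φ z) z = f z • fderiv ℝ φ z + (fderiv ℝ f z).smulRight (φ z) :=
    fderiv_fun_smul (hf.differentiable (by norm_num) z) (hφ.differentiable (by norm_num) z)
  have e1 : φ z = (φ z).re • (1 : ℂ) + (φ z).im • I := by
    apply Complex.ext <;> simp
  have f1 : fderiv ℝ f z (φ z) = (φ z).re • fderiv ℝ f z 1 + (φ z).im • fderiv ℝ f z I := by
    conv_lhs => rw [e1]
    simp only [map_add, map_smul]
  simp only [planeDiv, h, f1]
  simp; ring

theorem hasCompactSupport_planeDiv {φ : ℂ → ℂ} (h : HasCompactSupport φ) :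
    HasCompactSupport (planeDiv φ) :=
  HasCompactSupport.intro h fun _ hz => planeDiv_eq_zero_of_notMem_tsupport hz

theorem integral_planeDiv_eq_zero {φ : ℂ → ℂ} (hφ : ContDiff ℝ 1 φ) (hc : HasCompactSupport φ) :
    ∫ z, planeDiv φ z = 0 := by
  have hi : ∀ v, Integrable (fun z => fderiv ℝ φ z v) := by
    intro v
    refine Continuous.integrable_of_hasCompactSupport
        ((hφ.continuous_fderiv (by norm_num)).clm_apply continuous_const) ?_
    refine HasCompactSupport.intro hc fun z hz => ?_
    have : fderiv ℝ φ z = 0 := by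
      by_contra hne
      exact hz (support_fderiv_subset ℝ hne)
    simp [this]
  have key : ∀ v, ∫ z, fderiv ℝ φ z v = 0 := by
    intro v
    have := integral_smul_fderiv_eq_neg_fderiv_smul_of_integrable (𝕜 := ℝ) (μ := (volume : Measure ℂ))
      (f := fun _ : ℂ => (1 : ℝ)) (g := φ) (v := v) (by simp) (by simpa using hi v)
      (by simpa using hφ.continuous.integrable_of_hasCompactSupport hc)
      (fun _ _ => differentiableAt_const _) (fun x _ => hφ.differentiable (by norm_num) x)
    simpa using this
  have h1 := integral_re (hi 1)
  have h2 := integral_im (hi I)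
  have h3 := integral_add (hi 1).re (hi I).im
  simp only [RCLike.re_to_complex, RCLike.im_to_complex, key] at h1 h2 h3
  unfold planeDiv
  rw [h3, h1, h2]; simp

/-- The divergence theorem on a rectangle in normal coordinates along an arc, for a field that
vanishes on the three sides away from the arc. -/
theorem integral_planeDiv_arcChart {v τ : ℂ} (hτ : ‖τ‖ = 1) (κ : ℝ) {φ : ℂ → ℂ}
    (hφ : ContDiff ℝ 1 φ) {a b ε : ℝ} (hab : a ≤ b) (hε : 0 ≤ ε)
    (htop : ∀ s ∈ Icc a b, φ (arcChart v τ κ (s + ε * I)) = 0)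
    (hleft : ∀ t ∈ Icc 0 ε, φ (arcChart v τ κ (a + t * I)) = 0)
    (hright : ∀ t ∈ Icc 0 ε, φ (arcChart v τ κ (b + t * I)) = 0) :
    ∫ s in a..b, ∫ t in (0 : ℝ)..ε, (1 - κ * t) * planeDiv φ (arcChart v τ κ (s + t * I)) =
      ∫ s in a..b, inner ℝ (φ (arcPoint v τ κ s)) (-I * arcTangent τ κ s) := by
  let T : ℂ → ℂ := fun z => arcTangent τ κ z.re
  have hT : ∀ z, HasFDerivAt T (reCLM.smulRight (κ * (I * T z) : ℂ)) z := fun z => by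
    refine ((hasDerivAt_arcTangent τ κ z.re).hasFDerivAt.comp z reCLM.hasFDerivAt).congr_fderiv ?_
    ext <;> simp [T]
  have hIT : ∀ z, HasFDerivAt (fun z => I * T z) (reCLM.smulRight (-(κ * T z) : ℂ)) z := fun z => by
    refine ((hT z).const_mul I).congr_fderiv ?_
    ext <;> simp
    rename_i x
    linear_combination x.re * κ * T z * I_sq
  have hφΨ : ∀ z, HasFDerivAt (fun z => φ (arcChart v τ κ z))
      ((fderiv ℝ φ (arcChart v τ κ z)).comp (arcChartDeriv τ κ z)) z := fun z =>
    ((hφ.differentiable (by norm_num) _).hasFDerivAt).comp z (hasFDerivAt_arcChart v τ κ z)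
  let e := equivRealProdCLM.symm
  have he : ∀ s t : ℝ, e (s, t) = s + t * I := fun s t => equivRealProdCLM_symm_apply (s, t)
  -- `F` and `G` are the components of the field pulled back as a flux density: through a line `s =
  -- const` the flux is `⟪φ, T⟫ dt`, and through `t = const` it is `(1 - κ t) ⟪φ, I T⟫ ds`. Their
  -- divergence in `(s, t)` is the Jacobian times the divergence of `φ`.
  let F : ℂ → ℝ := fun z => inner ℝ (φ (arcChart v τ κ z)) (T z)
  let G : ℂ → ℝ := fun z => (1 - κ * z.im) * inner ℝ (φ (arcChart v τ κ z)) (I * T z)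
  have hF := fun z => (hφΨ z).inner ℝ (hT z)
  have hlin : ∀ z : ℂ, HasFDerivAt (fun z : ℂ => 1 - κ * z.im) (-(κ • imCLM)) z := fun z =>
    (imCLM.hasFDerivAt.const_mul κ).const_sub 1
  have hG := fun z => (hlin z).mul ((hφΨ z).inner ℝ (hIT z))
  have key : ∀ z, fderiv ℝ F z 1 + fderiv ℝ G z I = (1 - κ * z.im) * planeDiv φ (arcChart v τ κ z) := by
    intro z
    have h1 : fderiv ℝ F z = _ := (hF z).fderiv
    have h2 : fderiv ℝ G z = _ := (hG z).fderiv
    rw [h1, h2, planeDiv_eq_inner φ _ (norm_arcTangent hτ κ z.re)]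
    have e1 : arcChartDeriv τ κ z 1 = (1 - κ * z.im) • arcTangent τ κ z.re := by
      simp [arcChartDeriv]
    have e2 : arcChartDeriv τ κ z I = I * arcTangent τ κ z.re := by
      simp [arcChartDeriv]
    simp only [ContinuousLinearMap.comp_apply, ContinuousLinearMap.prod_apply, fderivInnerCLM_apply,
      e1, e2, add_apply, smul_apply,
      ContinuousLinearMap.smulRight_apply, neg_apply, map_smul, reCLM_apply,
      imCLM_apply, one_re, I_im, I_re, T]
    simp only [inner_smul_left, zero_smul, one_smul, inner_zero_right, smul_eq_mul]
    have e3 : (κ * (I * arcTangent τ κ z.re) : ℂ) = κ • (I * arcTangent τ κ z.re) := by simp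
    rw [e3, inner_smul_right]
    simp
    ring
  have hcF : Continuous F := continuous_iff_continuousAt.2 fun z => (hF z).continuousAt
  have hcG : Continuous G := continuous_iff_continuousAt.2 fun z => (hG z).continuousAt
  have hdiv := integral2_divergence_prod_of_hasFDerivAt_off_countable (F ∘ e) (G ∘ e)
    (fun p => (fderiv ℝ F (e p)).comp (e : ℝ × ℝ →L[ℝ] ℂ))
    (fun p => (fderiv ℝ G (e p)).comp (e : ℝ × ℝ →L[ℝ] ℂ)) a 0 b ε ∅ countable_empty
    (hcF.comp e.continuous).continuousOn (hcG.comp e.continuous).continuousOn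
    (fun p _ => (hF (e p)).differentiableAt.hasFDerivAt.comp p e.hasFDerivAt)
    (fun p _ => (hG (e p)).differentiableAt.hasFDerivAt.comp p e.hasFDerivAt) ?_
  · have e1 : e (1, 0) = 1 := by simp [he]
    have e2 : e (0, 1) = I := by simp [he]
    simp only [ContinuousLinearMap.comp_apply, ContinuousLinearEquiv.coe_coe, e1, e2, key, he,
      Function.comp_apply] at hdiv
    have z1 : ∫ x in a..b, G (x + ε * I) = 0 := by
      rw [intervalIntegral.integral_congr (g := fun _ => (0 : ℝ))]
      · simp
      · intro x hx
        rw [uIcc_of_le hab] at hx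
        simp [G, htop x hx]
    have z2 : ∫ y in (0 : ℝ)..ε, F (b + y * I) = 0 := by
      rw [intervalIntegral.integral_congr (g := fun _ => (0 : ℝ))]
      · simp
      · intro x hx
        rw [uIcc_of_le hε] at hx
        simp [F, hright x hx]
    have z3 : ∫ y in (0 : ℝ)..ε, F (a + y * I) = 0 := by
      rw [intervalIntegral.integral_congr (g := fun _ => (0 : ℝ))]
      · simp
      · intro x hx
        rw [uIcc_of_le hε] at hx
        simp [F, hleft x hx]
    rw [z1, z2, z3] at hdiv
    simp only [add_im, ofReal_im, mul_im, ofReal_re, I_im, mul_one, I_re, mul_zero, add_zero,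
      zero_add] at hdiv
    rw [hdiv, zero_sub, sub_zero, ← intervalIntegral.integral_neg]
    refine intervalIntegral.integral_congr fun x _ => ?_
    have : arcChart v τ κ x = arcPoint v τ κ x := arcChart_ofReal _ _ _ _
    simp [G, T, this]
  · have : (fun x : ℝ × ℝ => ((fderiv ℝ F (e x)).comp (e : ℝ × ℝ →L[ℝ] ℂ)) (1, 0) +
        ((fderiv ℝ G (e x)).comp (e : ℝ × ℝ →L[ℝ] ℂ)) (0, 1)) =
        fun x => (1 - κ * (e x).im) * planeDiv φ (arcChart v τ κ (e x)) := by
      ext x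
      rw [← key]
      simp [he]
    rw [this]
    refine ContinuousOn.integrableOn_compact (isCompact_uIcc.prod isCompact_uIcc) ?_
    have h1 := continuous_planeDiv hφ
    have h2 := (contDiff_arcChart v τ κ).continuous
    have h3 := e.continuous
    fun_prop

theorem setIntegral_complex_eq (E : Set ℂ) (f : ℂ → ℝ) :
    ∫ z in E, f z = ∫ p in {p : ℝ × ℝ | (p.1 + p.2 * I : ℂ) ∈ E}, f (p.1 + p.2 * I) := by
  have h := (volume_preserving_equiv_real_prod.symm _).setIntegral_preimage_emb
    measurableEquivRealProd.symm.measurableEmbedding f E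
  have he : ∀ p : ℝ × ℝ, measurableEquivRealProd.symm p = p.1 + p.2 * I := fun p => by
    apply Complex.ext <;> simp [measurableEquivRealProd]
  simp only [he] at h
  rw [← h]
  congr 2
  ext p
  simp [he]

theorem setIntegral_rectangle {f : ℂ → ℝ} (hf : Continuous f) {a b c d : ℝ} (hab : a ≤ b)
    (hcd : c ≤ d) :
    ∫ z in Ioo a b ×ℂ Ico c d, f z = ∫ s in a..b, ∫ t in c..d, f (s + t * I) := by
  have hset : {p : ℝ × ℝ | (p.1 + p.2 * I : ℂ) ∈ Ioo a b ×ℂ Ico c d} = Ioo a b ×ˢ Ico c d := by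
    ext p; simp [mem_reProdIm]
  have hc : Continuous fun p : ℝ × ℝ => f (p.1 + p.2 * I) := by fun_prop
  rw [setIntegral_complex_eq, hset, Measure.volume_eq_prod, setIntegral_prod,
    intervalIntegral.integral_of_le hab, integral_Ioc_eq_integral_Ioo]
  · refine setIntegral_congr_fun measurableSet_Ioo fun s _ => ?_
    simp only
    rw [intervalIntegral.integral_of_le hcd, integral_Ico_eq_integral_Ioo,
      integral_Ioc_eq_integral_Ioo]
  · refine IntegrableOn.mono_set (t := Icc a b ×ˢ Icc c d)
      (hc.continuousOn.integrableOn_compact (isCompact_Icc.prod isCompact_Icc)) ?_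
    exact prod_mono Ioo_subset_Icc_self Ico_subset_Icc_self

/-! ### The divergence theorem on regions enclosed by curved polygons -/

namespace CurvedPolygon

variable {n : ℕ} [NeZero n]

/-- The outward flux of a vector field through the boundary of a region to the left of `P`. -/
noncomputable def flux (P : CurvedPolygon n) (φ : ℂ → ℂ) : ℝ :=
  ∑ i, ∫ s in (0 : ℝ)..P.len i, inner ℝ (φ (P.point i s)) (-I * P.tangent i s)

theorem continuous_flux_integrand (P : CurvedPolygon n) (i : Fin n) {φ : ℂ → ℂ}
    (hφ : Continuous φ) :
    Continuous fun s => inner ℝ (φ (P.point i s)) (-I * P.tangent i s) :=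
  (hφ.comp (P.continuous_point i)).inner (continuous_const.mul (P.continuous_tangent i))

variable {P : CurvedPolygon n} {R : Set ℂ}

theorem Encloses.point_mem_frontier' (h : P.Encloses R) (i : Fin n) {s : ℝ}
    (hs : s ∈ uIcc 0 (P.len i)) : P.point i s ∈ frontier R := by
  rw [uIcc_of_le (P.len_pos i).le] at hs
  exact h.point_mem_frontier hs

/-- Both sides vanish: the field is zero along the boundary, and it is either compactly supported
inside `R` or zero on `R`. -/
theorem Encloses.gaussGreen_of_disjoint (h : P.Encloses R) {φ : ℂ → ℂ} (hφ : ContDiff ℝ 1 φ)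
    (hc : HasCompactSupport φ) (hs : Disjoint (tsupport φ) (frontier R))
    (h' : tsupport φ ⊆ interior R ∨ Disjoint (tsupport φ) R) :
    ∫ z in R, planeDiv φ z = P.flux φ := by
  have hfl : P.flux φ = 0 := by
    refine Finset.sum_eq_zero fun i _ => ?_
    rw [intervalIntegral.integral_congr (g := fun _ => (0 : ℝ))]
    · simp
    · intro s hs'
      have : φ (P.point i s) = 0 :=
        image_eq_zero_of_notMem_tsupport fun hmem => hs.le_bot ⟨hmem, h.point_mem_frontier' i hs'⟩
      simp [this]
  rw [hfl]
  rcases h' with h' | h'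
  · rw [← integral_planeDiv_eq_zero hφ hc]
    refine setIntegral_eq_integral_of_forall_compl_eq_zero fun z hz =>
      planeDiv_eq_zero_of_notMem_tsupport fun hmem => hz (interior_subset (h' hmem))
  · refine setIntegral_eq_zero_of_forall_eq_zero fun z hz =>
      planeDiv_eq_zero_of_notMem_tsupport fun hmem => h'.le_bot ⟨hmem, hz⟩

/-- The divergence theorem for fields supported near an inner point of an edge. -/
theorem Encloses.gaussGreen_near_edge (h : P.Encloses R) {i : Fin n} {s₀ : ℝ}
    (hs₀ : s₀ ∈ Ioo 0 (P.len i)) : ∃ U ∈ 𝓝 (P.point i s₀), IsOpen U ∧ ∀ φ : ℂ → ℂ, ContDiff ℝ 1 φ →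
      tsupport φ ⊆ U → ∫ z in R, planeDiv φ z = P.flux φ := by
  obtain ⟨ε, hε, hl, hr, hκ, hinj, hop, hpos, hneg⟩ := h.exists_chart hs₀
  have hbox : boxAround s₀ ε ⊆ boxAround s₀ (2 * ε) := boxAround_mono _ (by linarith)
  refine ⟨P.chart i '' boxAround s₀ ε, ?_, hop, fun φ hφ hsupp => ?_⟩
  · rw [← chart_ofReal]
    exact hop.mem_nhds ⟨s₀, mem_of_mem_nhds (mem_nhds_boxAround s₀ hε), rfl⟩
  -- On the boundary the field lives only on the piece of edge `i` inside the box, because box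
  -- points off the axis are interior to `R` or outside it.
  have hmemR : ∀ {j : Fin n} {s : ℝ}, s ∈ Icc 0 (P.len j) → φ (P.point j s) ≠ 0 →
      i = j ∧ s ∈ Ioo (s₀ - ε) (s₀ + ε) := by
    intro j s hs hne
    obtain ⟨z, hz, hzs⟩ := hsupp (subset_tsupport _ hne)
    have hfr := h.point_mem_frontier hs
    have him : z.im = 0 := by
      rcases lt_trichotomy z.im 0 with h1 | h1 | h1
      · exact absurd (h.isCompact.isClosed.frontier_subset hfr) (hzs ▸ hneg z hz h1)
      · exact h1
      · exact absurd (hzs ▸ hpos z hz h1) hfr.2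
    have hz' := hz
    rw [mem_boxAround] at hz'
    have hzre : z = (z.re : ℂ) := by apply Complex.ext <;> simp [him]
    rw [hzre, chart_ofReal] at hzs
    obtain ⟨rfl, h2⟩ := P.eq_of_point_eq (s := z.re) ⟨by linarith, by linarith⟩ hs hzs
    exact ⟨rfl, h2 ▸ ⟨hz'.1.1, hz'.1.2⟩⟩
  have hflux : P.flux φ = ∫ s in (s₀ - ε)..(s₀ + ε),
      inner ℝ (φ (P.point i s)) (-I * P.tangent i s) := by
    rw [flux, Finset.sum_eq_single i]
    · have hint := fun a b : ℝ =>
        (P.continuous_flux_integrand i hφ.continuous).intervalIntegrable (μ := volume) a b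
      rw [← intervalIntegral.integral_add_adjacent_intervals (hint 0 (s₀ - ε)) (hint (s₀ - ε) _),
        ← intervalIntegral.integral_add_adjacent_intervals (hint (s₀ - ε) (s₀ + ε)) (hint _ _)]
      have z1 : ∫ s in (0 : ℝ)..(s₀ - ε), inner ℝ (φ (P.point i s)) (-I * P.tangent i s) = 0 := by
        rw [intervalIntegral.integral_congr (g := fun _ => (0 : ℝ))]
        · simp
        · intro s hs
          rw [uIcc_of_le (by linarith)] at hs
          have : φ (P.point i s) = 0 := by
            by_contra hne
            linarith [(hmemR ⟨hs.1, by linarith [hs.2]⟩ hne).2.1, hs.2]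
          simp [this]
      have z2 : ∫ s in (s₀ + ε)..P.len i, inner ℝ (φ (P.point i s)) (-I * P.tangent i s) = 0 := by
        rw [intervalIntegral.integral_congr (g := fun _ => (0 : ℝ))]
        · simp
        · intro s hs
          rw [uIcc_of_le (by linarith)] at hs
          have : φ (P.point i s) = 0 := by
            by_contra hne
            linarith [(hmemR ⟨by linarith [hs.1], hs.2⟩ hne).2.2, hs.1]
          simp [this]
      rw [z1, z2]; ring
    · intro j _ hj
      rw [intervalIntegral.integral_congr (g := fun _ => (0 : ℝ))]
      · simp
      · intro s hs
        rw [uIcc_of_le (P.len_pos j).le] at hs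
        have : φ (P.point j s) = 0 := by
          by_contra hne
          exact hj (hmemR hs hne).1.symm
        simp [this]
    · simp
  let S : Set ℂ := Ioo (s₀ - ε) (s₀ + ε) ×ℂ Ico 0 ε
  have hSbox : S ⊆ boxAround s₀ ε := by
    intro z hz
    rw [mem_boxAround]
    exact ⟨hz.1, by linarith [hz.2.1], hz.2.2⟩
  have hSm : MeasurableSet S := by
    have : S = re ⁻¹' Ioo (s₀ - ε) (s₀ + ε) ∩ im ⁻¹' Ico 0 ε := rfl
    rw [this]
    exact (measurable_re measurableSet_Ioo).inter (measurable_im measurableSet_Ico)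
  have hSR : P.chart i '' S ⊆ R := by
    rintro _ ⟨z, hz, rfl⟩
    rcases hz.2.1.eq_or_lt with h1 | h1
    · have hzre : z = (z.re : ℂ) := by apply Complex.ext; simp; simpa using h1.symm
      rw [hzre, chart_ofReal]
      exact h.isCompact.isClosed.frontier_subset
        (h.point_mem_frontier ⟨by linarith [hz.1.1], by linarith [hz.1.2]⟩)
    · exact interior_subset (hpos z (hSbox hz) h1)
  have hRS : ∀ z ∈ R \ P.chart i '' S, planeDiv φ z = 0 := by
    intro z hz
    refine planeDiv_eq_zero_of_notMem_tsupport fun hmem => ?_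
    obtain ⟨w, hw, rfl⟩ := hsupp hmem
    have hw' := hw
    rw [mem_boxAround] at hw'
    by_cases h1 : w.im < 0
    · exact hneg w hw h1 hz.1
    · exact hz.2 ⟨w, ⟨hw'.1, not_lt.1 h1, hw'.2.2⟩, rfl⟩
  -- This is where injectivity on the doubled box enters: a point on the rim of the small box cannot
  -- have the same image as a point inside it, so the field vanishes on the three far sides.
  have hφ0 : ∀ z ∈ boxAround s₀ (2 * ε), z ∉ boxAround s₀ ε → φ (P.chart i z) = 0 := by
    intro z hz hz'
    by_contra hne
    obtain ⟨w, hw, hwz⟩ := hsupp (subset_tsupport _ hne)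
    exact hz' (hinj (hbox hw) hz hwz ▸ hw)
  rw [setIntegral_eq_of_subset_of_forall_sdiff_eq_zero h.isCompact.isClosed.measurableSet hSR hRS,
    integral_image_eq_integral_abs_det_fderiv_smul volume hSm
      (f := P.chart i) (fun z _ => (hasFDerivAt_arcChart _ _ _ z).hasFDerivWithinAt) (hinj.mono (hSbox.trans hbox)),
    hflux]
  have hcongr : ∀ z ∈ S, |(arcChartDeriv (P.dir i) (P.curv i) z).det| • planeDiv φ (P.chart i z) =
      (1 - P.curv i * z.im) * planeDiv φ (P.chart i z) := by
    intro z hz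
    rw [det_arcChartDeriv (P.norm_dir i), smul_eq_mul, abs_of_nonneg]
    have h1 : |P.curv i * z.im| ≤ 1 := by
      rw [abs_mul]
      refine (mul_le_mul_of_nonneg_left (abs_le.2 ⟨?_, hz.2.2.le⟩) (abs_nonneg _)).trans hκ
      linarith [hz.2.1]
    linarith [(abs_le.1 h1).2]
  rw [setIntegral_congr_fun hSm hcongr]
  have hcont : Continuous fun z : ℂ => (1 - P.curv i * z.im) * planeDiv φ (P.chart i z) := by
    have h1 := continuous_planeDiv hφ
    have h2 := P.continuous_chart i
    fun_prop
  rw [setIntegral_rectangle hcont (by linarith) hε.le]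
  have := integral_planeDiv_arcChart (v := P.vertex i) (P.norm_dir i) (P.curv i) hφ
    (a := s₀ - ε) (b := s₀ + ε) (ε := ε) (by linarith) hε.le ?_ ?_ ?_
  · simpa [chart, point, tangent] using this
  · intro s hs
    refine hφ0 _ ?_ ?_ <;> rw [mem_boxAround] <;> simp
    · exact ⟨⟨by linarith [hs.1], by linarith [hs.2]⟩, by linarith, by linarith⟩
  · intro t ht
    refine hφ0 _ ?_ ?_ <;> rw [mem_boxAround] <;> simp
    · exact ⟨⟨by linarith, by linarith⟩, by linarith [ht.1], by linarith [ht.2]⟩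
  · intro t ht
    refine hφ0 _ ?_ ?_ <;> rw [mem_boxAround] <;> simp
    · exact ⟨⟨by linarith, by linarith⟩, by linarith [ht.1], by linarith [ht.2]⟩

/-- The divergence theorem near every point that is not a vertex. -/
theorem Encloses.gaussGreen_local (h : P.Encloses R) {q : ℂ} (hq : q ∉ range P.vertex) :
    ∃ U ∈ 𝓝 q, IsOpen U ∧ ∀ φ : ℂ → ℂ, ContDiff ℝ 1 φ → HasCompactSupport φ →
      tsupport φ ⊆ U → ∫ z in R, planeDiv φ z = P.flux φ := by
  by_cases h1 : q ∈ frontier R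
  · have h2 := h1
    rw [h.frontier_eq] at h2
    obtain ⟨i, s, hs, rfl⟩ := mem_iUnion.1 h2
    have hs0 : s ≠ 0 := by
      rintro rfl; exact hq ⟨i, (P.point_zero i).symm⟩
    have hs1 : s ≠ P.len i := by
      rintro rfl; exact hq ⟨i + 1, (P.point_len i).symm⟩
    obtain ⟨U, hU, hop, hU'⟩ := h.gaussGreen_near_edge (i := i) (s₀ := s)
      ⟨lt_of_le_of_ne hs.1 hs0.symm, lt_of_le_of_ne hs.2 hs1⟩
    exact ⟨U, hU, hop, fun φ hφ _ hs => hU' φ hφ hs⟩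
  · by_cases h3 : q ∈ R
    · have h4 : q ∈ interior R := by
        by_contra h5; exact h1 ⟨subset_closure h3, h5⟩
      refine ⟨interior R, isOpen_interior.mem_nhds h4, isOpen_interior, fun φ hφ hc hs => ?_⟩
      exact h.gaussGreen_of_disjoint hφ hc (disjoint_interior_frontier.mono_left hs) (Or.inl hs)
    · refine ⟨Rᶜ, h.isCompact.isClosed.isOpen_compl.mem_nhds h3, h.isCompact.isClosed.isOpen_compl,
        fun φ hφ hc hs => ?_⟩
      have hd : Disjoint (tsupport φ) R := disjoint_compl_left.mono_left hs
      exact h.gaussGreen_of_disjoint hφ hc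
        (hd.mono_right h.isCompact.isClosed.frontier_subset) (Or.inr hd)

end CurvedPolygon

theorem tsupport_smul_subset (f : ℂ → ℝ) (φ : ℂ → ℂ) :
    tsupport (fun z => f z • φ z) ⊆ tsupport f ∩ tsupport φ :=
  subset_inter (closure_mono (Function.support_smul_subset_left f φ))
    (closure_mono (Function.support_smul_subset_right f φ))

theorem HasCompactSupport.real_smul (f : ℂ → ℝ) {φ : ℂ → ℂ} (hc : HasCompactSupport φ) :
    HasCompactSupport fun z => f z • φ z :=
  HasCompactSupport.intro hc fun z hz => by
    rw [image_eq_zero_of_notMem_tsupport hz, smul_zero]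

theorem ContDiff.real_smul {f : ℂ → ℝ} {φ : ℂ → ℂ} (hf : ContDiff ℝ 1 f) (hφ : ContDiff ℝ 1 φ) :
    ContDiff ℝ 1 fun z => f z • φ z :=
  ContDiff.smul hf hφ

theorem HasCompactSupport.bddNorm {E : Type*} [NormedAddCommGroup E] {f : ℂ → E}
    (hc : HasCompactSupport f) (hf : Continuous f) : ∃ C, 0 ≤ C ∧ ∀ z, ‖f z‖ ≤ C := by
  obtain ⟨C, hC⟩ := hc.exists_bound_of_continuous hf
  exact ⟨C, (norm_nonneg _).trans (hC 0), hC⟩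

namespace CurvedPolygon

variable {n : ℕ} [NeZero n] {P : CurvedPolygon n} {R : Set ℂ}

theorem flux_add {φ ψ : ℂ → ℂ} (hφ : Continuous φ) (hψ : Continuous ψ) :
    P.flux (fun z => φ z + ψ z) = P.flux φ + P.flux ψ := by
  rw [flux, flux, flux, ← Finset.sum_add_distrib]
  refine Finset.sum_congr rfl fun i _ => ?_
  rw [← intervalIntegral.integral_add
    ((P.continuous_flux_integrand i hφ).intervalIntegrable _ _)
    ((P.continuous_flux_integrand i hψ).intervalIntegrable _ _)]
  simp only [inner_add_left]

theorem Encloses.setIntegral_planeDiv_add (h : P.Encloses R) {φ ψ : ℂ → ℂ} (hφ : ContDiff ℝ 1 φ)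
    (hψ : ContDiff ℝ 1 ψ) : ∫ z in R, planeDiv (fun z => φ z + ψ z) z =
      (∫ z in R, planeDiv φ z) + ∫ z in R, planeDiv ψ z := by
  simp only [planeDiv_add hφ hψ]
  exact integral_add ((continuous_planeDiv hφ).continuousOn.integrableOn_compact h.isCompact)
    ((continuous_planeDiv hψ).continuousOn.integrableOn_compact h.isCompact)

-- A partition of unity on the compact support reduces the statement to fields supported in the
-- neighbourhoods given by `gaussGreen_local`.
open scoped Manifold ContDiff in
theorem Encloses.gaussGreen_off_vertices (h : P.Encloses R) {φ : ℂ → ℂ} (hφ : ContDiff ℝ 1 φ)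
    (hc : HasCompactSupport φ) (hv : ∀ i, P.vertex i ∉ tsupport φ) :
    ∫ z in R, planeDiv φ z = P.flux φ := by
  have hloc : ∀ q ∈ tsupport φ, ∃ U ∈ 𝓝 q, IsOpen U ∧ ∀ φ : ℂ → ℂ, ContDiff ℝ 1 φ →
      HasCompactSupport φ → tsupport φ ⊆ U → ∫ z in R, planeDiv φ z = P.flux φ := by
    intro q hq
    refine h.gaussGreen_local ?_
    rintro ⟨i, rfl⟩
    exact hv i hq
  choose! U hU hUo hUg using hloc
  obtain ⟨t, ht, htc⟩ := hc.isCompact.elim_nhds_subcover U hU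
  obtain ⟨f, hf⟩ := SmoothPartitionOfUnity.exists_isSubordinate 𝓘(ℝ, ℂ) (isClosed_tsupport φ)
    (fun q : t => U q) (fun q => hUo _ (ht _ q.2)) (by
      intro x hx
      obtain ⟨q, hq, hxq⟩ := mem_iUnion₂.1 (htc hx)
      exact mem_iUnion.2 ⟨⟨q, hq⟩, hxq⟩)
  have hfs : ∀ q, ContDiff ℝ 1 (f q) := fun q =>
    ((f q).contMDiff.contDiff).of_le (by exact_mod_cast le_top)
  have hfφ : ∀ q, ContDiff ℝ 1 (fun z => f q z • φ z) := fun q => (hfs q).real_smul hφ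
  have hsum : ∀ s : Finset t, ContDiff ℝ 1 (fun z => ∑ q ∈ s, f q z • φ z) ∧
      ∫ z in R, planeDiv (fun z => ∑ q ∈ s, f q z • φ z) z =
        P.flux (fun z => ∑ q ∈ s, f q z • φ z) := by
    intro s
    induction s using Finset.induction_on with
    | empty =>
      refine ⟨by simpa using contDiff_const, ?_⟩
      simp [planeDiv, flux]
    | insert a s ha ih =>
      simp only [Finset.sum_insert ha]
      refine ⟨(hfφ a).add ih.1, ?_⟩
      rw [h.setIntegral_planeDiv_add (hfφ a) ih.1, flux_add (hfφ a).continuous ih.1.continuous, ih.2,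
        hUg a (ht _ a.2) _ (hfφ a)]
      · exact hc.real_smul _
      · exact (tsupport_smul_subset _ _).trans (inter_subset_left.trans (hf a))
  have hone : (fun z => ∑ q : t, f q z • φ z) = φ := by
    ext1 z
    rw [← Finset.sum_smul]
    by_cases hz : z ∈ tsupport φ
    · have := f.sum_eq_one hz
      rw [finsum_eq_sum_of_fintype] at this
      rw [this, one_smul]
    · rw [image_eq_zero_of_notMem_tsupport hz, smul_zero]
  have := (hsum Finset.univ).2
  rwa [hone] at this

/-- A bump function at `v` of width `ρ`. -/
noncomputable def bumpAt (v : ℂ) (ρ : ℝ) (z : ℂ) : ℝ :=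
  (⟨1, 2, one_pos, one_lt_two⟩ : ContDiffBump (0 : ℂ)) (ρ⁻¹ • (z - v))

theorem contDiff_bumpAt (v : ℂ) (ρ : ℝ) : ContDiff ℝ 1 (bumpAt v ρ) :=
  (ContDiffBump.contDiff _).comp ((contDiff_id.sub contDiff_const).const_smul ρ⁻¹)

theorem bumpAt_mem_Icc (v : ℂ) (ρ : ℝ) (z : ℂ) : bumpAt v ρ z ∈ Icc (0 : ℝ) 1 :=
  ⟨ContDiffBump.nonneg _, ContDiffBump.le_one _⟩

theorem bumpAt_eq_one {v : ℂ} {ρ : ℝ} (hρ : 0 < ρ) {z : ℂ} (hz : dist z v ≤ ρ) :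
    bumpAt v ρ z = 1 := by
  refine ContDiffBump.one_of_mem_closedBall _ ?_
  rw [mem_closedBall_zero_iff, norm_smul, norm_inv, Real.norm_of_nonneg hρ.le, ← dist_eq_norm]
  rw [inv_mul_le_iff₀ hρ]; simpa using hz

theorem bumpAt_eq_zero {v : ℂ} {ρ : ℝ} (hρ : 0 < ρ) {z : ℂ} (hz : 2 * ρ ≤ dist z v) :
    bumpAt v ρ z = 0 := by
  refine ContDiffBump.zero_of_le_dist _ ?_
  rw [dist_zero_right, norm_smul, norm_inv, Real.norm_of_nonneg hρ.le, ← dist_eq_norm]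
  change (2 : ℝ) ≤ _
  rw [le_inv_mul_iff₀ hρ]; linarith

/-- All these bumps are rescalings of a single one, so the gradient grows like `1/ρ` with a uniform
constant. -/
theorem exists_norm_fderiv_bumpAt_le : ∃ C, 0 ≤ C ∧ ∀ (v : ℂ) (ρ : ℝ), 0 < ρ → ∀ z,
    ‖fderiv ℝ (bumpAt v ρ) z‖ ≤ C * ρ⁻¹ := by
  let b : ContDiffBump (0 : ℂ) := ⟨1, 2, one_pos, one_lt_two⟩
  have hb : ContDiff ℝ 1 b := b.contDiff
  obtain ⟨C, hC0, hC⟩ := (b.hasCompactSupport.fderiv ℝ).bddNorm (hb.continuous_fderiv (by norm_num))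
  refine ⟨C, hC0, fun v ρ hρ z => ?_⟩
  have h1 : HasFDerivAt (fun z : ℂ => ρ⁻¹ • (z - v)) (ρ⁻¹ • ContinuousLinearMap.id ℝ ℂ) z :=
    ((hasFDerivAt_id z).sub_const v).const_smul ρ⁻¹
  have h2 := ((hb.differentiable (by norm_num) (ρ⁻¹ • (z - v))).hasFDerivAt.comp z h1).fderiv
  change ‖fderiv ℝ (b ∘ fun z : ℂ => ρ⁻¹ • (z - v)) z‖ ≤ _
  rw [h2]
  refine (ContinuousLinearMap.opNorm_comp_le _ _).trans ?_
  refine mul_le_mul (hC _) ?_ (norm_nonneg _) hC0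
  refine (norm_smul_le _ _).trans ?_
  rw [norm_inv, Real.norm_of_nonneg hρ.le]
  exact mul_le_of_le_one_right (by positivity) ContinuousLinearMap.norm_id_le

/-- A divergence of size `O(1/ρ)` on a disc of area `O(ρ²)` contributes `O(ρ)`: a point is
negligible for the divergence theorem. -/
theorem Encloses.tendsto_setIntegral_planeDiv_bumpAt (h : P.Encloses R) (v : ℂ) {φ : ℂ → ℂ}
    (hφ : ContDiff ℝ 1 φ) (hc : HasCompactSupport φ) :
    Tendsto (fun ρ => ∫ z in R, planeDiv (fun z => bumpAt v ρ z • φ z) z) (𝓝[>] 0) (𝓝 0) := by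
  obtain ⟨M₁, hM₁, h1⟩ := (hasCompactSupport_planeDiv hc).bddNorm (continuous_planeDiv hφ)
  obtain ⟨M₂, hM₂, h2⟩ := hc.bddNorm hφ.continuous
  obtain ⟨C, hC, h3⟩ := exists_norm_fderiv_bumpAt_le
  have hbound : ∀ ρ : ℝ, 0 < ρ → ‖∫ z in R, planeDiv (fun z => bumpAt v ρ z • φ z) z‖ ≤
      (M₁ + C * ρ⁻¹ * M₂) * (Real.pi * (2 * ρ) ^ 2) := by
    intro ρ hρ
    have hsub : ∫ z in R, planeDiv (fun z => bumpAt v ρ z • φ z) z =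
        ∫ z in R ∩ Metric.closedBall v (2 * ρ), planeDiv (fun z => bumpAt v ρ z • φ z) z := by
      refine setIntegral_eq_of_subset_of_forall_sdiff_eq_zero h.isCompact.isClosed.measurableSet
        inter_subset_left fun z hz => planeDiv_eq_zero_of_notMem_tsupport fun hmem => hz.2 ⟨hz.1, ?_⟩
      have : tsupport (bumpAt v ρ) ⊆ Metric.closedBall v (2 * ρ) := by
        refine closure_minimal ?_ Metric.isClosed_closedBall
        intro w hw
        by_contra hcon
        exact hw (bumpAt_eq_zero hρ (not_le.1 hcon).le)
      exact this (tsupport_smul_subset _ _ hmem).1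
    have hvol : volume (Metric.closedBall v (2 * ρ)) < ∞ := measure_closedBall_lt_top
    rw [hsub]
    refine (norm_setIntegral_le_of_norm_le_const (C := M₁ + C * ρ⁻¹ * M₂)
      ((measure_mono inter_subset_right).trans_lt hvol) fun z _ => ?_).trans ?_
    · rw [planeDiv_smul (contDiff_bumpAt v ρ) hφ]
      refine (norm_add_le _ _).trans (add_le_add ?_ ?_)
      · rw [norm_mul, Real.norm_of_nonneg (bumpAt_mem_Icc v ρ z).1]
        exact (mul_le_of_le_one_left (norm_nonneg _) (bumpAt_mem_Icc v ρ z).2).trans (h1 z)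
      · refine (ContinuousLinearMap.le_opNorm _ _).trans ?_
        exact mul_le_mul (h3 v ρ hρ z) (h2 z) (norm_nonneg _) (by positivity)
    · refine mul_le_mul_of_nonneg_left ?_ (by positivity)
      refine (measureReal_mono inter_subset_right hvol.ne).trans_eq ?_
      rw [measureReal_def, Complex.volume_closedBall, ENNReal.toReal_mul, ENNReal.toReal_pow,
        ENNReal.toReal_ofReal (by positivity)]
      simp [mul_comm]
  refine squeeze_zero_norm' (a := fun ρ => 4 * Real.pi * (M₁ * ρ ^ 2 + C * M₂ * ρ)) ?_ ?_
  · filter_upwards [self_mem_nhdsWithin] with ρ hρ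
    refine (hbound ρ hρ).trans_eq ?_
    have : ρ ≠ 0 := (mem_Ioi.1 hρ).ne'
    field_simp
    ring
  · refine Tendsto.mono_left ?_ nhdsWithin_le_nhds
    have : Continuous fun ρ : ℝ => 4 * Real.pi * (M₁ * ρ ^ 2 + C * M₂ * ρ) := by fun_prop
    simpa using this.tendsto 0

/-- Dominated convergence: each half-open edge passes through `v` at most once, and away from `v`
the bump is eventually zero. -/
theorem tendsto_flux_bumpAt (P : CurvedPolygon n) (v : ℂ) {φ : ℂ → ℂ}
    (hφ : Continuous φ) (hc : HasCompactSupport φ) :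
    Tendsto (fun ρ => P.flux (fun z => bumpAt v ρ z • φ z)) (𝓝[>] 0) (𝓝 0) := by
  obtain ⟨M, hM, h2⟩ := hc.bddNorm hφ
  suffices H : ∀ i, Tendsto (fun ρ => ∫ s in (0 : ℝ)..P.len i,
      inner ℝ (bumpAt v ρ (P.point i s) • φ (P.point i s)) (-I * P.tangent i s))
      (𝓝[>] 0) (𝓝 0) by
    have hs := tendsto_finsetSum Finset.univ fun i _ => H i
    rwa [Finset.sum_const_zero] at hs
  intro i
  rw [show 𝓝 (0 : ℝ) = 𝓝 (∫ s in (0 : ℝ)..P.len i, (0 : ℝ)) by simp]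
  refine intervalIntegral.tendsto_integral_filter_of_dominated_convergence (fun _ => M) ?_ ?_ ?_ ?_
  · refine Eventually.of_forall fun ρ => Continuous.aestronglyMeasurable ?_
    exact P.continuous_flux_integrand i (φ := fun z => bumpAt v ρ z • φ z)
      ((contDiff_bumpAt v ρ).continuous.smul hφ)
  · refine Eventually.of_forall fun ρ => Eventually.of_forall fun s _ => ?_
    refine (norm_inner_le_norm _ _).trans ?_
    rw [norm_smul, norm_mul, P.norm_tangent, norm_neg, norm_I, mul_one, mul_one,
      Real.norm_of_nonneg (bumpAt_mem_Icc v ρ _).1]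
    exact (mul_le_of_le_one_left (norm_nonneg _) (bumpAt_mem_Icc v ρ _).2).trans (h2 _)
  · simp
  · have hnull : volume ({s ∈ Ico 0 (P.len i) | P.point i s = v} ∪ {P.len i}) = 0 := by
      refine Set.Countable.measure_zero (Set.Countable.union ?_ (countable_singleton _)) _
      refine Set.Subsingleton.countable fun s hs t ht => ?_
      exact (P.simple i i s hs.1 t ht.1 (hs.2.trans ht.2.symm)).2
    filter_upwards [compl_mem_ae_iff.2 hnull] with s hs hs'
    rw [uIoc_of_le (P.len_pos i).le] at hs'
    have hne : P.point i s ≠ v := by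
      intro hcon
      rcases hs'.2.lt_or_eq with h1 | h1
      · exact hs (Or.inl ⟨⟨hs'.1.le, h1⟩, hcon⟩)
      · exact hs (Or.inr h1)
    refine tendsto_const_nhds.congr' ?_
    have hd : 0 < dist (P.point i s) v / 2 := by have := dist_pos.2 hne; positivity
    filter_upwards [Ioo_mem_nhdsGT hd] with ρ hρ
    rw [bumpAt_eq_zero hρ.1 (by linarith [hρ.2]), zero_smul, inner_zero_left]

/-- The vertices are removed one at a time. Cutting the field off near `v` with a bump leaves a
field to which the induction hypothesis applies, and the part cut off contributes nothing in the
limit. -/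
theorem Encloses.gaussGreen_of_hasCompactSupport (h : P.Encloses R) {φ : ℂ → ℂ}
    (hφ : ContDiff ℝ 1 φ) (hc : HasCompactSupport φ) : ∫ z in R, planeDiv φ z = P.flux φ := by
  suffices H : ∀ (s : Finset ℂ) (φ : ℂ → ℂ), ContDiff ℝ 1 φ → HasCompactSupport φ →
      (∀ i, P.vertex i ∉ s → P.vertex i ∉ tsupport φ) → ∫ z in R, planeDiv φ z = P.flux φ from
    H (Finset.univ.image P.vertex) φ hφ hc fun i hi => absurd (by simp) hi
  intro s
  induction s using Finset.induction_on with
  | empty => exact fun φ hφ hc hv => h.gaussGreen_off_vertices hφ hc fun i => hv i (by simp)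
  | insert v s _ ih =>
    intro φ hφ hc hv
    have hlim := (h.tendsto_setIntegral_planeDiv_bumpAt v hφ hc).sub
      (P.tendsto_flux_bumpAt v hφ.continuous hc)
    rw [sub_zero] at hlim
    have heq : ∀ᶠ ρ in 𝓝[>] (0 : ℝ), (∫ z in R, planeDiv φ z) - P.flux φ =
        (∫ z in R, planeDiv (fun z => bumpAt v ρ z • φ z) z) -
          P.flux (fun z => bumpAt v ρ z • φ z) := by
      filter_upwards [self_mem_nhdsWithin] with ρ hρ
      rw [mem_Ioi] at hρ
      have hb := (contDiff_bumpAt v ρ).real_smul hφ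
      have hb' : ContDiff ℝ 1 fun z => (1 - bumpAt v ρ z) • φ z :=
        (contDiff_const.sub (contDiff_bumpAt v ρ)).real_smul hφ
      have hdec : φ = fun z => bumpAt v ρ z • φ z + (1 - bumpAt v ρ z) • φ z := by
        ext1 z; rw [← add_smul]; simp
      have hrest := ih (fun z => (1 - bumpAt v ρ z) • φ z) hb' (hc.real_smul _) ?_
      · conv_lhs => rw [hdec]
        rw [h.setIntegral_planeDiv_add hb hb', flux_add hb.continuous hb'.continuous, hrest]
        ring
      · intro i hi hmem
        have hm := tsupport_smul_subset _ _ hmem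
        by_cases hiv : P.vertex i = v
        · rw [hiv] at hm
          refine notMem_tsupport_iff_eventuallyEq.2 ?_ hm.1
          filter_upwards [Metric.closedBall_mem_nhds v hρ] with z hz
          simp [bumpAt_eq_one hρ (Metric.mem_closedBall.1 hz)]
        · exact hv i (by simp [hi, hiv]) hm.2
    have := tendsto_nhds_unique (tendsto_const_nhds.congr' heq) hlim
    linarith

/-- The divergence theorem on a region enclosed by a curved polygon. -/
theorem Encloses.gaussGreen (h : P.Encloses R) {φ : ℂ → ℂ} (hφ : ContDiff ℝ 1 φ) :
    ∫ z in R, planeDiv φ z = P.flux φ := by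
  obtain ⟨r, hr0, hr⟩ := (h.isCompact.isBounded).subset_closedBall_lt 0 (0 : ℂ)
  let b : ContDiffBump (0 : ℂ) := ⟨r + 1, r + 2, by linarith, by linarith⟩
  have hb : ContDiff ℝ 1 b := b.contDiff
  have hnear : ∀ z ∈ R, (fun z => b z • φ z) =ᶠ[𝓝 z] φ := by
    intro z hz
    have hz' : z ∈ Metric.ball (0 : ℂ) (r + 1) := Metric.closedBall_subset_ball (by linarith) (hr hz)
    filter_upwards [Metric.isOpen_ball.mem_nhds hz'] with w hw
    rw [b.one_of_mem_closedBall (Metric.ball_subset_closedBall hw), one_smul]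
  have h1 := h.gaussGreen_of_hasCompactSupport (hb.real_smul hφ)
    (HasCompactSupport.intro b.hasCompactSupport fun z hz => by
      rw [image_eq_zero_of_notMem_tsupport hz, zero_smul])
  have h2 : ∫ z in R, planeDiv (fun z => b z • φ z) z = ∫ z in R, planeDiv φ z := by
    refine setIntegral_congr_fun h.isCompact.isClosed.measurableSet fun z hz => ?_
    simp only [planeDiv, (hnear z hz).fderiv_eq]
  have h3 : P.flux (fun z => b z • φ z) = P.flux φ := by
    refine Finset.sum_congr rfl fun i _ => intervalIntegral.integral_congr fun s hs => ?_
    have := (hnear _ (h.isCompact.isClosed.frontier_subset (h.point_mem_frontier' i hs))).eq_of_nhds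
    simp only [this]
  rw [← h2, ← h3]; exact h1

end CurvedPolygon

/-! ### Perimeter from below and area of an enclosed region -/

theorem caccioppoliPerimeter_congr {E F : Set ℂ} (h : E =ᵐ[volume] F) :
    caccioppoliPerimeter E = caccioppoliPerimeter F := by
  unfold caccioppoliPerimeter
  simp only [setIntegral_congr_set h]

theorem le_caccioppoliPerimeter (E : Set ℂ) {φ : ℂ → ℂ} (hφ : ContDiff ℝ 1 φ)
    (hc : HasCompactSupport φ) (h1 : ∀ z, ‖φ z‖ ≤ 1) :
    ENNReal.ofReal (∫ z in E, planeDiv φ z) ≤ caccioppoliPerimeter E :=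
  le_iSup_of_le φ (le_iSup_of_le hφ (le_iSup_of_le hc (le_iSup_of_le h1 le_rfl)))

namespace CurvedPolygon

variable {n : ℕ} [NeZero n] (P : CurvedPolygon n) {R : Set ℂ}

/-- A smooth field that equals the right unit normal along the `i`-th edge. -/
noncomputable def normalField (i : Fin n) (z : ℂ) : ℂ :=
  -I * P.dir i + P.curv i * (z - P.vertex i)

theorem contDiff_normalField (i : Fin n) : ContDiff ℝ 1 (P.normalField i) := by
  unfold normalField
  exact contDiff_const.add (contDiff_const.mul (contDiff_id.sub contDiff_const))

/-- The normal of a circle is a multiple of the vector from the center, and that of a line is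
constant; in both cases it extends to an affine field. -/
theorem normalField_point (i : Fin n) (s : ℝ) :
    P.normalField i (P.point i s) = -I * P.tangent i s := by
  by_cases h : P.curv i = 0
  · simp [normalField, point, tangent, h, arcTangent]
  · have h' : (P.curv i : ℂ) ≠ 0 := by exact_mod_cast h
    rw [normalField, point, arcPoint_curved _ _ h, tangent]
    field_simp
    ring

-- The affine normal fields of the edges are glued by a partition of unity. They need not have norm
-- at most `1` off the edges, but near them the norm stays below `1 + η`, which explains the factor
-- `(1 + η)⁻¹`. Shortening the edges by `η` at both ends makes them disjoint.
open scoped Manifold ContDiff in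
theorem exists_field_lower_bound {η : ℝ} (hη : 0 < η) :
    ∃ φ : ℂ → ℂ, ContDiff ℝ 1 φ ∧ HasCompactSupport φ ∧ (∀ z, ‖φ z‖ ≤ 1) ∧
      ∀ i, ∀ s ∈ Icc η (P.len i - η), φ (P.point i s) = ((1 + η)⁻¹ : ℝ) • (-I * P.tangent i s) := by
  let K : Fin n → Set ℂ := fun i => P.point i '' Icc η (P.len i - η)
  have hK : ∀ i, IsCompact (K i) := fun i => isCompact_Icc.image (P.continuous_point i)
  have hdisj : ∀ i j, i ≠ j → Disjoint (K i) (K j) := by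
    intro i j hij
    rw [Set.disjoint_left]
    rintro _ ⟨s, hs, rfl⟩ ⟨t, ht, hts⟩
    exact hij (P.eq_of_point_eq (s := s) (t := t) ⟨by linarith [hs.1], by linarith [hs.2]⟩
      ⟨by linarith [ht.1], by linarith [ht.2]⟩ hts.symm).1
  obtain ⟨r, hr0, hr⟩ := ((isCompact_iUnion hK).isBounded).subset_ball_lt 0 (0 : ℂ)
  -- Removing the other shortened edges from `U i` ensures that on `K i` only the `i`-th cut-off
  -- function is nonzero.
  let U : Fin n → Set ℂ := fun i => (⋂ j ∈ ({i}ᶜ : Set (Fin n)), (K j)ᶜ) ∩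
    ({z | ‖P.normalField i z‖ < 1 + η} ∩ Metric.ball 0 r)
  have hUo : ∀ i, IsOpen (U i) := fun i =>
    ((toFinite _).isOpen_biInter fun j _ => (hK j).isClosed.isOpen_compl).inter
      ((isOpen_lt (P.contDiff_normalField i).continuous.norm continuous_const).inter
        Metric.isOpen_ball)
  have hcov : (⋃ i, K i) ⊆ ⋃ i, U i := by
    refine iUnion_mono fun i z hz => ⟨?_, ?_, hr (mem_iUnion.2 ⟨i, hz⟩)⟩
    · exact mem_iInter₂.2 fun j hj hzj => (hdisj i j (Ne.symm hj)).le_bot ⟨hz, hzj⟩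
    · obtain ⟨s, -, rfl⟩ := hz
      change ‖P.normalField i (P.point i s)‖ < 1 + η
      rw [normalField_point, norm_mul, norm_tangent]
      simp [hη]
  obtain ⟨f, hf⟩ := SmoothPartitionOfUnity.exists_isSubordinate 𝓘(ℝ, ℂ)
    (isCompact_iUnion hK).isClosed U hUo hcov
  have hfs : ∀ i, ContDiff ℝ 1 (f i) := fun q =>
    ((f q).contMDiff.contDiff).of_le (by exact_mod_cast le_top)
  have hfc : ∀ i, HasCompactSupport (f i) := fun i =>
    (isCompact_closedBall (0 : ℂ) r).of_isClosed_subset (isClosed_tsupport _)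
      ((hf i).trans ((inter_subset_right.trans inter_subset_right).trans Metric.ball_subset_closedBall))
  refine ⟨fun z => ((1 + η)⁻¹ : ℝ) • ∑ i, f i z • P.normalField i z, ?_, ?_, ?_, ?_⟩
  · exact (ContDiff.sum fun i _ => (hfs i).real_smul (P.contDiff_normalField i)).const_smul _
  · refine HasCompactSupport.intro (isCompact_iUnion hfc) fun z hz => ?_
    rw [Finset.sum_eq_zero, smul_zero]
    intro i _
    rw [image_eq_zero_of_notMem_tsupport fun h => hz (mem_iUnion.2 ⟨i, h⟩), zero_smul]
  · intro z
    have h1 : ‖∑ i, f i z • P.normalField i z‖ ≤ ∑ i, f i z * (1 + η) := by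
      refine (norm_sum_le _ _).trans (Finset.sum_le_sum fun i _ => ?_)
      rw [norm_smul, Real.norm_of_nonneg (f.nonneg i z)]
      by_cases hz : z ∈ tsupport (f i)
      · exact mul_le_mul_of_nonneg_left ((hf i hz).2.1.le) (f.nonneg i z)
      · rw [image_eq_zero_of_notMem_tsupport hz]; simp
    have h2 : ∑ i, f i z ≤ 1 := by
      have := f.sum_le_one z
      rwa [finsum_eq_sum_of_fintype] at this
    have h3 : 0 < 1 + η := by linarith
    rw [norm_smul, norm_inv, Real.norm_of_nonneg h3.le, inv_mul_le_iff₀ h3, mul_one]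
    rw [← Finset.sum_mul] at h1
    exact h1.trans (mul_le_of_le_one_left h3.le h2)
  · intro i s hs
    have hmem : P.point i s ∈ K i := ⟨s, hs, rfl⟩
    have h0 : ∀ j, j ≠ i → f j (P.point i s) = 0 := fun j hj =>
      image_eq_zero_of_notMem_tsupport fun h =>
        mem_iInter₂.1 (hf j h).1 i (Ne.symm hj) hmem
    have h1 : f i (P.point i s) = 1 := by
      have := f.sum_eq_one (mem_iUnion.2 ⟨i, hmem⟩ : P.point i s ∈ ⋃ i, K i)
      rwa [finsum_eq_sum_of_fintype, Finset.sum_eq_single i (fun j _ hj => h0 j hj) (by simp)] at this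
    beta_reduce
    rw [Finset.sum_eq_single i (fun j _ hj => by rw [h0 j hj, zero_smul]) (by simp), h1, one_smul,
      normalField_point]

/-- The middle of each edge contributes exactly, and each of the two ends, of length `η`, costs at
most `η`. -/
theorem flux_lower_bound {η : ℝ} (hη : 0 < η) (hη' : ∀ i, 2 * η < P.len i) {φ : ℂ → ℂ}
    (hφ : Continuous φ) (h1 : ∀ z, ‖φ z‖ ≤ 1)
    (h2 : ∀ i, ∀ s ∈ Icc η (P.len i - η),
      φ (P.point i s) = ((1 + η)⁻¹ : ℝ) • (-I * P.tangent i s)) :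
    ∑ i, ((1 + η)⁻¹ * (P.len i - 2 * η) - 2 * η) ≤ P.flux φ := by
  refine Finset.sum_le_sum fun i _ => ?_
  have hη'' := hη' i
  have hint := fun a b : ℝ =>
    (P.continuous_flux_integrand i hφ).intervalIntegrable (μ := volume) a b
  have hlow : ∀ s, -1 ≤ inner ℝ (φ (P.point i s)) (-I * P.tangent i s) := by
    intro s
    have := norm_inner_le_norm (𝕜 := ℝ) (φ (P.point i s)) (-I * P.tangent i s)
    rw [norm_mul, norm_tangent, norm_neg, norm_I, mul_one, mul_one] at this
    exact (abs_le.1 (this.trans (h1 _))).1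
  rw [← intervalIntegral.integral_add_adjacent_intervals (hint 0 η) (hint η _),
    ← intervalIntegral.integral_add_adjacent_intervals (hint η (P.len i - η)) (hint _ _)]
  have e1 : -η ≤ ∫ s in (0 : ℝ)..η, inner ℝ (φ (P.point i s)) (-I * P.tangent i s) := by
    have := intervalIntegral.integral_mono_on hη.le (μ := volume)
      (continuous_const.intervalIntegrable _ _) (hint 0 η) fun s _ => hlow s
    simpa using this
  have e3 : -η ≤ ∫ s in (P.len i - η)..P.len i,
      inner ℝ (φ (P.point i s)) (-I * P.tangent i s) := by
    have := intervalIntegral.integral_mono_on (μ := volume) (by linarith)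
      (continuous_const.intervalIntegrable _ _) (hint (P.len i - η) (P.len i)) fun s _ => hlow s
    simpa using this
  have e2 : ∫ s in η..(P.len i - η), inner ℝ (φ (P.point i s)) (-I * P.tangent i s) =
      (1 + η)⁻¹ * (P.len i - 2 * η) := by
    rw [intervalIntegral.integral_congr (g := fun _ => (1 + η)⁻¹)]
    · simp; ring
    · intro s hs
      rw [uIcc_of_le (by linarith)] at hs
      simp only
      rw [h2 i s hs, real_inner_smul_left, real_inner_self_eq_norm_sq, norm_mul, norm_tangent]
      simp
  rw [e2]; linarith

variable {P}

/-- The Caccioppoli perimeter of a region enclosed by a curved polygon is at least the length of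
the polygon. -/
theorem Encloses.length_le_caccioppoliPerimeter (h : P.Encloses R) :
    ENNReal.ofReal (∑ i, P.len i) ≤ caccioppoliPerimeter R := by
  have hlim : Tendsto (fun η : ℝ => ENNReal.ofReal (∑ i, ((1 + η)⁻¹ * (P.len i - 2 * η) - 2 * η)))
      (𝓝[>] 0) (𝓝 (ENNReal.ofReal (∑ i, P.len i))) := by
    refine ENNReal.tendsto_ofReal (Tendsto.mono_left ?_ nhdsWithin_le_nhds)
    refine tendsto_finsetSum _ fun i _ => ?_
    have : ContinuousAt (fun η : ℝ => (1 + η)⁻¹ * (P.len i - 2 * η) - 2 * η) 0 := by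
      have : (1 + (0 : ℝ)) ≠ 0 := by norm_num
      fun_prop (disch := assumption)
    simpa [ContinuousAt] using this
  refine le_of_tendsto hlim ?_
  have hsmall : ∀ᶠ η : ℝ in 𝓝[>] 0, ∀ i, 2 * η < P.len i := by
    refine eventually_all.2 fun i => ?_
    have hd : 0 < P.len i / 2 := by have := P.len_pos i; positivity
    filter_upwards [Ioo_mem_nhdsGT hd] with η hη
    linarith [hη.2]
  filter_upwards [hsmall, self_mem_nhdsWithin] with η h1 h2
  obtain ⟨φ, hφ, hc, hn, hv⟩ := P.exists_field_lower_bound h2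
  refine le_trans (ENNReal.ofReal_le_ofReal ?_) (le_caccioppoliPerimeter R hφ hc hn)
  rw [h.gaussGreen hφ]
  exact P.flux_lower_bound h2 h1 hφ.continuous hn hv

/-- Twice the area swept from the origin: the triangle over the chord plus twice the circular
segment. For `κ = 0` the last term reads `0 / 0`, which is `0` by convention, as it should be for a
segment. -/
theorem integral_arcPoint_cross {τ : ℂ} (hτ : ‖τ‖ = 1) (v : ℂ) (κ l : ℝ) :
    ∫ s in (0 : ℝ)..l, inner ℝ (arcPoint v τ κ s) (-I * arcTangent τ κ s) =
      ((starRingEnd ℂ) v * arcPoint v τ κ l).im + (κ * l - Real.sin (κ * l)) / κ ^ 2 := by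
  have hn : ∀ s, (arcTangent τ κ s).re ^ 2 + (arcTangent τ κ s).im ^ 2 = 1 := fun s => by
    have := Complex.sq_norm (arcTangent τ κ s)
    rw [norm_arcTangent hτ, normSq_apply] at this; linarith
  have hττ : τ.re ^ 2 + τ.im ^ 2 = 1 := by simpa [arcTangent] using hn 0
  by_cases h : κ = 0
  · subst h
    have : ∀ s : ℝ, inner ℝ (arcPoint v τ 0 s) (-I * arcTangent τ 0 s) =
        v.re * τ.im - v.im * τ.re := by
      intro s
      rw [arcPoint_flat]
      simp [arcTangent]
      ring
    simp only [this]
    rw [arcPoint_flat]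
    simp
    ring
  · have h1 : ∀ s : ℝ, inner ℝ (arcPoint v τ κ s) (-I * arcTangent τ κ s) =
        (((starRingEnd ℂ) (v + I * τ / κ)) * arcTangent τ κ s).im + κ⁻¹ := by
      intro s
      rw [arcPoint_curved v τ h]
      simp [Complex.div_re, Complex.div_im, normSq_apply]
      field_simp
      linear_combination hn s
    have h2 : ∫ s in (0 : ℝ)..l, arcTangent τ κ s = arcPoint v τ κ l - v := by
      rw [arcPoint]; simp [arcTangent]
    have h3 : ∫ s in (0 : ℝ)..l, (((starRingEnd ℂ) (v + I * τ / κ)) * arcTangent τ κ s).im =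
        (((starRingEnd ℂ) (v + I * τ / κ)) * (arcPoint v τ κ l - v)).im := by
      rw [← h2, ← intervalIntegral.integral_const_mul]
      exact (imCLM.intervalIntegral_comp_comm
        ((continuous_const.mul (continuous_arcTangent τ κ)).intervalIntegrable _ _))
    have hi : Continuous fun s : ℝ =>
        (((starRingEnd ℂ) (v + I * τ / κ)) * arcTangent τ κ s).im :=
      continuous_im.comp (continuous_const.mul (continuous_arcTangent τ κ))
    simp only [h1]
    rw [intervalIntegral.integral_add (hi.intervalIntegrable _ _)
      (continuous_const.intervalIntegrable _ _), h3, arcPoint_curved v τ h]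
    have e : arcTangent τ κ l = τ * (Real.cos (κ * l) + Real.sin (κ * l) * I) := by
      rw [arcTangent, Complex.exp_mul_I, ← Complex.ofReal_cos, ← Complex.ofReal_sin]
    rw [e]
    simp only [intervalIntegral.integral_const, sub_zero, smul_eq_mul]
    simp [Complex.div_re, Complex.div_im, normSq_apply, -Complex.ofReal_cos, -Complex.ofReal_sin]
    field_simp
    linear_combination (-Real.sin (κ * l)) * hττ

/-- The area of a region enclosed by a curved polygon: the shoelace formula for the vertices, plus
the circular segments. -/
theorem Encloses.two_mul_volume (h : P.Encloses R) :
    2 * volume.real R = ∑ i, (((starRingEnd ℂ) (P.vertex i) * P.vertex (i + 1)).im +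
      (P.curv i * P.len i - Real.sin (P.curv i * P.len i)) / P.curv i ^ 2) := by
  have h1 := h.gaussGreen (φ := fun z => z) contDiff_id
  have h2 : ∀ z, planeDiv (fun z => z) z = 2 := fun z => by
    simp [planeDiv]; norm_num
  simp only [h2] at h1
  rw [setIntegral_const, smul_eq_mul, mul_comm] at h1
  rw [h1, flux]
  refine Finset.sum_congr rfl fun i _ => ?_
  have := integral_arcPoint_cross (P.norm_dir i) (P.vertex i) (P.curv i) (P.len i)
  rw [P.vertex_succ i] at this
  exact this

end CurvedPolygon

/-! ### Angles, lengths and areas of curvilinear rectangles -/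

/-- The chord of an arc is parallel to the tangent at its midpoint. -/
theorem arcPoint_sub_eq_chord (v τ : ℂ) {κ : ℝ} (hκ : κ ≠ 0) (l : ℝ) :
    arcPoint v τ κ l - v =
      τ * exp ((κ * l / 2 : ℝ) * I) * (2 * Real.sin (κ * l / 2) / κ : ℝ) := by
  have hκ' : (κ : ℂ) ≠ 0 := by exact_mod_cast hκ
  have e1 : exp ((κ * l : ℝ) * I) = exp ((κ * l / 2 : ℝ) * I) * exp ((κ * l / 2 : ℝ) * I) := by
    rw [← Complex.exp_add]; congr 1; push_cast; ring
  have e2 : exp ((κ * l / 2 : ℝ) * I) = (Real.cos (κ * l / 2) : ℂ) + Real.sin (κ * l / 2) * I := by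
    rw [Complex.exp_mul_I, ← Complex.ofReal_cos, ← Complex.ofReal_sin]
  have e3 : (Real.cos (κ * l / 2) : ℂ) ^ 2 + (Real.sin (κ * l / 2) : ℂ) ^ 2 = 1 := by
    exact_mod_cast Real.cos_sq_add_sin_sq (κ * l / 2)
  have e4 : ((2 * Real.sin (κ * l / 2) / κ : ℝ) : ℂ) = 2 * (Real.sin (κ * l / 2) : ℂ) / κ := by
    push_cast; ring
  rw [arcPoint_curved v τ hκ, arcTangent, e1, e2, e4]
  set C : ℂ := (Real.cos (κ * l / 2) : ℂ)
  set S : ℂ := (Real.sin (κ * l / 2) : ℂ)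
  field_simp
  linear_combination (-I * τ) * e3 + (- 2 * τ * S * C - τ * S ^ 2 * I) * I_sq

theorem exp_two_pi_sub (x : ℝ) : exp ((x : ℝ) * I) = 1 ↔ ∃ k : ℤ, x = k * (2 * Real.pi) := by
  rw [Complex.exp_eq_one_iff]
  refine exists_congr fun k => ⟨fun h => ?_, fun h => ?_⟩
  · have h2 : (x : ℂ) = (k * (2 * Real.pi) : ℝ) := by
      have := mul_right_cancel₀ I_ne_zero (h.trans (by ring : _ = (k * (2 * Real.pi) : ℂ) * I))
      rw [this]; push_cast; ring
    exact_mod_cast h2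
  · rw [h]; push_cast; ring

namespace CurvedPolygon

variable {n : ℕ} [NeZero n] {P : CurvedPolygon n} {R : Set ℂ}

/-- An arc that turns by more than `2π` passes through its start again. One that turns by exactly
`2π` ends where it starts, which identifies two consecutive vertices; `hn` says that their indices
differ. -/
theorem abs_curv_mul_len_lt (P : CurvedPolygon n) (hn : (1 : Fin n) ≠ 0) {i : Fin n}
    (hκ : P.curv i ≠ 0) :
    |P.curv i| * P.len i < 2 * Real.pi := by
  have hpos : 0 < |P.curv i| := abs_pos.2 hκ
  have hper : arcPoint (P.vertex i) (P.dir i) (P.curv i) (2 * Real.pi / |P.curv i|) = P.vertex i := by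
    rw [arcPoint_curved _ _ hκ, arcTangent]
    have : exp ((P.curv i * (2 * Real.pi / |P.curv i|) : ℝ) * I) = 1 := by
      rw [exp_two_pi_sub]
      rcases lt_or_gt_of_ne hκ with h | h
      · refine ⟨-1, ?_⟩
        rw [abs_of_neg h]; push_cast; field_simp
      · refine ⟨1, ?_⟩
        rw [abs_of_pos h]; push_cast; field_simp
    rw [this, mul_one]; ring
  by_contra hcon
  have h1 : 2 * Real.pi / |P.curv i| ≤ P.len i := by
    rw [div_le_iff₀ hpos]; linarith [not_lt.1 hcon]
  have h0 : 0 < 2 * Real.pi / |P.curv i| := by have := Real.pi_pos; positivity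
  rcases h1.lt_or_eq with h2 | h2
  · have := P.simple i i 0 ⟨le_rfl, P.len_pos i⟩ _ ⟨h0.le, h2⟩ (by rw [hper, arcPoint_zero])
    linarith [this.2]
  · have h3 : P.vertex (i + 1) = P.vertex i := by rw [← P.vertex_succ i, ← h2, hper]
    have := P.simple (i + 1) i 0 ⟨le_rfl, P.len_pos _⟩ 0 ⟨le_rfl, P.len_pos _⟩
      (by rw [arcPoint_zero, arcPoint_zero, h3])
    exact hn (by simpa using this.1)

end CurvedPolygon

/-- The area, in units of the squared radius of the arcs, of a curvilinear square. -/
noncomputable def squareConst : ℝ := Real.pi / 3 + 1 - √3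

theorem sin_mul_sin_rect (a b : ℝ) :
    4 * (Real.sin (a / 2) * Real.sin (b / 2)) =
      2 * (Real.cos ((a - b) / 2) - Real.cos ((a + b) / 2)) := by
  have h1 : (a - b) / 2 = a / 2 - b / 2 := by ring
  have h2 : (a + b) / 2 = a / 2 + b / 2 := by ring
  rw [h1, h2, Real.cos_sub, Real.cos_add]; ring

theorem sin_add_sin_rect (a b : ℝ) :
    Real.sin a + Real.sin b = 2 * (Real.sin ((a + b) / 2) * Real.cos ((a - b) / 2)) := by
  have h1 : a = (a + b) / 2 + (a - b) / 2 := by ring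
  have h2 : b = (a + b) / 2 - (a - b) / 2 := by ring
  conv_lhs => rw [h1, h2]
  rw [Real.sin_add, Real.sin_sub]
  ring_nf

theorem cos_eq_zero_of_mem_Ioo {x : ℝ} (h0 : 0 < x) (h1 : x < 2 * Real.pi + Real.pi / 2)
    (h : Real.cos x = 0) : x = Real.pi / 2 ∨ x = 3 * Real.pi / 2 := by
  obtain ⟨k, hk⟩ := Real.cos_eq_zero_iff.1 h
  have hpi := Real.pi_pos
  have k0 : -1 < k := by
    by_contra hcon
    have : (k : ℝ) ≤ -1 := by exact_mod_cast not_lt.1 hcon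
    nlinarith
  have k1 : k < 2 := by
    by_contra hcon
    have : (2 : ℝ) ≤ k := by exact_mod_cast not_lt.1 hcon
    nlinarith
  interval_cases k
  · left; rw [hk]; push_cast; ring
  · right; rw [hk]; push_cast; ring

/-- The angles of the arcs of a curvilinear rectangle. -/
theorem rectangle_angles {p : ℝ} (hp : 0 < p) (P : CurvedPolygon 4) (hκ : ∀ i, P.curv i = p)
    (hin : ∀ i, inner ℝ (P.vertex (i + 1) - P.vertex i) (P.vertex (i + 2) - P.vertex (i + 1)) = 0) :
    P.len 2 = P.len 0 ∧ P.len 3 = P.len 1 ∧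
    (p * P.len 0 + p * P.len 1 = Real.pi / 3 ∨ p * P.len 0 + p * P.len 1 = 7 * Real.pi / 3) := by
  have hpi := Real.pi_pos
  have hθ : ∀ i, 0 < p * P.len i ∧ p * P.len i < 2 * Real.pi := fun i => by
    have h := P.abs_curv_mul_len_lt (by decide) (i := i) (by rw [hκ]; exact hp.ne')
    rw [hκ, abs_of_pos hp] at h
    exact ⟨mul_pos hp (P.len_pos i), h⟩
  -- The tangents at the midpoints of consecutive arcs, hence the chords, enclose the angle `(θ +
  -- θ') / 2 + π / 3`. Orthogonality makes it `π / 2` or `3π / 2`, and the second value leads to `7π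
  -- / 3`.
  have hsum : ∀ i, p * P.len i + p * P.len (i + 1) = Real.pi / 3 ∨
      p * P.len i + p * P.len (i + 1) = 7 * Real.pi / 3 := by
    intro i
    have e0 : P.vertex (i + 1) - P.vertex i = P.dir i * exp ((p * P.len i / 2 : ℝ) * I) *
        (2 * Real.sin (p * P.len i / 2) / p : ℝ) := by
      rw [← P.vertex_succ i, hκ, arcPoint_sub_eq_chord _ _ hp.ne']
    have e1 : P.vertex (i + 2) - P.vertex (i + 1) =
        (P.dir i * exp ((p * P.len i / 2 : ℝ) * I)) *
        exp (((p * P.len i + p * P.len (i + 1)) / 2 + Real.pi / 3 : ℝ) * I) *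
        (2 * Real.sin (p * P.len (i + 1) / 2) / p : ℝ) := by
      have h2 : i + 2 = i + 1 + 1 := by rw [add_assoc]; rfl
      rw [h2, ← P.vertex_succ (i + 1), hκ, arcPoint_sub_eq_chord _ _ hp.ne', P.dir_succ, hκ]
      congr 1
      simp only [mul_assoc, ← Complex.exp_add]
      congr 2; push_cast; ring
    have h := hin i
    rw [e0, e1] at h
    set u := P.dir i * exp ((p * P.len i / 2 : ℝ) * I) with hu
    have hun : ‖u‖ = 1 := by rw [hu, norm_mul, P.norm_dir, Complex.norm_exp_ofReal_mul_I, one_mul]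
    have hun2 : u.re ^ 2 + u.im ^ 2 = 1 := by
      have := Complex.sq_norm u
      rw [hun, normSq_apply] at this; linarith
    have s0 : 0 < Real.sin (p * P.len i / 2) :=
      Real.sin_pos_of_pos_of_lt_pi (by linarith [(hθ i).1]) (by linarith [(hθ i).2])
    have s1 : 0 < Real.sin (p * P.len (i + 1) / 2) :=
      Real.sin_pos_of_pos_of_lt_pi (by linarith [(hθ (i + 1)).1]) (by linarith [(hθ (i + 1)).2])
    set x := (p * P.len i + p * P.len (i + 1)) / 2 + Real.pi / 3 with hx
    have hcos : Real.cos x = 0 := by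
      rw [Complex.exp_mul_I, ← Complex.ofReal_cos, ← Complex.ofReal_sin, Complex.inner] at h
      have h' : (2 * Real.sin (p * P.len i / 2) / p) * (2 * Real.sin (p * P.len (i + 1) / 2) / p) *
          Real.cos x = 0 := by
        rw [← h]
        simp [-Complex.ofReal_cos, -Complex.ofReal_sin, -Complex.ofReal_mul, -Complex.ofReal_div]
        linear_combination (-(2 * Real.sin (p * P.len i / 2) / p) *
          (2 * Real.sin (p * P.len (i + 1) / 2) / p) * Real.cos x) * hun2
      rcases mul_eq_zero.1 h' with h'' | h''
      · exact absurd h'' (by positivity)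
      · exact h''
    rcases cos_eq_zero_of_mem_Ioo (by linarith [(hθ i).1, (hθ (i + 1)).1])
      (by linarith [(hθ i).2, (hθ (i + 1)).2]) hcos with h | h
    · left; linarith
    · right; linarith
  have key : ∀ i, P.len (i + 2) = P.len i := by
    intro i
    have h1 := hsum i
    have h2 := hsum (i + 1)
    have h3 : i + 1 + 1 = i + 2 := by rw [add_assoc]; rfl
    rw [h3] at h2
    -- Mixed cases would make two angles in `(0, 2π)` differ by `2π`.
    have : p * P.len (i + 2) = p * P.len i := by
      have := hθ i; have := hθ (i + 2)
      rcases h1 with h1 | h1 <;> rcases h2 with h2 | h2 <;> linarith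
    exact mul_left_cancel₀ hp.ne' this
  exact ⟨key 0, key 1, hsum 0⟩

/-- Area of the rectangle of chords plus four circular segments. The sign `σ` records whether the
rectangle is run through counterclockwise; it is `-1` for the spurious angle sum. -/
theorem rectangle_volume {p : ℝ} (hp : 0 < p) (P : CurvedPolygon 4) (hκ : ∀ i, P.curv i = p)
    {R : Set ℂ} (hR : P.Encloses R) (h2 : P.len 2 = P.len 0) (h3 : P.len 3 = P.len 1)
    {σ : ℝ} (hσ : exp (((p * P.len 0 + p * P.len 1) / 2 + Real.pi / 3 : ℝ) * I) = σ * I)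
    (hσ2 : σ ^ 2 = 1) :
    volume.real R = p⁻¹ ^ 2 * (σ * (4 * (Real.sin (p * P.len 0 / 2) * Real.sin (p * P.len 1 / 2))) +
      (p * P.len 0 + p * P.len 1) - (Real.sin (p * P.len 0) + Real.sin (p * P.len 1))) := by
  set u := P.dir 0 * exp ((p * P.len 0 / 2 : ℝ) * I) with hu
  have hun : u.re ^ 2 + u.im ^ 2 = 1 := by
    have h1 : ‖u‖ = 1 := by rw [hu, norm_mul, P.norm_dir, Complex.norm_exp_ofReal_mul_I, one_mul]
    have := Complex.sq_norm u
    rw [h1, normSq_apply] at this; linarith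
  have hmid : ∀ i, P.dir (i + 1) * exp ((p * P.len (i + 1) / 2 : ℝ) * I) =
      P.dir i * exp ((p * P.len i / 2 : ℝ) * I) *
        exp (((p * P.len i + p * P.len (i + 1)) / 2 + Real.pi / 3 : ℝ) * I) := by
    intro i
    rw [P.dir_succ, hκ]
    simp only [mul_assoc, ← Complex.exp_add]
    congr 2; push_cast; ring
  have hch : ∀ i, P.vertex (i + 1) - P.vertex i = P.dir i * exp ((p * P.len i / 2 : ℝ) * I) *
      (2 * Real.sin (p * P.len i / 2) / p : ℝ) := by
    intro i
    rw [← P.vertex_succ i, hκ, arcPoint_sub_eq_chord _ _ hp.ne']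
  have m1 : P.dir 1 * exp ((p * P.len 1 / 2 : ℝ) * I) = u * (σ * I) := by
    have := hmid 0; rw [zero_add, hσ] at this; exact this
  have m2 : P.dir 2 * exp ((p * P.len 0 / 2 : ℝ) * I) = -u := by
    have := hmid 1
    have e : (1 : Fin 4) + 1 = 2 := rfl
    rw [e, h2, add_comm (p * P.len 1), hσ, m1] at this
    rw [this]
    have hσ2' : (σ : ℂ) ^ 2 = 1 := by exact_mod_cast hσ2
    linear_combination (-u) * hσ2' + u * (σ : ℂ) ^ 2 * I_sq
  have c0 := hch 0
  have c1 := hch 1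
  have c2 := hch 2
  have e1 : (1 : Fin 4) + 1 = 2 := rfl
  have e2 : (2 : Fin 4) + 1 = 3 := rfl
  have e3 : (3 : Fin 4) + 1 = 0 := rfl
  rw [e1, m1] at c1
  rw [e2, h2, m2] at c2
  rw [zero_add, ← hu] at c0
  have v1 : P.vertex 1 = P.vertex 0 + u * (2 * Real.sin (p * P.len 0 / 2) / p : ℝ) := by
    rw [← c0]; ring
  have v2 : P.vertex 2 = P.vertex 0 + u * (2 * Real.sin (p * P.len 0 / 2) / p : ℝ) +
      u * (σ * I) * (2 * Real.sin (p * P.len 1 / 2) / p : ℝ) := by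
    rw [← c1, v1]; ring
  have v3 : P.vertex 3 = P.vertex 0 +
      u * (σ * I) * (2 * Real.sin (p * P.len 1 / 2) / p : ℝ) := by
    have : P.vertex 3 = (P.vertex 3 - P.vertex 2) + P.vertex 2 := by ring
    rw [this, c2, v2]; ring
  have hvol := hR.two_mul_volume
  simp only [Fin.sum_univ_four, hκ, e1, e2, e3, h2, h3, zero_add] at hvol
  have hA : ∀ a b : ℝ, ((starRingEnd ℂ) (P.vertex 0) * (P.vertex 0 + u * a)).im +
      ((starRingEnd ℂ) (P.vertex 0 + u * a) * (P.vertex 0 + u * a + u * (σ * I) * b)).im +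
      ((starRingEnd ℂ) (P.vertex 0 + u * a + u * (σ * I) * b) *
        (P.vertex 0 + u * (σ * I) * b)).im +
      ((starRingEnd ℂ) (P.vertex 0 + u * (σ * I) * b) * P.vertex 0).im = 2 * σ * a * b := by
    intro a b
    simp
    linear_combination (2 * σ * a * b) * hun
  have := hA (2 * Real.sin (p * P.len 0 / 2) / p) (2 * Real.sin (p * P.len 1 / 2) / p)
  rw [← v2, ← v3, ← v1] at this
  have hfin : 2 * volume.real R = 2 * σ * (2 * Real.sin (p * P.len 0 / 2) / p) *
      (2 * Real.sin (p * P.len 1 / 2) / p) + 2 * ((p * P.len 0 - Real.sin (p * P.len 0)) / p ^ 2 +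
      (p * P.len 1 - Real.sin (p * P.len 1)) / p ^ 2) := by
    rw [hvol, ← this]; ring
  have h4 : volume.real R = σ * (2 * Real.sin (p * P.len 0 / 2) / p) *
      (2 * Real.sin (p * P.len 1 / 2) / p) + ((p * P.len 0 - Real.sin (p * P.len 0)) / p ^ 2 +
      (p * P.len 1 - Real.sin (p * P.len 1)) / p ^ 2) := by linarith
  rw [h4]; field_simp; ring

/-- The area of a curvilinear rectangle is at most that of the curvilinear square with the same
curvature. The second alternative cannot occur, but it is easily dealt with together with the first
one. -/
theorem rectangle_area_bounds {p : ℝ} (hp : 0 < p) (P : CurvedPolygon 4) (hκ : ∀ i, P.curv i = p)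
    {R : Set ℂ} (hR : P.Encloses R)
    (hin : ∀ i, inner ℝ (P.vertex (i + 1) - P.vertex i) (P.vertex (i + 2) - P.vertex (i + 1)) = 0) :
    (∑ i, P.len i = 2 * (Real.pi / 3) / p ∧ volume.real R ≤ squareConst * p⁻¹ ^ 2 ∧
      (volume.real R = squareConst * p⁻¹ ^ 2 → ∀ i, p * P.len i = Real.pi / 6)) ∨
    (∑ i, P.len i = 2 * (7 * Real.pi / 3) / p ∧
      volume.real R ≤ (7 * Real.pi / 3 - √3 + 1) * p⁻¹ ^ 2) := by
  obtain ⟨h2, h3, hs⟩ := rectangle_angles hp P hκ hin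
  have hpi := Real.pi_pos
  have hr : 0 < p⁻¹ ^ 2 := by positivity
  have hlen : ∑ i, P.len i = 2 * (p * P.len 0 + p * P.len 1) / p := by
    rw [Fin.sum_univ_four, h2, h3]; field_simp; ring
  rcases hs with hs | hs
  · left
    have hσ : exp (((p * P.len 0 + p * P.len 1) / 2 + Real.pi / 3 : ℝ) * I) = (1 : ℝ) * I := by
      rw [hs, show (Real.pi / 3 / 2 + Real.pi / 3 : ℝ) = Real.pi / 2 by ring]
      rw [Complex.exp_mul_I, ← Complex.ofReal_cos, ← Complex.ofReal_sin]; simp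
    have hv := rectangle_volume hp P hκ hR h2 h3 hσ (by norm_num)
    -- For angles `a + b = π / 3` the area in units of `r²` becomes `cos ((a - b) / 2) + π / 3 -
    -- √3`, which is largest exactly for `a = b`.
    rw [sin_mul_sin_rect, sin_add_sin_rect, hs, show Real.pi / 3 / 2 = Real.pi / 6 by ring,
      Real.cos_pi_div_six, Real.sin_pi_div_six] at hv
    refine ⟨by rw [hlen, hs], ?_, fun heq => ?_⟩
    · rw [hv, mul_comm, squareConst]
      refine mul_le_mul_of_nonneg_right ?_ hr.le
      linarith [Real.cos_le_one ((p * P.len 0 - p * P.len 1) / 2)]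
    · rw [hv, mul_comm, squareConst] at heq
      have h4 := mul_right_cancel₀ hr.ne' heq
      have h5 : Real.cos ((p * P.len 0 - p * P.len 1) / 2) = 1 := by linarith
      have hp0 := mul_pos hp (P.len_pos 0)
      have hp1 := mul_pos hp (P.len_pos 1)
      have h6 := (Real.cos_eq_one_iff_of_lt_of_lt (by linarith) (by linarith)).1 h5
      intro i
      fin_cases i
      · change p * P.len 0 = _; linarith
      · change p * P.len 1 = _; linarith
      · change p * P.len 2 = _; rw [h2]; linarith
      · change p * P.len 3 = _; rw [h3]; linarith
  · right
    have e7 : (7 * Real.pi / 3 / 2 : ℝ) = Real.pi / 6 + Real.pi := by ring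
    have hσ : exp (((p * P.len 0 + p * P.len 1) / 2 + Real.pi / 3 : ℝ) * I) = (-1 : ℝ) * I := by
      rw [hs, show (7 * Real.pi / 3 / 2 + Real.pi / 3 : ℝ) = Real.pi / 2 + Real.pi by ring]
      rw [Complex.exp_mul_I, ← Complex.ofReal_cos, ← Complex.ofReal_sin, Real.cos_add_pi,
        Real.sin_add_pi]; simp
    have hv := rectangle_volume hp P hκ hR h2 h3 hσ (by norm_num)
    -- Here the area in units of `r²` is `7π / 3 - √3 - cos ((a - b) / 2)`.
    rw [sin_mul_sin_rect, sin_add_sin_rect, hs, e7, Real.cos_add_pi, Real.sin_add_pi,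
      Real.cos_pi_div_six, Real.sin_pi_div_six] at hv
    refine ⟨by rw [hlen, hs], ?_⟩
    rw [hv, mul_comm]
    refine mul_le_mul_of_nonneg_right ?_ hr.le
    linarith [Real.neg_one_le_cos ((p * P.len 0 - p * P.len 1) / 2)]

/-! ### Angles, lengths and areas of chipped parallelograms -/

/-- Rotation leaves the cross product unchanged. Translation adds a difference that telescopes to
zero in a shoelace sum over a closed polygon. -/
theorem sum_cross_translate {z d : ℂ} (hd : ‖d‖ = 1) (q q' : ℂ) :
    ((starRingEnd ℂ) (z + d * q) * (z + d * q')).im =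
      ((starRingEnd ℂ) z * (d * q')).im - ((starRingEnd ℂ) z * (d * q)).im +
        ((starRingEnd ℂ) q * q').im := by
  have hn : d.re ^ 2 + d.im ^ 2 = 1 := by
    have := Complex.sq_norm d
    rw [hd, normSq_apply] at this; linarith
  simp
  linear_combination (q.re * q'.im - q.im * q'.re) * hn

theorem exp_pi_div_three : exp ((Real.pi / 3 : ℝ) * I) = (1 / 2 : ℝ) + (√3 / 2 : ℝ) * I := by
  rw [Complex.exp_mul_I, ← Complex.ofReal_cos, ← Complex.ofReal_sin, Real.cos_pi_div_three,
    Real.sin_pi_div_three]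

theorem exp_mul_I_eq_neg_one {x : ℝ} (h : exp ((x : ℝ) * I) = -1) (h0 : -(3 * Real.pi) < x)
    (h1 : x < 3 * Real.pi) : x = Real.pi ∨ x = -Real.pi := by
  have h2 : exp ((x + Real.pi : ℝ) * I) = 1 := by
    push_cast
    rw [add_mul, Complex.exp_add, h, Complex.exp_pi_mul_I]; norm_num
  obtain ⟨k, hk⟩ := (exp_two_pi_sub _).1 h2
  have hpi := Real.pi_pos
  have k0 : -1 < k := by
    by_contra hcon
    have : (k : ℝ) ≤ -1 := by exact_mod_cast not_lt.1 hcon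
    nlinarith
  have k1 : k < 2 := by
    by_contra hcon
    have : (2 : ℝ) ≤ k := by exact_mod_cast not_lt.1 hcon
    nlinarith
  interval_cases k
  · right; push_cast at hk; linarith
  · left; push_cast at hk; linarith

/-- The angles of the arcs of a chipped parallelogram. -/
theorem chipped_angles {p : ℝ} (hp : 0 < p) (P : CurvedPolygon 8)
    (hκ : ∀ i : Fin 8, P.curv i = if Even (i : ℕ) then 0 else -p)
    (hdir : ∀ i : Fin 8, Even (i : ℕ) → P.dir (i + 4) = -P.dir i) :
    P.len 5 = P.len 1 ∧ P.len 7 = P.len 3 ∧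
    (p * P.len 1 + p * P.len 3 = Real.pi / 3 ∨ p * P.len 1 + p * P.len 3 = 7 * Real.pi / 3) := by
  have hpi := Real.pi_pos
  have hθ : ∀ i : Fin 8, ¬ Even (i : ℕ) → 0 < p * P.len i ∧ p * P.len i < 2 * Real.pi := by
    intro i hi
    have h1 : P.curv i = -p := by rw [hκ, if_neg hi]
    have h := P.abs_curv_mul_len_lt (by decide) (i := i) (by rw [h1]; linarith)
    rw [h1, abs_neg, abs_of_pos hp] at h
    exact ⟨mul_pos hp (P.len_pos i), h⟩
  have hsum : ∀ i : Fin 8, Even (i : ℕ) →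
      p * P.len (i + 1) + p * P.len (i + 3) = Real.pi / 3 ∨
      p * P.len (i + 1) + p * P.len (i + 3) = 7 * Real.pi / 3 := by
    intro i hi
    have o1 : ¬ Even ((i + 1 : Fin 8) : ℕ) := by revert hi; revert i; decide
    have o2 : Even ((i + 2 : Fin 8) : ℕ) := by revert hi; revert i; decide
    have o3 : ¬ Even ((i + 3 : Fin 8) : ℕ) := by revert hi; revert i; decide
    have e2 : i + 1 + 1 = i + 2 := by rw [add_assoc]; rfl
    have e3 : i + 2 + 1 = i + 3 := by rw [add_assoc]; rfl
    have e4 : i + 3 + 1 = i + 4 := by rw [add_assoc]; rfl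
    have d1 := P.dir_succ i
    have d2 := P.dir_succ (i + 1)
    have d3 := P.dir_succ (i + 2)
    have d4 := P.dir_succ (i + 3)
    rw [hκ, if_pos hi] at d1
    rw [hκ, if_neg o1, e2, d1] at d2
    rw [hκ, if_pos o2, e3, d2] at d3
    rw [hκ, if_neg o3, e4, d3, hdir i hi] at d4
    have hne : P.dir i ≠ 0 := by
      intro h0; have := P.norm_dir i; rw [h0] at this; simp at this
    -- From a flat edge to the opposite one the tangent makes four corners of `π / 3` and turns back
    -- along two concave arcs; the total must be a half turn.
    have hexp : exp ((4 * Real.pi / 3 - (p * P.len (i + 1) + p * P.len (i + 3)) : ℝ) * I) = -1 := by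
      refine mul_left_cancel₀ hne ?_
      rw [mul_neg_one, d4]
      simp only [mul_assoc, ← Complex.exp_add]
      congr 2; push_cast; ring
    have h1 := hθ _ o1
    have h3 := hθ _ o3
    rcases exp_mul_I_eq_neg_one hexp (by linarith) (by linarith) with h | h
    · left; linarith
    · right; linarith
  have s0 := hsum 0 (by decide)
  have s2 := hsum 2 (by decide)
  have s4 := hsum 4 (by decide)
  have f1 : (2 : Fin 8) + 1 = 3 := rfl
  have f2 : (2 : Fin 8) + 3 = 5 := rfl
  have f3 : (4 : Fin 8) + 1 = 5 := rfl
  have f4 : (4 : Fin 8) + 3 = 7 := rfl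
  rw [zero_add, zero_add] at s0
  rw [f1, f2] at s2
  rw [f3, f4] at s4
  have t1 := hθ 1 (by decide)
  have t3 := hθ 3 (by decide)
  have t5 := hθ 5 (by decide)
  have t7 := hθ 7 (by decide)
  have h5 : p * P.len 5 = p * P.len 1 := by
    rcases s0 with s0 | s0 <;> rcases s2 with s2 | s2 <;> linarith
  have h7 : p * P.len 7 = p * P.len 3 := by
    rcases s2 with s2 | s2 <;> rcases s4 with s4 | s4 <;> linarith
  exact ⟨mul_left_cancel₀ hp.ne' h5, mul_left_cancel₀ hp.ne' h7, s0⟩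

/-- The edge vectors of a chipped parallelogram, in terms of the direction `d` of its first edge
and of `E = exp (-i θ)`, where `θ` is the angle of its first arc. -/
theorem chipped_edges {p : ℝ} (hp : 0 < p) (P : CurvedPolygon 8)
    (hκ : ∀ i : Fin 8, P.curv i = if Even (i : ℕ) then 0 else -p)
    (hdir : ∀ i : Fin 8, Even (i : ℕ) → P.dir (i + 4) = -P.dir i)
    {ω E : ℂ} (hω : ω = exp ((Real.pi / 3 : ℝ) * I)) (hE : E = exp ((-(p * P.len 1) : ℝ) * I)) :
    P.vertex 1 - P.vertex 0 = P.dir 0 * P.len 0 ∧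
    P.vertex 2 - P.vertex 1 = P.dir 0 * ((p⁻¹ : ℝ) * (-I * (ω - ω * E))) ∧
    P.vertex 3 - P.vertex 2 = P.dir 0 * (P.len 2 * (ω ^ 2 * E)) ∧
    P.vertex 4 - P.vertex 3 = P.dir 0 * ((p⁻¹ : ℝ) * (-I * (-E - ω ^ 2))) ∧
    P.vertex 5 - P.vertex 4 = P.dir 0 * (-P.len 4) ∧
    P.vertex 6 - P.vertex 5 = P.dir 0 * ((p⁻¹ : ℝ) * (I * (ω - ω * E))) ∧
    P.vertex 7 - P.vertex 6 = P.dir 0 * (-(P.len 6 * (ω ^ 2 * E))) ∧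
    P.vertex 0 - P.vertex 7 = P.dir 0 * ((p⁻¹ : ℝ) * (I * (-E - ω ^ 2))) ∧
    ω ^ 3 = -1 ∧ exp ((-(p * P.len 3) : ℝ) * I) * (ω * E) = 1 := by
  obtain ⟨h5, h7, hs⟩ := chipped_angles hp P hκ hdir
  have hp' : (p : ℂ) ≠ 0 := by exact_mod_cast hp.ne'
  have hω3 : ω ^ 3 = -1 := by
    rw [hω, ← Complex.exp_nat_mul, ← Complex.exp_pi_mul_I]; congr 1; push_cast; ring
  have hEE : exp ((-(p * P.len 3) : ℝ) * I) * (ω * E) = 1 := by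
    rw [hω, hE, ← Complex.exp_add, ← Complex.exp_add]
    have : ((-(p * P.len 3) : ℝ) * I + ((Real.pi / 3 : ℝ) * I + (-(p * P.len 1) : ℝ) * I) : ℂ) =
        ((Real.pi / 3 - (p * P.len 1 + p * P.len 3) : ℝ) : ℂ) * I := by push_cast; ring
    rw [this, exp_two_pi_sub]
    rcases hs with hs | hs
    · exact ⟨0, by rw [hs]; simp⟩
    · exact ⟨-1, by rw [hs]; push_cast; ring⟩
  set E₃ := exp ((-(p * P.len 3) : ℝ) * I) with hE₃
  have hflat : ∀ i : Fin 8, Even (i : ℕ) → P.vertex (i + 1) - P.vertex i = P.dir i * P.len i ∧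
      P.dir (i + 1) = P.dir i * ω := by
    intro i hi
    have h0 : P.curv i = 0 := by rw [hκ, if_pos hi]
    refine ⟨?_, ?_⟩
    · rw [← P.vertex_succ i, h0, arcPoint_flat]; ring
    · rw [P.dir_succ i, h0, hω]; simp
  have hcurved : ∀ i : Fin 8, ¬ Even (i : ℕ) →
      P.vertex (i + 1) - P.vertex i =
        (p⁻¹ : ℝ) * (-I * (P.dir i - P.dir i * exp ((-(p * P.len i) : ℝ) * I))) ∧
      P.dir (i + 1) = P.dir i * exp ((-(p * P.len i) : ℝ) * I) * ω := by
    intro i hi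
    have h0 : P.curv i = -p := by rw [hκ, if_neg hi]
    have h1 : -p ≠ 0 := by linarith
    refine ⟨?_, ?_⟩
    · rw [← P.vertex_succ i, h0, arcPoint_curved _ _ h1, arcTangent,
        show -p * P.len i = -(p * P.len i) by ring]
      push_cast
      field_simp
      ring
    · rw [P.dir_succ i, h0, hω, mul_assoc, ← Complex.exp_add]
      congr 2; push_cast; ring
  obtain ⟨a0, b0⟩ := hflat 0 (by decide)
  obtain ⟨a1, b1⟩ := hcurved 1 (by decide)
  obtain ⟨a2, b2⟩ := hflat 2 (by decide)
  obtain ⟨a3, b3⟩ := hcurved 3 (by decide)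
  obtain ⟨a4, b4⟩ := hflat 4 (by decide)
  obtain ⟨a5, b5⟩ := hcurved 5 (by decide)
  obtain ⟨a6, b6⟩ := hflat 6 (by decide)
  obtain ⟨a7, b7⟩ := hcurved 7 (by decide)
  have c4 := hdir 0 (by decide)
  have c6 := hdir 2 (by decide)
  have f0 : (0 : Fin 8) + 1 = 1 := rfl
  have f1 : (1 : Fin 8) + 1 = 2 := rfl
  have f2 : (2 : Fin 8) + 1 = 3 := rfl
  have f3 : (3 : Fin 8) + 1 = 4 := rfl
  have f4 : (4 : Fin 8) + 1 = 5 := rfl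
  have f5 : (5 : Fin 8) + 1 = 6 := rfl
  have f6 : (6 : Fin 8) + 1 = 7 := rfl
  have f7 : (7 : Fin 8) + 1 = 0 := rfl
  have g4 : (0 : Fin 8) + 4 = 4 := rfl
  have g6 : (2 : Fin 8) + 4 = 6 := rfl
  rw [f0] at a0 b0
  rw [f1, b0, ← hE] at a1 b1
  rw [f2, b1] at a2 b2
  rw [f3, ← hE₃, b2] at a3
  rw [g4] at c4
  rw [g6, b1] at c6
  rw [f4, c4] at a4 b4
  rw [f5, b4, h5, ← hE] at a5
  rw [f6, c6] at a6 b6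
  rw [f7, b6, h7, ← hE₃] at a7
  refine ⟨a0, ?_, ?_, ?_, ?_, ?_, ?_, ?_, hω3, hEE⟩
  · rw [a1]; ring
  · rw [a2]; ring
  · rw [a3]
    linear_combination (p⁻¹ : ℝ) * (-I * P.dir 0) * (E * hω3 - ω ^ 2 * hEE)
  · rw [a4]; ring
  · rw [a5]; ring
  · rw [a6]; ring
  · rw [a7]
    linear_combination -(p⁻¹ : ℝ) * (-I * P.dir 0) * (E * hω3 - ω ^ 2 * hEE)

/-- The side lengths and the area of a chipped parallelogram. -/
theorem chipped_volume {p : ℝ} (hp : 0 < p) (P : CurvedPolygon 8)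
    (hκ : ∀ i : Fin 8, P.curv i = if Even (i : ℕ) then 0 else -p)
    (hdir : ∀ i : Fin 8, Even (i : ℕ) → P.dir (i + 4) = -P.dir i)
    {R : Set ℂ} (hR : P.Encloses R) (hvpos : 0 < volume.real R) :
    P.len 4 = P.len 0 ∧ P.len 6 = P.len 2 ∧
    volume.real R = Real.sin (2 * Real.pi / 3 - p * P.len 1) * (P.len 0 * P.len 2) +
      p⁻¹ * (P.len 0 + P.len 2) * (√3 * Real.sin (2 * Real.pi / 3 - p * P.len 1) - 1) +
      p⁻¹ ^ 2 * (3 * Real.sin (2 * Real.pi / 3 - p * P.len 1) - √3 - (p * P.len 1 + p * P.len 3)) := by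
  obtain ⟨h5, h7, hs⟩ := chipped_angles hp P hκ hdir
  obtain ⟨a0, a1, a2, a3, a4, a5, a6, a7, hω3, hEE⟩ := chipped_edges hp P hκ hdir rfl rfl
  rw [exp_pi_div_three] at a1 a2 a3 a5 a6 a7 hω3 hEE
  have hx : exp ((-(p * P.len 1) : ℝ) * I) =
      (Real.cos (p * P.len 1) : ℂ) + (-Real.sin (p * P.len 1) : ℝ) * I := by
    rw [Complex.exp_mul_I, ← Complex.ofReal_cos, ← Complex.ofReal_sin, Real.cos_neg, Real.sin_neg]
  have hx3 : exp ((-(p * P.len 3) : ℝ) * I) =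
      (Real.cos (p * P.len 3) : ℂ) + (-Real.sin (p * P.len 3) : ℝ) * I := by
    rw [Complex.exp_mul_I, ← Complex.ofReal_cos, ← Complex.ofReal_sin, Real.cos_neg, Real.sin_neg]
  rw [hx] at a1 a2 a3 a5 a6 a7 hEE
  rw [hx3] at hEE
  have hsin : Real.sin (2 * Real.pi / 3 - p * P.len 1) =
      √3 / 2 * Real.cos (p * P.len 1) - (-Real.sin (p * P.len 1)) / 2 := by
    rw [show 2 * Real.pi / 3 = Real.pi - Real.pi / 3 by ring, Real.sin_sub, Real.sin_pi_sub,
      Real.cos_pi_sub, Real.sin_pi_div_three, Real.cos_pi_div_three]; ring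
  have hxy : Real.cos (p * P.len 1) ^ 2 + (-Real.sin (p * P.len 1)) ^ 2 = 1 := by
    rw [neg_sq]; exact Real.cos_sq_add_sin_sq _
  have hxy3 : Real.cos (p * P.len 3) ^ 2 + (-Real.sin (p * P.len 3)) ^ 2 = 1 := by
    rw [neg_sq]; exact Real.cos_sq_add_sin_sq _
  have ht : √3 ^ 2 = 3 := Real.sq_sqrt (by norm_num)
  have ht0 : 0 < √3 := by positivity
  have hvol := hR.two_mul_volume
  rw [Fin.sum_univ_eight] at hvol
  have k0 : P.curv 0 = 0 := hκ 0
  have k1 : P.curv 1 = -p := hκ 1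
  have k2 : P.curv 2 = 0 := hκ 2
  have k3 : P.curv 3 = -p := hκ 3
  have k4 : P.curv 4 = 0 := hκ 4
  have k5 : P.curv 5 = -p := hκ 5
  have k6 : P.curv 6 = 0 := hκ 6
  have k7 : P.curv 7 = -p := hκ 7
  rw [k0, k1, k2, k3, k4, k5, k6, k7, h5, h7] at hvol
  have hm : ∀ l : ℝ, (-p * l - Real.sin (-p * l)) / (-p) ^ 2 =
      p⁻¹ ^ 2 * (-Real.sin (p * l) * (-1) - p * l) := by
    intro l
    rw [show -p * l = -(p * l) by ring, Real.sin_neg]; field_simp; ring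
  simp only [hm, zero_mul, Real.sin_zero, sub_zero, zero_div, add_zero] at hvol
  rw [hsin]
  set r := p⁻¹ with hr
  have hr0 : 0 < r := by positivity
  set θ₁ := p * P.len 1
  set θ₃ := p * P.len 3
  set x := Real.cos θ₁
  set y := -Real.sin θ₁
  set x' := Real.cos θ₃
  set y' := -Real.sin θ₃
  set t := √3
  have hσ : 0 < θ₁ + θ₃ := by
    have h1 := mul_pos hp (P.len_pos 1)
    have h3 := mul_pos hp (P.len_pos 3)
    positivity
  -- coordinates of the edge vectors with respect to the direction of the first edge
  obtain ⟨g, hg⟩ : ∃ g, g = x / 2 - t * y / 2 := ⟨_, rfl⟩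
  obtain ⟨h, hh⟩ : ∃ h, h = y / 2 + t * x / 2 := ⟨_, rfl⟩
  obtain ⟨α, hα⟩ : ∃ α, α = -x / 2 - t * y / 2 := ⟨_, rfl⟩
  obtain ⟨w, hw⟩ : ∃ w, w = t / 2 * x - y / 2 := ⟨_, rfl⟩
  have hgh : g ^ 2 + h ^ 2 = 1 := by
    rw [hg, hh]; linear_combination (1 / 4 * (x ^ 2 + y ^ 2)) * ht + hxy
  have hy' : y' = -h := by
    have hre : x' * g - y' * h = 1 := by
      have := congrArg Complex.re hEE
      simp [-Complex.ofReal_cos, -Complex.ofReal_sin] at this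
      rw [hg, hh]; linear_combination this
    have him : x' * h + y' * g = 0 := by
      have := congrArg Complex.im hEE
      simp [-Complex.ofReal_cos, -Complex.ofReal_sin] at this
      rw [hg, hh]; linear_combination this
    linear_combination (-h) * hre + g * him - y' * hgh
  have b0 : ((P.len 0 : ℝ) : ℂ) = ⟨P.len 0, 0⟩ := rfl
  have b4 : -((P.len 4 : ℝ) : ℂ) = ⟨-P.len 4, 0⟩ := by apply Complex.ext <;> simp
  have b1 : (r : ℂ) * (-I * (((1 / 2 : ℝ) + (t / 2 : ℝ) * I) -
      ((1 / 2 : ℝ) + (t / 2 : ℝ) * I) * (x + y * I))) = ⟨r * (t / 2 - h), r * (g - 1 / 2)⟩ := by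
    rw [hg, hh]
    apply Complex.ext <;> simp <;> ring
  have bW : (((1 / 2 : ℝ) + (t / 2 : ℝ) * I) ^ 2 * (x + y * I) : ℂ) = ⟨α, w⟩ := by
    rw [hα, hw]
    apply Complex.ext
    · simp [pow_two]; linear_combination (-x / 4) * ht
    · simp [pow_two]; linear_combination (-y / 4) * ht
  have b2 : (P.len 2 : ℂ) * (((1 / 2 : ℝ) + (t / 2 : ℝ) * I) ^ 2 * (x + y * I)) =
      ⟨P.len 2 * α, P.len 2 * w⟩ := by
    rw [bW]
    apply Complex.ext <;> simp
  have b3 : (r : ℂ) * (-I * (-(x + y * I : ℂ) - ((1 / 2 : ℝ) + (t / 2 : ℝ) * I) ^ 2)) =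
      ⟨r * (-y - t / 2), r * (x - 1 / 2)⟩ := by
    apply Complex.ext
    · simp [pow_two]; ring
    · simp [pow_two]; linear_combination (-r / 4) * ht
  have b5 : (r : ℂ) * (I * (((1 / 2 : ℝ) + (t / 2 : ℝ) * I) -
      ((1 / 2 : ℝ) + (t / 2 : ℝ) * I) * (x + y * I))) = ⟨-(r * (t / 2 - h)), -(r * (g - 1 / 2))⟩ := by
    rw [hg, hh]
    apply Complex.ext <;> simp <;> ring
  have b6 : -((P.len 6 : ℂ) * (((1 / 2 : ℝ) + (t / 2 : ℝ) * I) ^ 2 * (x + y * I))) =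
      ⟨-(P.len 6 * α), -(P.len 6 * w)⟩ := by
    rw [bW]
    apply Complex.ext <;> simp
  have b7 : (r : ℂ) * (I * (-(x + y * I : ℂ) - ((1 / 2 : ℝ) + (t / 2 : ℝ) * I) ^ 2)) =
      ⟨-(r * (-y - t / 2)), -(r * (x - 1 / 2))⟩ := by
    apply Complex.ext
    · simp [pow_two]; ring
    · simp [pow_two]; linear_combination (r / 4) * ht
  rw [b0] at a0
  rw [b1] at a1
  rw [b2] at a2
  rw [b3] at a3
  rw [b4] at a4
  rw [b5] at a5
  rw [b6] at a6
  rw [b7] at a7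
  have step : ∀ {v v' : ℂ} {a b c e : ℝ}, v = P.vertex 0 + P.dir 0 * ⟨a, b⟩ →
      v' - v = P.dir 0 * ⟨c, e⟩ → v' = P.vertex 0 + P.dir 0 * ⟨a + c, b + e⟩ := by
    intro v v' a b c e h1 h2
    have : (⟨a + c, b + e⟩ : ℂ) = ⟨a, b⟩ + ⟨c, e⟩ := rfl
    rw [this]; linear_combination h1 + h2
  have z0 : P.vertex 0 = P.vertex 0 + P.dir 0 * ⟨0, 0⟩ := by
    have : (⟨0, 0⟩ : ℂ) = 0 := rfl
    rw [this]; ring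
  have q1 := step z0 a0
  have q2 := step q1 a1
  have q3 := step q2 a2
  have q4 := step q3 a3
  have q5 := step q4 a4
  have q6 := step q5 a5
  have q7 := step q6 a6
  have q8 := step q7 a7
  have hne : P.dir 0 ≠ 0 := by
    intro h0; have := P.norm_dir 0; rw [h0] at this; simp at this
  -- The edge vectors add up to zero. The concave edges cancel in pairs, so this only relates the
  -- lengths of opposite flat edges.
  have hclose := mul_left_cancel₀ hne (add_left_cancel (z0.symm.trans q8))
  have hcre : P.len 0 - P.len 4 + (P.len 2 - P.len 6) * α = 0 := by
    have := congrArg Complex.re hclose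
    simp only at this
    linear_combination -this
  have hcim : (P.len 2 - P.len 6) * w = 0 := by
    have := congrArg Complex.im hclose
    simp only at this
    linear_combination -this
  have hαw : α ^ 2 + w ^ 2 = 1 := by
    rw [hα, hw]; linear_combination (1 / 4 * (x ^ 2 + y ^ 2)) * ht + hxy
  have f1 : (1 : Fin 8) + 1 = 2 := rfl
  have f2 : (2 : Fin 8) + 1 = 3 := rfl
  have f3 : (3 : Fin 8) + 1 = 4 := rfl
  have f4 : (4 : Fin 8) + 1 = 5 := rfl
  have f5 : (5 : Fin 8) + 1 = 6 := rfl
  have f6 : (6 : Fin 8) + 1 = 7 := rfl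
  have f7 : (7 : Fin 8) + 1 = 0 := rfl
  rw [zero_add, f1, f2, f3, f4, f5, f6, f7] at hvol
  have hn := P.norm_dir 0
  have key : ∀ {v v' : ℂ} {a b c e : ℝ}, v = P.vertex 0 + P.dir 0 * ⟨a, b⟩ →
      v' = P.vertex 0 + P.dir 0 * ⟨c, e⟩ → ((starRingEnd ℂ) v * v').im =
      ((starRingEnd ℂ) (P.vertex 0) * v').im - ((starRingEnd ℂ) (P.vertex 0) * v).im +
        (a * e - b * c) := by
    intro v v' a b c e h1 h2
    rw [h1, h2, sum_cross_translate hn]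
    simp only [mul_add, Complex.add_im, Complex.mul_im, Complex.conj_re, Complex.conj_im]
    ring
  rw [key z0 q1, key q1 q2, key q2 q3, key q3 q4, key q4 q5, key q5 q6, key q6 q7, key q7 z0] at hvol
  clear key step q1 q2 q3 q4 q5 q6 q7 q8 a0 a1 a2 a3 a4 a5 a6 a7 b0 b1 b2 b3 b4 b5 b6 b7 z0
  rw [← hw]
  have hyy : y + y' = -w := by rw [hy', hh, hw]; ring
  -- `w` is the sine of the angle between the two flat directions. If they were parallel, the
  -- shoelace formula would give a negative area; otherwise opposite flat edges have equal lengths.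
  by_cases hw0 : w = 0
  · exfalso
    have e1 : y = t * x := by rw [hw] at hw0; linarith
    have e2 : x = -α / 2 := by
      rw [hα, e1]; linear_combination (-x / 4) * ht
    have e3 : g = α / 2 := by
      rw [hg, e1, e2]; linear_combination (α / 4) * ht
    have e4 : h = -t * α / 2 := by rw [hh, e1, e2]; ring
    have l0 := P.len_pos 0
    have l2 := P.len_pos 2
    have l4 := P.len_pos 4
    have l6 := P.len_pos 6
    have e5 : P.len 4 = P.len 0 + (P.len 2 - P.len 6) * α := by linarith
    have hneg : 2 * volume.real R = -r * (P.len 0 + P.len 2 + P.len 4 + P.len 6)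
        - 2 * r ^ 2 * (t + θ₁ + θ₃) := by
      rw [hvol, hw0, e5, e3, e4]
      have ha : (α - 1) * (α + 1) = 0 := by rw [hw0] at hαw; linear_combination hαw
      rw [hw0] at hyy
      rcases mul_eq_zero.1 ha with ha | ha
      · obtain rfl : α = 1 := by linarith
        rw [e2] at e1 ⊢
        linear_combination (-2 * r ^ 2) * hyy
      · obtain rfl : α = -1 := by linarith
        rw [e2] at e1 ⊢
        linear_combination (-2 * r ^ 2) * hyy - 2 * r ^ 2 * e1
    have : 0 < r * (P.len 0 + P.len 2 + P.len 4 + P.len 6) := by positivity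
    have : 0 < r ^ 2 * (t + θ₁ + θ₃) := mul_pos (by positivity) (by linarith)
    linarith
  · have hL2 : P.len 6 = P.len 2 := by
      rcases mul_eq_zero.1 hcim with h0 | h0
      · linarith
      · exact absurd h0 hw0
    have hL0 : P.len 4 = P.len 0 := by rw [hL2] at hcre; linarith
    refine ⟨hL0, hL2, ?_⟩
    rw [hL0, hL2] at hvol
    have c1 : g - 1 / 2 + (x - 1 / 2) = t * w - 1 := by
      rw [hg, hw]; linear_combination (-x / 2) * ht
    have c2 : (t / 2 - h) * w - (g - 1 / 2) * α = g - 1 / 2 := by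
      rw [hg, hh, hw, hα]
      linear_combination (x / 4 - (x ^ 2 + y ^ 2) / 4) * ht - (1 / 2) * hxy
    have c3 : α * (x - 1 / 2) - w * (-y - t / 2) = x - 1 / 2 := by
      rw [hw, hα]; linear_combination (x / 4) * ht - (1 / 2) * hxy
    have c4 : (t / 2 - h) * (x - 1 / 2) - (g - 1 / 2) * (-y - t / 2) = 2 * w - t := by
      rw [hg, hh, hw]; linear_combination (-t / 2) * hxy - (y / 4) * ht
    have hfin : 2 * volume.real R = 2 * (P.len 0 * P.len 2 * w +
        r * P.len 0 * (g - 1 / 2 + (x - 1 / 2)) +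
        r * P.len 2 * (((t / 2 - h) * w - (g - 1 / 2) * α) + (α * (x - 1 / 2) - w * (-y - t / 2))) +
        r ^ 2 * ((t / 2 - h) * (x - 1 / 2) - (g - 1 / 2) * (-y - t / 2)) -
        r ^ 2 * (y + y' + θ₁ + θ₃)) := by
      rw [hvol]; ring
    rw [c2, c3, c4, hyy, c1] at hfin
    linear_combination hfin / 2

/-! ### The isoperimetric inequality for rectangle and octagon -/

theorem sqrt_three_bounds : (1.73205 : ℝ) < √3 ∧ √3 < 1.732051 := by
  constructor
  · exact Real.lt_sqrt_of_sq_lt (by norm_num)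
  · rw [Real.sqrt_lt' (by norm_num)]; norm_num

theorem squareConst_bounds : (0.315 : ℝ) < squareConst ∧ squareConst < 0.31515 := by
  have h1 := Real.pi_gt_d6
  have h2 := Real.pi_lt_d6
  obtain ⟨h3, h4⟩ := sqrt_three_bounds
  unfold squareConst
  constructor <;> linarith

theorem squareConst_pos : 0 < squareConst := by linarith [squareConst_bounds.1]

/-- Among the octagons of given area, half the length is least for the square ones. -/
theorem chipped_half_length {r ℓ₁ ℓ₂ w σ A : ℝ} (hr : 0 < r) (h₁ : 0 < ℓ₁) (h₂ : 0 < ℓ₂) (hw : w ≤ 1)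
    (hσ : σ = Real.pi / 3 ∨ σ = 7 * Real.pi / 3)
    (hA : A = w * (ℓ₁ * ℓ₂) + r * (ℓ₁ + ℓ₂) * (√3 * w - 1) + r ^ 2 * (3 * w - √3 - σ)) :
    2 * √(A + squareConst * r ^ 2) + 2 * squareConst * r - Real.pi * r / 3 ≤ ℓ₁ + ℓ₂ + σ * r ∧
    (2 * √(A + squareConst * r ^ 2) + 2 * squareConst * r - Real.pi * r / 3 = ℓ₁ + ℓ₂ + σ * r →
      w = 1 ∧ ℓ₁ = ℓ₂ ∧ σ = Real.pi / 3) := by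
  have h3 : √3 ^ 2 = 3 := Real.sq_sqrt (by norm_num)
  obtain ⟨h4, h5⟩ := sqrt_three_bounds
  have hpi := Real.pi_pos
  -- The mean side of the parallelogram obtained by restoring the corners, in the case of right
  -- angles. When the shape is a square, `Y²` is the full area `A + c r²`.
  set Y := (ℓ₁ + ℓ₂) / 2 + r * (√3 - 1) with hY
  have hY0 : 0 < Y := by
    have : 0 < r * (√3 - 1) := mul_pos hr (by linarith)
    linarith
  have hD : 0 < ℓ₁ * ℓ₂ + √3 * r * (ℓ₁ + ℓ₂) + 3 * r ^ 2 := by positivity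
  -- The excess is a sum of three nonnegative defects: unequal sides, angles that are not right, and
  -- the spurious angle sum. Equality kills each of them.
  have key : Y ^ 2 - (A + squareConst * r ^ 2) = (ℓ₁ - ℓ₂) ^ 2 / 4 +
      (1 - w) * (ℓ₁ * ℓ₂ + √3 * r * (ℓ₁ + ℓ₂) + 3 * r ^ 2) + r ^ 2 * (σ - Real.pi / 3) := by
    rw [hY, hA, squareConst]; linear_combination r ^ 2 * h3
  have hs0 : 0 ≤ r ^ 2 * (σ - Real.pi / 3) := by
    refine mul_nonneg (by positivity) ?_
    rcases hσ with rfl | rfl <;> linarith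
  have hw0 : 0 ≤ (1 - w) * (ℓ₁ * ℓ₂ + √3 * r * (ℓ₁ + ℓ₂) + 3 * r ^ 2) :=
    mul_nonneg (by linarith) hD.le
  have hle : √(A + squareConst * r ^ 2) ≤ Y := by
    refine Real.sqrt_le_iff.2 ⟨hY0.le, ?_⟩
    linarith [sq_nonneg (ℓ₁ - ℓ₂)]
  have hσr : Real.pi / 3 * r ≤ σ * r := by
    rcases hσ with rfl | rfl <;> nlinarith
  have e : 2 * Y + 2 * squareConst * r - Real.pi * r / 3 = ℓ₁ + ℓ₂ + Real.pi / 3 * r := by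
    rw [hY, squareConst]; ring
  refine ⟨by linarith, fun heq => ?_⟩
  have hYe : √(A + squareConst * r ^ 2) = Y := by linarith
  have hpos : 0 ≤ A + squareConst * r ^ 2 := by
    by_contra hcon
    rw [Real.sqrt_eq_zero_of_nonpos (by linarith)] at hYe
    linarith
  have h6 := Real.sq_sqrt hpos
  rw [hYe] at h6
  have z1 : (1 - w) * (ℓ₁ * ℓ₂ + √3 * r * (ℓ₁ + ℓ₂) + 3 * r ^ 2) = 0 := by
    linarith [sq_nonneg (ℓ₁ - ℓ₂)]
  have z2 : (ℓ₁ - ℓ₂) ^ 2 = 0 := by linarith [sq_nonneg (ℓ₁ - ℓ₂)]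
  have z3 : (σ - Real.pi / 3) * r = 0 := by linarith
  refine ⟨?_, ?_, ?_⟩
  · rcases mul_eq_zero.1 z1 with h | h <;> linarith
  · have := pow_eq_zero_iff (two_ne_zero) |>.1 z2; linarith
  · rcases mul_eq_zero.1 z3 with h | h <;> linarith

/-- This rules out the rectangle with angle sum `7π / 3`. Its area may be larger, up to `k r²`, but
its half length `7π r / 3` outweighs this. With `a = √c` and `b = √k`, the square roots on the left
grow by at most `(b - a) r` and `a b r`, so it suffices that `b - a + a b < π + c`. -/
theorem exotic_rectangle_bound {r A₁ A₂ : ℝ} (hr : 0 < r) (h₂ : 0 ≤ A₂)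
    (hA : A₁ ≤ (7 * Real.pi / 3 - √3 + 1) * r ^ 2) :
    2 * √(A₁ + A₂) + 2 * √(squareConst * A₁) <
      2 * √(A₂ + squareConst * r ^ 2) + 2 * (Real.pi + squareConst) * r := by
  obtain ⟨h4, h5⟩ := sqrt_three_bounds
  have hp1 := Real.pi_gt_d6
  have hp2 := Real.pi_lt_d6
  have hc := squareConst_pos
  set k := 7 * Real.pi / 3 - √3 + 1 with hk
  have hk0 : 0 < k := by linarith
  set a := √squareConst with ha
  set b := √k with hb
  have ha2 : a ^ 2 = squareConst := Real.sq_sqrt hc.le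
  have hb2 : b ^ 2 = k := Real.sq_sqrt hk0.le
  have ha0 : 0 < a := Real.sqrt_pos.2 hc
  have hb0 : 0 < b := Real.sqrt_pos.2 hk0
  have ha1 : a < 0.5614 := by
    rw [ha, Real.sqrt_lt' (by norm_num), squareConst]; norm_num; linarith
  have hb1 : b < 2.569 := by
    rw [hb, Real.sqrt_lt' (by norm_num), hk]; norm_num; linarith
  have hab : a < b := Real.sqrt_lt_sqrt hc.le (by rw [squareConst, hk]; linarith)
  -- The margin is less than `0.01`, which dictates the precision of the bounds on `a` and `b`.
  have hnum : b - a + a * b < Real.pi + squareConst := by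
    have hcb : (3.456738 : ℝ) < Real.pi + squareConst := by rw [squareConst]; linarith
    nlinarith
  set X := √(A₂ + squareConst * r ^ 2) with hX
  have hX2 : X ^ 2 = A₂ + squareConst * r ^ 2 := Real.sq_sqrt (by positivity)
  have hXr : a * r ≤ X := by
    refine Real.le_sqrt_of_sq_le ?_
    rw [mul_pow, ha2]; linarith
  have b1 : √(A₁ + A₂) ≤ X + (b - a) * r := by
    have h0 : 0 ≤ (b - a) * r := mul_nonneg (by linarith) hr.le
    refine Real.sqrt_le_iff.2 ⟨by positivity, ?_⟩
    have := mul_le_mul_of_nonneg_right hXr h0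
    have h1 : b ^ 2 * r ^ 2 = k * r ^ 2 := by rw [hb2]
    have h2 : a ^ 2 * r ^ 2 = squareConst * r ^ 2 := by rw [ha2]
    nlinarith
  have b2 : √(squareConst * A₁) ≤ a * b * r := by
    refine Real.sqrt_le_iff.2 ⟨by positivity, ?_⟩
    rw [mul_pow, mul_pow, ha2, hb2, mul_assoc]
    exact mul_le_mul_of_nonneg_left hA hc.le
  have := mul_lt_mul_of_pos_right hnum hr
  nlinarith

/-- The isoperimetric inequality for `(4;8)` configurations. -/
theorem rectangle_chipped_length {p : ℝ} (hp : 0 < p) (P : CurvedPolygon 4) (hκ : ∀ i, P.curv i = p)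
    (hin : ∀ i, inner ℝ (P.vertex (i + 1) - P.vertex i) (P.vertex (i + 2) - P.vertex (i + 1)) = 0)
    {R : Set ℂ} (hR : P.Encloses R) (hv : 0 < volume.real R)
    (Q : CurvedPolygon 8) (hκ' : ∀ i : Fin 8, Q.curv i = if Even (i : ℕ) then 0 else -p)
    (hdir : ∀ i : Fin 8, Even (i : ℕ) → Q.dir (i + 4) = -Q.dir i)
    {R' : Set ℂ} (hR' : Q.Encloses R') (hv' : 0 < volume.real R') :
    2 * √(volume.real R + volume.real R') + 2 * √(squareConst * volume.real R) ≤
      (∑ i, P.len i + ∑ i, Q.len i) / 2 ∧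
    (2 * √(volume.real R + volume.real R') + 2 * √(squareConst * volume.real R) =
      (∑ i, P.len i + ∑ i, Q.len i) / 2 →
      (∀ i, p * P.len i = Real.pi / 6) ∧ (∀ i : Fin 8, ¬ Even (i : ℕ) → p * Q.len i = Real.pi / 6) ∧
      (∀ i : Fin 8, Even (i : ℕ) → Q.len i = Q.len 0) ∧
      volume.real R = squareConst * p⁻¹ ^ 2 ∧
      volume.real R + volume.real R' = (Q.len 0 + (√3 - 1) * p⁻¹) ^ 2) := by
  obtain ⟨h5, h7, hσ⟩ := chipped_angles hp Q hκ' hdir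
  obtain ⟨h4, h6, hvol⟩ := chipped_volume hp Q hκ' hdir hR' hv'
  set r := p⁻¹ with hr
  have hr0 : 0 < r := inv_pos.2 hp
  have hpr : p * r = 1 := mul_inv_cancel₀ hp.ne'
  have hpi := Real.pi_pos
  have hc := squareConst_pos
  obtain ⟨hI, hIeq⟩ := chipped_half_length hr0 (Q.len_pos 0) (Q.len_pos 2)
    (Real.sin_le_one (2 * Real.pi / 3 - p * Q.len 1)) hσ hvol
  have hsum : ∑ i, Q.len i =
      2 * (Q.len 0 + Q.len 2 + (p * Q.len 1 + p * Q.len 3) * r) := by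
    rw [Fin.sum_univ_eight, h4, h5, h6, h7]
    linear_combination (-2) * (Q.len 1 + Q.len 3) * hpr
  have hdiv : ∀ x : ℝ, x / p = x * r := fun x => by rw [hr, div_eq_mul_inv]
  have hm := Real.sqrt_nonneg (volume.real R' + squareConst * r ^ 2)
  rcases rectangle_area_bounds hp P hκ hR hin with ⟨hS, hA, hAeq⟩ | ⟨hS, hA⟩
  · rw [hdiv] at hS
    -- The half length `π r / 3` of the rectangle cancels the term `-π r / 3` in the bound for the
    -- octagon; what remains is monotone in `A₁ ≤ c r²`.
    have g1 : √(volume.real R + volume.real R') ≤ √(volume.real R' + squareConst * r ^ 2) :=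
      Real.sqrt_le_sqrt (by linarith)
    have g2 : √(squareConst * volume.real R) ≤ squareConst * r := by
      refine Real.sqrt_le_iff.2 ⟨by positivity, ?_⟩
      have := mul_le_mul_of_nonneg_left hA hc.le
      linarith
    refine ⟨by rw [hS, hsum]; linarith, fun heq => ?_⟩
    rw [hS, hsum] at heq
    have e1 : √(squareConst * volume.real R) = squareConst * r := by linarith
    have e2 : volume.real R = squareConst * r ^ 2 := by
      have h := Real.sq_sqrt (mul_nonneg hc.le hv.le)
      rw [e1] at h
      have : squareConst * (volume.real R - squareConst * r ^ 2) = 0 := by linarith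
      rcases mul_eq_zero.1 this with h | h <;> linarith
    have e3 : 2 * √(volume.real R' + squareConst * r ^ 2) + 2 * squareConst * r - Real.pi * r / 3 =
        Q.len 0 + Q.len 2 + (p * Q.len 1 + p * Q.len 3) * r := by linarith
    obtain ⟨hw, hl, hσ'⟩ := hIeq e3
    have t1 : 0 < p * Q.len 1 := mul_pos hp (Q.len_pos 1)
    have t3 : 0 < p * Q.len 3 := mul_pos hp (Q.len_pos 3)
    have hθ1 : p * Q.len 1 = Real.pi / 6 := by
      have : 2 * Real.pi / 3 - p * Q.len 1 = Real.pi / 2 := by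
        have h := (Real.cos_eq_one_iff_of_lt_of_lt (x := 2 * Real.pi / 3 - p * Q.len 1 - Real.pi / 2)
          (by linarith) (by linarith)).1 (by rw [Real.cos_sub_pi_div_two, hw])
        linarith
      linarith
    have hθ3 : p * Q.len 3 = Real.pi / 6 := by linarith
    refine ⟨hAeq e2, ?_, ?_, e2, ?_⟩
    · intro i hi
      fin_cases i <;> first | exact hθ1 | exact hθ3 | exact (h5 ▸ hθ1) | exact (h7 ▸ hθ3) | exact absurd (by decide) hi
    · intro i hi
      fin_cases i <;> first | rfl | exact h4 | exact hl.symm | exact h6.trans hl.symm | exact absurd hi (by decide)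
    · rw [e2, hvol, hw, ← hl, hσ', squareConst]
      have h3 : √3 ^ 2 = 3 := Real.sq_sqrt (by norm_num)
      linear_combination (-r ^ 2) * h3
  · rw [hdiv] at hS
    have hex := exotic_rectangle_bound hr0 hv'.le hA
    have hlt : 2 * √(volume.real R + volume.real R') + 2 * √(squareConst * volume.real R) <
      (∑ i, P.len i + ∑ i, Q.len i) / 2 := by rw [hS, hsum]; linarith
    exact ⟨hlt.le, fun h => absurd h hlt.ne⟩

/-! ### Divergence on the corner pieces and the curvilinear square -/

theorem setIntegral_under_graph {f : ℝ → ℝ} (hf : Continuous f) {d : ℝ} (hd : 0 ≤ d)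
    (h0 : ∀ x ∈ Icc 0 d, 0 ≤ f x) {F : ℂ → ℝ} (hF : Continuous F) :
    ∫ z in {z : ℂ | z.re ∈ Ioc 0 d ∧ z.im ∈ Icc 0 (f z.re)}, F z =
      ∫ x in (0 : ℝ)..d, ∫ y in (0 : ℝ)..f x, F (x + y * I) := by
  have hset : {p : ℝ × ℝ | (p.1 + p.2 * I : ℂ) ∈ {z : ℂ | z.re ∈ Ioc 0 d ∧ z.im ∈ Icc 0 (f z.re)}} =
      {p : ℝ × ℝ | p.1 ∈ Ioc 0 d ∧ p.2 ∈ Icc 0 (f p.1)} := by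
    ext p; simp
  set S : Set (ℝ × ℝ) := {p : ℝ × ℝ | p.1 ∈ Ioc 0 d ∧ p.2 ∈ Icc 0 (f p.1)} with hS
  have hSm : MeasurableSet S := by
    have h1 : MeasurableSet {p : ℝ × ℝ | p.1 ∈ Ioc 0 d} := measurable_fst measurableSet_Ioc
    have h2 : MeasurableSet {p : ℝ × ℝ | p.2 ∈ Icc 0 (f p.1)} :=
      ((isClosed_le continuous_const continuous_snd).inter
        (isClosed_le continuous_snd (hf.comp continuous_fst))).measurableSet
    exact h1.inter h2
  have hc : Continuous fun p : ℝ × ℝ => F (p.1 + p.2 * I) := by fun_prop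
  obtain ⟨M, hM⟩ := (isCompact_Icc (a := (0 : ℝ)) (b := d)).bddAbove_image hf.continuousOn
  have hint : IntegrableOn (fun p : ℝ × ℝ => F (p.1 + p.2 * I)) S := by
    refine IntegrableOn.mono_set (t := Icc 0 d ×ˢ Icc 0 M)
      (hc.continuousOn.integrableOn_compact (isCompact_Icc.prod isCompact_Icc)) ?_
    rintro p ⟨h1, h2⟩
    exact ⟨Ioc_subset_Icc_self h1, h2.1, h2.2.trans (hM ⟨_, Ioc_subset_Icc_self h1, rfl⟩)⟩
  rw [setIntegral_complex_eq, hset, ← integral_indicator hSm, Measure.volume_eq_prod,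
    integral_prod _ (by rw [← Measure.volume_eq_prod]; exact hint.integrable_indicator hSm),
    intervalIntegral.integral_of_le hd, ← integral_indicator measurableSet_Ioc]
  refine integral_congr_ae (Eventually.of_forall fun x => ?_)
  by_cases hx : x ∈ Ioc 0 d
  · simp only [indicator_of_mem hx]
    rw [intervalIntegral.integral_of_le (h0 x (Ioc_subset_Icc_self hx)),
      ← integral_Icc_eq_integral_Ioc, ← integral_indicator measurableSet_Icc]
    refine integral_congr_ae (Eventually.of_forall fun y => ?_)
    by_cases hy : y ∈ Icc 0 (f x)
    · simp only [indicator_of_mem hy]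
      rw [indicator_of_mem (show (x, y) ∈ S from ⟨hx, hy⟩)]
    · simp only [indicator_of_notMem hy]
      rw [indicator_of_notMem fun h => hy h.2]
  · simp only [indicator_of_notMem hx]
    refine integral_eq_zero_of_ae (Eventually.of_forall fun y => ?_)
    exact indicator_of_notMem (fun h : (x, y) ∈ S => hx h.1) _

/-- A quarter of the curvilinear square with edges of radius `r`. -/
def squareQuarter (r : ℝ) : Set ℂ :=
  {w | 0 ≤ w.re ∧ 0 ≤ w.im ∧ (w.re + r / 2) ^ 2 + (w.im + r / 2) ^ 2 ≤ r ^ 2}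

/-- The position on the arc bounding `squareQuarter r`. -/
noncomputable def quarterArc (r θ : ℝ) : ℂ :=
  (r * Real.sin θ - r / 2 : ℝ) + (r * Real.cos θ - r / 2 : ℝ) * I

theorem quarterArc_re (r θ : ℝ) : (quarterArc r θ).re = r * Real.sin θ - r / 2 := by
  simp only [quarterArc, add_re, ofReal_re, re_ofReal_mul, I_re, mul_zero, add_zero]

theorem quarterArc_im (r θ : ℝ) : (quarterArc r θ).im = r * Real.cos θ - r / 2 := by
  simp only [quarterArc, add_im, ofReal_im, im_ofReal_mul, I_im, mul_one, zero_add]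

/-- Half the side of the square inscribed in the curvilinear square with edges of radius `r`. -/
noncomputable def halfSide (r : ℝ) : ℝ := (√3 - 1) * r / 2

theorem halfSide_pos {r : ℝ} (hr : 0 < r) : 0 < halfSide r := by
  have := sqrt_three_bounds.1
  exact div_pos (mul_pos (by linarith) hr) two_pos

theorem le_halfSide_of_sq_add_sq_le {r x y : ℝ} (hr : 0 < r) (hy : 0 ≤ y)
    (h : (x + r / 2) ^ 2 + (y + r / 2) ^ 2 ≤ r ^ 2) : x ≤ halfSide r := by
  have h3 : √3 ^ 2 = 3 := Real.sq_sqrt (by norm_num)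
  have h4 : (x + r / 2) ^ 2 ≤ (√3 / 2 * r) ^ 2 := by
    have : (√3 / 2 * r) ^ 2 = 3 / 4 * r ^ 2 := by rw [mul_pow, div_pow, h3]; ring
    rw [this]; nlinarith
  have := abs_le_of_sq_le_sq' h4 (by positivity)
  rw [halfSide]; linarith [this.2]

theorem isCompact_squareQuarter {r : ℝ} (hr : 0 < r) : IsCompact (squareQuarter r) := by
  have hcl : IsClosed (squareQuarter r) := by
    refine (isClosed_le continuous_const continuous_re).inter
      ((isClosed_le continuous_const continuous_im).inter ?_)
    exact isClosed_le (f := fun w : ℂ => (w.re + r / 2) ^ 2 + (w.im + r / 2) ^ 2) (by fun_prop)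
      continuous_const
  refine Metric.isCompact_of_isClosed_isBounded hcl
    ((Metric.isBounded_closedBall (x := (0 : ℂ)) (r := 2 * halfSide r)).subset ?_)
  rintro w ⟨h1, h2, h3⟩
  rw [mem_closedBall_zero_iff]
  have a1 := le_halfSide_of_sq_add_sq_le hr h2 h3
  have a2 := le_halfSide_of_sq_add_sq_le hr h1 (by linarith : (w.im + r / 2) ^ 2 + (w.re + r / 2) ^ 2 ≤ r ^ 2)
  refine (Complex.norm_le_abs_re_add_abs_im w).trans ?_
  rw [abs_of_nonneg h1, abs_of_nonneg h2]; linarith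

theorem volume_re_eq (a : ℝ) : volume {w : ℂ | w.re = a} = 0 := by
  have h := (volume_preserving_equiv_real_prod).measure_preimage_emb
    measurableEquivRealProd.measurableEmbedding ({a} ×ˢ univ)
  rw [Measure.volume_eq_prod, Measure.prod_prod, Real.volume_singleton, zero_mul] at h
  rw [← h]
  congr 1
  ext w; simp [measurableEquivRealProd]

/-- The fundamental theorem of calculus along vertical lines, followed by the substitution `x = r
sin θ - r / 2`: the arc meets the vertical axis at `θ = π / 6` and the horizontal one at `θ = π /
3`. -/
theorem integral_fderiv_I_squareQuarter {r : ℝ} (hr : 0 < r) {u : ℂ → ℝ} (hu : ContDiff ℝ 1 u) :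
    ∫ z in squareQuarter r, fderiv ℝ u z I =
      (∫ θ in (Real.pi / 6)..(Real.pi / 3), u (quarterArc r θ) * (r * Real.cos θ)) -
        ∫ x in (0 : ℝ)..halfSide r, u x := by
  set f : ℝ → ℝ := fun x => √(r ^ 2 - (x + r / 2) ^ 2) - r / 2 with hf
  have hfc : Continuous f := by rw [hf]; fun_prop
  have h3 : √3 ^ 2 = 3 := Real.sq_sqrt (by norm_num)
  have hd := halfSide_pos hr
  have hf0 : ∀ x ∈ Icc 0 (halfSide r), 0 ≤ f x := by
    rintro x ⟨hx0, hx1⟩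
    rw [hf]
    simp only [sub_nonneg]
    refine Real.le_sqrt_of_sq_le ?_
    have : (x + r / 2) ^ 2 ≤ (√3 / 2 * r) ^ 2 :=
      pow_le_pow_left₀ (by positivity) (by rw [halfSide] at hx1; linarith) 2
    rw [mul_pow, div_pow, h3] at this
    nlinarith
  -- Up to the null line `re = 0`, the quarter is the region under the graph of `f`.
  have hset : squareQuarter r =ᵐ[volume]
      {z : ℂ | z.re ∈ Ioc 0 (halfSide r) ∧ z.im ∈ Icc 0 (f z.re)} := by
    have hne : ∀ᵐ z : ℂ, z.re ≠ 0 := by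
      rw [ae_iff]; simpa using volume_re_eq 0
    filter_upwards [hne] with z hz
    refine propext ⟨?_, ?_⟩
    · rintro ⟨h1, h2, h4⟩
      refine ⟨⟨lt_of_le_of_ne h1 hz.symm, le_halfSide_of_sq_add_sq_le hr h2 h4⟩, h2, ?_⟩
      have := Real.le_sqrt_of_sq_le (x := z.im + r / 2) (y := r ^ 2 - (z.re + r / 2) ^ 2) (by linarith)
      rw [hf]; simp only; linarith
    · rintro ⟨⟨h1, h2⟩, h4, h5⟩
      refine ⟨h1.le, h4, ?_⟩
      have : z.im + r / 2 ≤ √(r ^ 2 - (z.re + r / 2) ^ 2) := by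
        rw [hf] at h5; simp only at h5; linarith
      rw [Real.le_sqrt' (by positivity)] at this
      linarith
  have hFc : Continuous fun z => fderiv ℝ u z I :=
    (hu.continuous_fderiv (by norm_num)).clm_apply continuous_const
  rw [setIntegral_congr_set hset, setIntegral_under_graph hfc hd.le hf0 hFc]
  have hin : ∀ x : ℝ, ∫ y in (0 : ℝ)..f x, fderiv ℝ u (x + y * I) I = u (x + f x * I) - u x := by
    intro x
    have hder : ∀ y : ℝ, HasDerivAt (fun y : ℝ => u (x + y * I)) (fderiv ℝ u (x + y * I) I) y := by
      intro y
      have h1 : HasDerivAt (fun y : ℝ => (x + y * I : ℂ)) I y := by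
        simpa using ((HasDerivAt.ofReal_comp (hasDerivAt_id y)).mul_const I).const_add (x : ℂ)
      exact ((hu.differentiable (by norm_num) _).hasFDerivAt).comp_hasDerivAt y h1
    rw [intervalIntegral.integral_eq_sub_of_hasDerivAt (fun y _ => hder y)
      (Continuous.intervalIntegrable (by fun_prop) _ _)]
    simp
  simp only [hin]
  have hg : Continuous fun x : ℝ => u (x + f x * I) := hu.continuous.comp (by fun_prop)
  have hg2 : Continuous fun x : ℝ => u x := hu.continuous.comp continuous_ofReal
  rw [intervalIntegral.integral_sub (hg.intervalIntegrable _ _) (hg2.intervalIntegrable _ _)]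
  congr 1
  have hsub := intervalIntegral.integral_comp_mul_deriv (a := Real.pi / 6) (b := Real.pi / 3)
    (f := fun θ => r * Real.sin θ - r / 2) (f' := fun θ => r * Real.cos θ)
    (g := fun x => u (x + f x * I))
    (fun θ _ => ((Real.hasDerivAt_sin θ).const_mul r).sub_const _) (by fun_prop) hg
  have e1 : r * Real.sin (Real.pi / 6) - r / 2 = 0 := by rw [Real.sin_pi_div_six]; ring
  have e2 : r * Real.sin (Real.pi / 3) - r / 2 = halfSide r := by
    rw [Real.sin_pi_div_three, halfSide]; ring
  rw [e1, e2] at hsub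
  rw [← hsub]
  refine intervalIntegral.integral_congr fun θ hθ => ?_
  have hpi := Real.pi_pos
  rw [uIcc_of_le (by linarith)] at hθ
  have hcos : 0 ≤ Real.cos θ := Real.cos_nonneg_of_mem_Icc ⟨by linarith [hθ.1], by linarith [hθ.2]⟩
  have e3 : f (r * Real.sin θ - r / 2) = r * Real.cos θ - r / 2 := by
    rw [hf]
    simp only [sub_add_cancel]
    rw [show r ^ 2 - (r * Real.sin θ) ^ 2 = (r * Real.cos θ) ^ 2 by
      linear_combination (-r ^ 2) * Real.sin_sq_add_cos_sq θ, Real.sqrt_sq (by positivity)]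
  simp only [Function.comp, e3, quarterArc]

/-- The reflection in the diagonal. -/
theorem integral_squareQuarter_swap (r : ℝ) (F : ℂ → ℝ) :
    ∫ z in squareQuarter r, F (I * (starRingEnd ℂ) z) = ∫ z in squareQuarter r, F z := by
  let e : ℂ ≃ₗᵢ[ℝ] ℂ := conjLIE.trans (rotation ⟨I, by simp [Submonoid.unitSphere]⟩)
  have he : ∀ z, e z = I * (starRingEnd ℂ) z := fun z => rfl
  have h := e.measurePreserving.setIntegral_preimage_emb
    e.toHomeomorph.measurableEmbedding F (squareQuarter r)
  have hpre : e ⁻¹' squareQuarter r = squareQuarter r := by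
    ext z
    simp only [mem_preimage, he, squareQuarter, mem_ofPred_eq]
    simp
    constructor <;> rintro ⟨h1, h2, h3⟩ <;> exact ⟨h2, h1, by linarith⟩
  rw [hpre] at h
  exact h

/-- The quarter is symmetric in the diagonal, so the horizontal derivative reduces to the vertical
one of the reflected component. -/
theorem integral_planeDiv_squareQuarter {r : ℝ} (hr : 0 < r) {φ : ℂ → ℂ} (hφ : ContDiff ℝ 1 φ) :
    ∫ z in squareQuarter r, planeDiv φ z =
      (∫ θ in (Real.pi / 6)..(Real.pi / 3), r * ((φ (quarterArc r θ)).re * Real.sin θ +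
        (φ (quarterArc r θ)).im * Real.cos θ)) -
      ((∫ x in (0 : ℝ)..halfSide r, (φ x).im) + ∫ x in (0 : ℝ)..halfSide r, (φ (x * I)).re) := by
  have hre : ContDiff ℝ 1 fun z => (φ z).re := reCLM.contDiff.comp hφ
  have him : ContDiff ℝ 1 fun z => (φ z).im := imCLM.contDiff.comp hφ
  have hsw : ContDiff ℝ 1 fun z : ℂ => I * (starRingEnd ℂ) z :=
    contDiff_const.mul conjCLE.contDiff
  have hre' : ContDiff ℝ 1 fun z => (φ (I * (starRingEnd ℂ) z)).re := hre.comp hsw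
  have d1 : ∀ z, fderiv ℝ (fun z => (φ z).im) z I = (fderiv ℝ φ z I).im := fun z => by
    have := (imCLM.hasFDerivAt (x := φ z)).comp z (hφ.differentiable (by norm_num) z).hasFDerivAt
    have h2 : fderiv ℝ (fun z => (φ z).im) z = imCLM.comp (fderiv ℝ φ z) := this.fderiv
    rw [h2]; rfl
  have d2 : ∀ z, fderiv ℝ (fun z => (φ (I * (starRingEnd ℂ) z)).re) z I =
      (fderiv ℝ φ (I * (starRingEnd ℂ) z) 1).re := fun z => by
    have h0 : HasFDerivAt (fun z : ℂ => I * (starRingEnd ℂ) z)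
        (I • (conjCLE : ℂ →L[ℝ] ℂ)) z :=
      (conjCLE.hasFDerivAt (x := z)).const_mul I
    have := (reCLM.hasFDerivAt (x := φ (I * (starRingEnd ℂ) z))).comp z
      (((hφ.differentiable (by norm_num) _).hasFDerivAt).comp z h0)
    have h2 : fderiv ℝ (fun z => (φ (I * (starRingEnd ℂ) z)).re) z = _ := this.fderiv
    rw [h2]; simp
  have hK := isCompact_squareQuarter hr
  have hcd := hφ.continuous_fderiv (by norm_num : (1 : WithTop ℕ∞) ≠ 0)
  have i1 : IntegrableOn (fun z => (fderiv ℝ φ z 1).re) (squareQuarter r) :=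
    (continuous_re.comp (hcd.clm_apply continuous_const)).continuousOn.integrableOn_compact hK
  have i2 : IntegrableOn (fun z => (fderiv ℝ φ z I).im) (squareQuarter r) :=
    (continuous_im.comp (hcd.clm_apply continuous_const)).continuousOn.integrableOn_compact hK
  unfold planeDiv
  rw [integral_add i1 i2, ← integral_squareQuarter_swap r fun z => (fderiv ℝ φ z 1).re]
  simp only [← d1, ← d2]
  rw [integral_fderiv_I_squareQuarter hr him, integral_fderiv_I_squareQuarter hr hre']
  have hq : Continuous (quarterArc r) := by unfold quarterArc; fun_prop
  have hs1 : ∫ θ in (Real.pi / 6)..(Real.pi / 3),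
      (φ (I * (starRingEnd ℂ) (quarterArc r θ))).re * (r * Real.cos θ) =
      ∫ θ in (Real.pi / 6)..(Real.pi / 3), (φ (quarterArc r θ)).re * (r * Real.sin θ) := by
    have h := intervalIntegral.integral_comp_sub_left (a := Real.pi / 6) (b := Real.pi / 3)
      (fun θ => (φ (quarterArc r θ)).re * (r * Real.sin θ)) (Real.pi / 2)
    rw [show Real.pi / 2 - Real.pi / 3 = Real.pi / 6 by ring,
      show Real.pi / 2 - Real.pi / 6 = Real.pi / 3 by ring] at h
    rw [← h]
    refine intervalIntegral.integral_congr fun θ _ => ?_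
    simp only [Real.sin_pi_div_two_sub]
    congr 3
    apply Complex.ext
    · simp [quarterArc_re, quarterArc_im, Real.sin_pi_div_two_sub]
    · simp [quarterArc_re, quarterArc_im, Real.cos_pi_div_two_sub]
  have hs2 : ∀ x : ℝ, I * (starRingEnd ℂ) (x : ℂ) = x * I := fun x => by
    rw [Complex.conj_ofReal, mul_comm]
  have j1 : Continuous fun θ => (φ (quarterArc r θ)).im * (r * Real.cos θ) :=
    (continuous_im.comp (hφ.continuous.comp hq)).mul (by fun_prop)
  have j2 : Continuous fun θ => (φ (quarterArc r θ)).re * (r * Real.sin θ) :=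
    (continuous_re.comp (hφ.continuous.comp hq)).mul (by fun_prop)
  have hs3 : ∫ θ in (Real.pi / 6)..(Real.pi / 3), r * ((φ (quarterArc r θ)).re * Real.sin θ +
        (φ (quarterArc r θ)).im * Real.cos θ) =
      (∫ θ in (Real.pi / 6)..(Real.pi / 3), (φ (quarterArc r θ)).re * (r * Real.sin θ)) +
        ∫ θ in (Real.pi / 6)..(Real.pi / 3), (φ (quarterArc r θ)).im * (r * Real.cos θ) := by
    rw [← intervalIntegral.integral_add (j2.intervalIntegrable _ _) (j1.intervalIntegrable _ _)]
    refine intervalIntegral.integral_congr fun θ _ => ?_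
    ring
  simp only [hs1, hs2, hs3]
  ring

theorem isometry_mul_sub {u : ℂ} (hu : ‖u‖ = 1) (z : ℂ) : Isometry fun w : ℂ => u * (w - z) :=
  Isometry.of_dist_eq fun a b => by
    rw [dist_eq_norm, ← mul_sub, norm_mul, hu, one_mul, sub_sub_sub_cancel_right, dist_eq_norm]

theorem measurePreserving_mul_sub {u : ℂ} (hu : ‖u‖ = 1) (z : ℂ) :
    MeasurePreserving fun w : ℂ => u * (w - z) :=
  (rotation ⟨u, by simp [Submonoid.unitSphere, hu]⟩).measurePreserving.comp
    (measurePreserving_sub_right volume z)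

theorem measurableEmbedding_mul_sub {u : ℂ} (hu : ‖u‖ = 1) (z : ℂ) :
    MeasurableEmbedding fun w : ℂ => u * (w - z) :=
  (isometry_mul_sub hu z).isClosedEmbedding.measurableEmbedding

/-- The quarter of a curvilinear square with center `z` and axes directed by `u` and `I * u`. -/
def cornerPiece (z u : ℂ) (r : ℝ) : Set ℂ :=
  (fun w => (starRingEnd ℂ) u * (w - z)) ⁻¹' squareQuarter r

/-- The flux through the right of the segment from `z + a u` to `z + b u`, up to sign. -/
noncomputable def sideFlux (φ : ℂ → ℂ) (z u : ℂ) (a b : ℝ) : ℝ :=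
  ∫ x in a..b, ((starRingEnd ℂ) u * φ (z + u * x)).im

/-- The flux through the arc bounding a corner piece. -/
noncomputable def cornerFlux (φ : ℂ → ℂ) (z u : ℂ) (r : ℝ) : ℝ :=
  ∫ θ in (Real.pi / 6)..(Real.pi / 3),
    r * (((starRingEnd ℂ) u * φ (z + u * quarterArc r θ)).re * Real.sin θ +
      ((starRingEnd ℂ) u * φ (z + u * quarterArc r θ)).im * Real.cos θ)

theorem conj_mul_self_of_norm {u : ℂ} (hu : ‖u‖ = 1) : (starRingEnd ℂ) u * u = 1 := by
  rw [mul_comm, Complex.mul_conj, Complex.normSq_eq_norm_sq, hu]; simp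

theorem planeDiv_rotate {φ : ℂ → ℂ} (hφ : ContDiff ℝ 1 φ) {u : ℂ} (hu : ‖u‖ = 1) (z w : ℂ) :
    planeDiv (fun w => (starRingEnd ℂ) u * φ (z + u * w)) w = planeDiv φ (z + u * w) := by
  have h0 : HasFDerivAt (fun w : ℂ => z + u * w) (u • ContinuousLinearMap.id ℝ ℂ) w :=
    ((hasFDerivAt_id w).const_mul u).const_add z
  have h1 := (((hφ.differentiable (by norm_num) (z + u * w)).hasFDerivAt).comp w h0).const_mul
    ((starRingEnd ℂ) u)
  have h2 : fderiv ℝ (fun w => (starRingEnd ℂ) u * φ (z + u * w)) w = _ := h1.fderiv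
  rw [planeDiv_eq_inner φ _ hu, planeDiv, h2]
  simp [Complex.inner]
  rw [mul_comm I u]
  ring

theorem integral_planeDiv_cornerPiece {r : ℝ} (hr : 0 < r) {φ : ℂ → ℂ} (hφ : ContDiff ℝ 1 φ) (z : ℂ)
    {u : ℂ} (hu : ‖u‖ = 1) :
    ∫ w in cornerPiece z u r, planeDiv φ w = cornerFlux φ z u r -
      sideFlux φ z u 0 (halfSide r) + sideFlux φ z (I * u) 0 (halfSide r) := by
  have hcu : ‖(starRingEnd ℂ) u‖ = 1 := by rw [RCLike.norm_conj, hu]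
  have hψ : ContDiff ℝ 1 fun w => (starRingEnd ℂ) u * φ (z + u * w) :=
    contDiff_const.mul (hφ.comp (contDiff_const.add (contDiff_const.mul contDiff_id)))
  have h := (measurePreserving_mul_sub hcu z).setIntegral_preimage_emb
    (measurableEmbedding_mul_sub hcu z) (planeDiv fun w => (starRingEnd ℂ) u * φ (z + u * w))
    (squareQuarter r)
  have e1 : ∀ w, planeDiv (fun w => (starRingEnd ℂ) u * φ (z + u * w))
      ((starRingEnd ℂ) u * (w - z)) = planeDiv φ w := fun w => by
    rw [planeDiv_rotate hφ hu]
    congr 1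
    linear_combination (w - z) * conj_mul_self_of_norm hu
  simp only [e1] at h
  rw [cornerPiece, h, integral_planeDiv_squareQuarter hr hψ]
  have e2 : ∫ x in (0 : ℝ)..halfSide r, ((starRingEnd ℂ) u * φ (z + u * (x * I))).re =
      - sideFlux φ z (I * u) 0 (halfSide r) := by
    rw [sideFlux, ← intervalIntegral.integral_neg]
    refine intervalIntegral.integral_congr fun x _ => ?_
    simp only [map_mul, conj_I]
    rw [show I * u * (x : ℂ) = u * (x * I) by ring, mul_assoc, neg_mul, Complex.neg_im, Complex.I_mul_im, neg_neg]
  rw [e2]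
  change cornerFlux φ z u r -
    (sideFlux φ z u 0 (halfSide r) + -sideFlux φ z (I * u) 0 (halfSide r)) = _
  ring

theorem abs_cornerFlux_le {r : ℝ} (hr : 0 < r) {φ : ℂ → ℂ} (h1 : ∀ z, ‖φ z‖ ≤ 1) (z : ℂ) {u : ℂ}
    (hu : ‖u‖ = 1) : |cornerFlux φ z u r| ≤ r * (Real.pi / 6) := by
  have hpi := Real.pi_pos
  have h := intervalIntegral.norm_integral_le_of_norm_le_const (a := Real.pi / 6) (b := Real.pi / 3)
    (C := r) (f := fun θ => r * (((starRingEnd ℂ) u * φ (z + u * quarterArc r θ)).re * Real.sin θ +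
      ((starRingEnd ℂ) u * φ (z + u * quarterArc r θ)).im * Real.cos θ)) fun θ _ => by
    set a := (starRingEnd ℂ) u * φ (z + u * quarterArc r θ) with ha
    have hn : ‖a‖ ≤ 1 := by rw [ha, norm_mul, RCLike.norm_conj, hu, one_mul]; exact h1 _
    have h2 : a.re ^ 2 + a.im ^ 2 ≤ 1 := by
      have := Complex.sq_norm a
      rw [normSq_apply] at this
      nlinarith [norm_nonneg a]
    rw [norm_mul, Real.norm_of_nonneg hr.le]
    refine mul_le_of_le_one_right hr.le ?_
    rw [Real.norm_eq_abs]
    have h3 : (a.re * Real.sin θ + a.im * Real.cos θ) ^ 2 ≤ 1 ^ 2 := by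
      nlinarith [Real.sin_sq_add_cos_sq θ, sq_nonneg (a.re * Real.cos θ - a.im * Real.sin θ)]
    exact abs_le_of_sq_le_sq h3 zero_le_one
  rw [Real.norm_eq_abs] at h
  refine h.trans_eq ?_
  rw [show Real.pi / 3 - Real.pi / 6 = Real.pi / 6 by ring, abs_of_pos (by positivity)]

theorem abs_sideFlux_le {φ : ℂ → ℂ} (h1 : ∀ z, ‖φ z‖ ≤ 1) (z : ℂ) {u : ℂ} (hu : ‖u‖ = 1) {a b : ℝ}
    (hab : a ≤ b) : |sideFlux φ z u a b| ≤ b - a := by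
  have h := intervalIntegral.norm_integral_le_of_norm_le_const (a := a) (b := b)
    (C := 1) (f := fun x : ℝ => ((starRingEnd ℂ) u * φ (z + u * x)).im) fun x _ => by
    rw [Real.norm_eq_abs]
    refine (Complex.abs_im_le_norm _).trans ?_
    rw [norm_mul, RCLike.norm_conj, hu, one_mul]; exact h1 _
  rw [Real.norm_eq_abs] at h
  refine h.trans_eq ?_
  rw [one_mul, abs_of_nonneg (by linarith)]

theorem sideFlux_add {φ : ℂ → ℂ} (hφ : Continuous φ) (z u : ℂ) (a b c : ℝ) :
    sideFlux φ z u a b + sideFlux φ z u b c = sideFlux φ z u a c := by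
  have : Continuous fun x : ℝ => ((starRingEnd ℂ) u * φ (z + u * x)).im := by fun_prop
  exact intervalIntegral.integral_add_adjacent_intervals (this.intervalIntegrable _ _)
    (this.intervalIntegrable _ _)

/-- Running through a side backwards. -/
theorem sideFlux_reverse (φ : ℂ → ℂ) (z u : ℂ) (L d : ℝ) :
    sideFlux φ (z + u * L) (-u) 0 d = - sideFlux φ z u (L - d) L := by
  rw [sideFlux, sideFlux, ← intervalIntegral.integral_neg]
  have h := intervalIntegral.integral_comp_sub_left (a := 0) (b := d)
    (fun x : ℝ => -((starRingEnd ℂ) u * φ (z + u * x)).im) L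
  rw [sub_zero] at h
  rw [← h]
  refine intervalIntegral.integral_congr fun x _ => ?_
  simp only [map_neg]
  rw [show z + u * (L : ℂ) + -u * (x : ℂ) = z + u * ((L - x : ℝ) : ℂ) by push_cast; ring, neg_mul,
    Complex.neg_im]

/-- The directions `1, I, -1, -I`. -/
noncomputable def quarterTurn : Fin 4 → ℂ := ![1, I, -1, -I]

theorem norm_quarterTurn (j : Fin 4) : ‖quarterTurn j‖ = 1 := by
  fin_cases j <;> simp [quarterTurn]

theorem I_mul_quarterTurn (j : Fin 4) : I * quarterTurn j = quarterTurn (j + 1) := by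
  fin_cases j <;> simp [quarterTurn]

theorem isCompact_cornerPiece {r : ℝ} (hr : 0 < r) (z : ℂ) {u : ℂ} (hu : ‖u‖ = 1) :
    IsCompact (cornerPiece z u r) :=
  (isometry_mul_sub (by rw [RCLike.norm_conj, hu]) z).isClosedEmbedding.isCompact_preimage
    (isCompact_squareQuarter hr)

theorem setIntegral_iUnion_cornerPiece {r : ℝ} (hr : 0 < r) {z : Fin 4 → ℂ}
    (hd : Pairwise (Function.onFun (AEDisjoint volume) fun j => cornerPiece (z j) (quarterTurn j) r)) {F : ℂ → ℝ}
    (hF : Continuous F) :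
    ∫ w in ⋃ j, cornerPiece (z j) (quarterTurn j) r, F w =
      ∑ j, ∫ w in cornerPiece (z j) (quarterTurn j) r, F w := by
  have hK := fun j => isCompact_cornerPiece hr (z j) (norm_quarterTurn j)
  rw [integral_iUnion_ae (fun j => (hK j).isClosed.measurableSet.nullMeasurableSet) hd
    (hF.continuousOn.integrableOn_compact (isCompact_iUnion hK)), tsum_fintype]

/-- The curvilinear square with center `0`, axes parallel to the coordinate axes and edges of radius
`r`. -/
def curvedSquare (r : ℝ) : Set ℂ := {w | (|w.re| + r / 2) ^ 2 + (|w.im| + r / 2) ^ 2 ≤ r ^ 2}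

theorem mem_cornerPiece {z u : ℂ} {r : ℝ} {w : ℂ} :
    w ∈ cornerPiece z u r ↔ (starRingEnd ℂ) u * (w - z) ∈ squareQuarter r := Iff.rfl

theorem curvedSquare_eq_iUnion (r : ℝ) :
    curvedSquare r = ⋃ j, cornerPiece 0 (quarterTurn j) r := by
  ext w
  simp only [mem_iUnion, Fin.exists_fin_succ, mem_cornerPiece, quarterTurn, squareQuarter, curvedSquare]
  simp
  constructor
  · intro h
    rcases le_total 0 w.re with h1 | h1 <;> rcases le_total 0 w.im with h2 | h2
    · rw [abs_of_nonneg h1, abs_of_nonneg h2] at h; simp_all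
    · rw [abs_of_nonneg h1, abs_of_nonpos h2, add_comm] at h; simp_all
    · rw [abs_of_nonpos h1, abs_of_nonneg h2, add_comm] at h; simp_all
    · rw [abs_of_nonpos h1, abs_of_nonpos h2] at h; simp_all
  · rintro (⟨h1, h2, h⟩ | ⟨h1, h2, h⟩ | ⟨h1, h2, h⟩ | ⟨h1, h2, h⟩)
    · rwa [abs_of_nonneg h1, abs_of_nonneg h2]
    · rwa [abs_of_nonneg h1, abs_of_nonpos h2, add_comm]
    · rwa [abs_of_nonpos h1, abs_of_nonpos h2]
    · rwa [abs_of_nonneg h2, abs_of_nonpos h1, add_comm]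

theorem volume_im_eq (a : ℝ) : volume {w : ℂ | w.im = a} = 0 := by
  have h := (volume_preserving_equiv_real_prod).measure_preimage_emb
    measurableEquivRealProd.measurableEmbedding (univ ×ˢ {a})
  rw [Measure.volume_eq_prod, Measure.prod_prod, Real.volume_singleton, mul_zero] at h
  rw [← h]
  congr 1
  ext w; simp [measurableEquivRealProd]

theorem aedisjoint_cornerPiece_zero (r : ℝ) :
    Pairwise (Function.onFun (AEDisjoint volume) fun j => cornerPiece 0 (quarterTurn j) r) := by
  intro j k hjk
  refine measure_mono_null (t := {w : ℂ | w.re = 0} ∪ {w : ℂ | w.im = 0}) ?_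
    (measure_union_null (volume_re_eq 0) (volume_im_eq 0))
  rintro w ⟨h1, h2⟩
  simp only [mem_cornerPiece, squareQuarter, sub_zero] at h1 h2
  obtain ⟨a1, a2, -⟩ := h1
  obtain ⟨b1, b2, -⟩ := h2
  by_contra hcon
  simp only [mem_union, mem_ofPred_eq, not_or] at hcon
  obtain ⟨c1, c2⟩ := hcon
  fin_cases j <;> fin_cases k <;> simp [quarterTurn] at a1 a2 b1 b2 hjk <;>
    first | exact c1 (le_antisymm (by linarith) (by linarith)) |
      exact c2 (le_antisymm (by linarith) (by linarith))

/-- The fluxes through the half axes cancel: the second side of a quarter is the first side of the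
next. -/
theorem integral_planeDiv_curvedSquare {r : ℝ} (hr : 0 < r) {φ : ℂ → ℂ} (hφ : ContDiff ℝ 1 φ) :
    ∫ w in curvedSquare r, planeDiv φ w = ∑ j, cornerFlux φ 0 (quarterTurn j) r := by
  rw [curvedSquare_eq_iUnion, setIntegral_iUnion_cornerPiece hr (z := fun _ => 0)
    (aedisjoint_cornerPiece_zero r) (continuous_planeDiv hφ)]
  simp only [integral_planeDiv_cornerPiece hr hφ 0 (norm_quarterTurn _), I_mul_quarterTurn,
    Finset.sum_add_distrib, Finset.sum_sub_distrib]
  have := Equiv.sum_comp (Equiv.addRight (1 : Fin 4))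
    fun j => sideFlux φ 0 (quarterTurn j) 0 (halfSide r)
  simp only [Equiv.coe_addRight] at this
  rw [this]; ring

theorem caccioppoliPerimeter_curvedSquare_le {r : ℝ} (hr : 0 < r) :
    caccioppoliPerimeter (curvedSquare r) ≤ ENNReal.ofReal (2 * Real.pi * r / 3) := by
  refine iSup_le fun φ => iSup_le fun hφ => iSup_le fun _ => iSup_le fun h1 => ?_
  refine ENNReal.ofReal_le_ofReal ?_
  rw [integral_planeDiv_curvedSquare hr hφ]
  have h := fun j => (le_abs_self _).trans (abs_cornerFlux_le hr h1 0 (norm_quarterTurn j))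
  calc _ ≤ ∑ j : Fin 4, r * (Real.pi / 6) := Finset.sum_le_sum fun j _ => h j
    _ = _ := by simp; ring

theorem isCompact_curvedSquare {r : ℝ} (hr : 0 < r) : IsCompact (curvedSquare r) := by
  rw [curvedSquare_eq_iUnion]
  exact isCompact_iUnion fun j => isCompact_cornerPiece hr 0 (norm_quarterTurn j)

/-- The divergence theorem for the identity field, whose divergence is `2`. -/
theorem volume_real_curvedSquare {r : ℝ} (hr : 0 < r) :
    volume.real (curvedSquare r) = squareConst * r ^ 2 := by
  have h := integral_planeDiv_curvedSquare hr (φ := fun z => z) contDiff_id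
  have h2 : ∀ z, planeDiv (fun z => z) z = 2 := fun z => by
    simp [planeDiv]; norm_num
  have h3 : ∀ j, cornerFlux (fun z => z) 0 (quarterTurn j) r =
      r ^ 2 * (Real.pi / 6 - (√3 - 1) / 2) := by
    intro j
    have e1 : ∀ θ, (starRingEnd ℂ) (quarterTurn j) * (0 + quarterTurn j * quarterArc r θ) =
        quarterArc r θ := fun θ => by
      linear_combination quarterArc r θ * conj_mul_self_of_norm (norm_quarterTurn j)
    simp only [cornerFlux, e1, quarterArc_re, quarterArc_im]
    have hd : ∀ θ : ℝ, HasDerivAt (fun θ => r ^ 2 * θ - r ^ 2 / 2 * (Real.sin θ - Real.cos θ))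
        (r * ((r * Real.sin θ - r / 2) * Real.sin θ + (r * Real.cos θ - r / 2) * Real.cos θ)) θ := by
      intro θ
      refine (((hasDerivAt_id θ).const_mul (r ^ 2)).sub
        (((Real.hasDerivAt_sin θ).sub (Real.hasDerivAt_cos θ)).const_mul (r ^ 2 / 2))).congr_deriv ?_
      linear_combination (-r ^ 2) * Real.sin_sq_add_cos_sq θ
    rw [intervalIntegral.integral_eq_sub_of_hasDerivAt (fun θ _ => hd θ)
      (Continuous.intervalIntegrable (by fun_prop) _ _)]
    simp only [Real.sin_pi_div_three, Real.cos_pi_div_three, Real.sin_pi_div_six, Real.cos_pi_div_six]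
    ring
  simp only [h2, h3] at h
  rw [setIntegral_const, smul_eq_mul] at h
  simp at h
  rw [squareConst]; linarith

/-! ### The square with chipped corners -/

/-- The closed square with corner `0` and side `L`. -/
def closedSquare (L : ℝ) : Set ℂ := Icc 0 L ×ℂ Icc 0 L

/-- The corners of `closedSquare L`. -/
noncomputable def squareCorner (L : ℝ) : Fin 4 → ℂ := ![0, L, L + L * I, L * I]

theorem squareCorner_succ (L : ℝ) (j : Fin 4) :
    squareCorner L (j + 1) = squareCorner L j + quarterTurn j * L := by
  fin_cases j <;> simp [squareCorner, quarterTurn] <;> ring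

theorem isCompact_closedSquare (L : ℝ) : IsCompact (closedSquare L) :=
  isCompact_Icc.reProdIm isCompact_Icc

/-- This is the imaginary part of the complex boundary integral formula on a rectangle, applied to
the conjugate of `φ`. -/
theorem integral_planeDiv_closedSquare {L : ℝ} (hL : 0 < L) {φ : ℂ → ℂ} (hφ : ContDiff ℝ 1 φ) :
    ∫ w in closedSquare L, planeDiv φ w =
      - ∑ j, sideFlux φ (squareCorner L j) (quarterTurn j) 0 L := by
  have hset : closedSquare L =ᵐ[volume] Ioo 0 L ×ℂ Ico 0 L := by
    have hne : ∀ᵐ z : ℂ, (z.re ≠ 0 ∧ z.re ≠ L) ∧ z.im ≠ L := by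
      refine Eventually.and (Eventually.and ?_ ?_) ?_ <;> rw [ae_iff]
      · simpa using volume_re_eq 0
      · simpa using volume_re_eq L
      · simpa using volume_im_eq L
    filter_upwards [hne] with z ⟨⟨h1, h2⟩, h3⟩
    refine propext ⟨?_, ?_⟩
    · rintro ⟨⟨a1, a2⟩, a3, a4⟩
      exact ⟨⟨lt_of_le_of_ne a1 (Ne.symm h1), lt_of_le_of_ne a2 h2⟩, a3, lt_of_le_of_ne a4 h3⟩
    · rintro ⟨⟨a1, a2⟩, a3, a4⟩
      exact ⟨⟨a1.le, a2.le⟩, a3, a4.le⟩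
  have hcd := hφ.continuous_fderiv (by norm_num : (1 : WithTop ℕ∞) ≠ 0)
  rw [setIntegral_congr_set hset, setIntegral_rectangle (continuous_planeDiv hφ) hL.le hL.le]
  let f' : ℂ → ℂ →L[ℝ] ℂ := fun z => (conjCLE : ℂ →L[ℝ] ℂ).comp (fderiv ℝ φ z)
  have hf' : ∀ z, HasFDerivAt (fun z => (starRingEnd ℂ) (φ z)) (f' z) z := fun z =>
    (conjCLE.hasFDerivAt (x := φ z)).comp z (hφ.differentiable (by norm_num) z).hasFDerivAt
  have hc : Continuous fun z => I • f' z 1 - f' z I := by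
    have h1 : ∀ v : ℂ, Continuous fun z => f' z v := fun v =>
      continuous_conj.comp (hcd.clm_apply continuous_const)
    exact ((h1 1).const_smul I).sub (h1 I)
  have hb := integral_boundary_rect_of_continuousOn_of_hasFDerivAt_real
    (fun z => (starRingEnd ℂ) (φ z)) f' 0 (L + L * I) 
    (continuous_conj.comp hφ.continuous).continuousOn (fun z _ => hf' z)
    (hc.continuousOn.integrableOn_compact (isCompact_uIcc.reProdIm isCompact_uIcc))
  have hpt : ∀ z, (I • f' z 1 - f' z I).im = planeDiv φ z := fun z => by
    simp [f', planeDiv]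
  simp at hb
  have him := congrArg Complex.im hb
  have hci : ∀ a b : ℝ, ∀ g : ℝ → ℂ, Continuous g → (∫ x in a..b, g x).im = ∫ x in a..b, (g x).im :=
    fun a b g hg => (imCLM.intervalIntegral_comp_comm (hg.intervalIntegrable a b)).symm
  have hcr : ∀ a b : ℝ, ∀ g : ℝ → ℂ, Continuous g → (∫ x in a..b, g x).re = ∫ x in a..b, (g x).re :=
    fun a b g hg => (reCLM.intervalIntegral_comp_comm (hg.intervalIntegrable a b)).symm
  have c1 : Continuous fun x : ℝ => (starRingEnd ℂ) (φ x) :=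
    continuous_conj.comp (hφ.continuous.comp continuous_ofReal)
  have c2 : Continuous fun x : ℝ => (starRingEnd ℂ) (φ (x + L * I)) :=
    continuous_conj.comp (hφ.continuous.comp (by fun_prop))
  have c3 : Continuous fun x : ℝ => (starRingEnd ℂ) (φ (L + x * I)) :=
    continuous_conj.comp (hφ.continuous.comp (by fun_prop))
  have c4 : Continuous fun x : ℝ => (starRingEnd ℂ) (φ (x * I)) :=
    continuous_conj.comp (hφ.continuous.comp (by fun_prop))
  have c5 : Continuous fun q : ℝ × ℝ => I * f' (q.1 + q.2 * I) 1 - f' (q.1 + q.2 * I) I :=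
    hc.comp (by fun_prop : Continuous fun q : ℝ × ℝ => (q.1 + q.2 * I : ℂ))
  rw [hci _ _ _ (intervalIntegral.continuous_parametric_intervalIntegral_of_continuous' c5 0 L)] at him
  have hr : ∀ s : ℝ, (∫ t in (0 : ℝ)..L, (I * f' (s + t * I) 1 - f' (s + t * I) I)).im =
      ∫ t in (0 : ℝ)..L, planeDiv φ (s + t * I) := fun s => by
    refine (hci _ _ _ (c5.comp (by fun_prop : Continuous fun t : ℝ => (s, t)))).trans ?_
    exact intervalIntegral.integral_congr fun t _ => hpt _
  simp only [hr] at him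
  rw [← him]
  simp only [Complex.add_im, Complex.sub_im, Complex.I_mul_im, hci _ _ _ c1, hci _ _ _ c2,
    hcr _ _ _ c3, hcr _ _ _ c4, Complex.conj_re, Complex.conj_im, Fin.sum_univ_four,
    intervalIntegral.integral_neg]
  have r2 := intervalIntegral.integral_comp_sub_left (a := 0) (b := L)
    (fun x : ℝ => (φ (x + L * I)).im) L
  have r3 := intervalIntegral.integral_comp_sub_left (a := 0) (b := L)
    (fun x : ℝ => (φ (x * I)).re) L
  simp only [sub_zero, sub_self] at r2 r3
  rw [← r2, ← r3]
  have s0 : sideFlux φ (squareCorner L 0) (quarterTurn 0) 0 L = ∫ x in (0 : ℝ)..L, (φ x).im := by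
    simp [sideFlux, squareCorner, quarterTurn]
  have s1 : sideFlux φ (squareCorner L 1) (quarterTurn 1) 0 L =
      - ∫ x in (0 : ℝ)..L, (φ (L + x * I)).re := by
    rw [← intervalIntegral.integral_neg]
    simp [sideFlux, squareCorner, quarterTurn, mul_comm]
  have s2 : sideFlux φ (squareCorner L 2) (quarterTurn 2) 0 L =
      - ∫ x in (0 : ℝ)..L, (φ ((L - x : ℝ) + L * I)).im := by
    rw [← intervalIntegral.integral_neg]
    refine intervalIntegral.integral_congr fun x _ => ?_
    simp [squareCorner, quarterTurn]
    congr 2; ring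
  have s3 : sideFlux φ (squareCorner L 3) (quarterTurn 3) 0 L =
      ∫ x in (0 : ℝ)..L, (φ ((L - x : ℝ) * I)).re := by
    refine intervalIntegral.integral_congr fun x _ => ?_
    simp [squareCorner, quarterTurn]
    congr 2; ring
  rw [s0, s1, s2, s3]
  ring

/-- The square with side `L` whose corners have been cut off by curvilinear squares. -/
noncomputable def chippedSquare (L r : ℝ) : Set ℂ :=
  closedSquare L \ ⋃ j, cornerPiece (squareCorner L j) (quarterTurn j) r

theorem re_im_of_mem_cornerPiece {r : ℝ} (hr : 0 < r) {z u w : ℂ} (h : w ∈ cornerPiece z u r) :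
    ((starRingEnd ℂ) u * (w - z)).re ∈ Icc 0 (halfSide r) ∧
      ((starRingEnd ℂ) u * (w - z)).im ∈ Icc 0 (halfSide r) := by
  obtain ⟨h1, h2, h3⟩ := h
  exact ⟨⟨h1, le_halfSide_of_sq_add_sq_le hr h2 h3⟩, h2,
    le_halfSide_of_sq_add_sq_le hr h1 (by linarith)⟩

theorem aedisjoint_cornerPiece_squareCorner {L r : ℝ} (hr : 0 < r) (hL : 2 * halfSide r < L) :
    Pairwise (Function.onFun (AEDisjoint volume)
      fun j => cornerPiece (squareCorner L j) (quarterTurn j) r) := by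
  intro j k hjk
  refine Disjoint.aedisjoint (Set.disjoint_left.2 fun w h1 h2 => ?_)
  obtain ⟨⟨a1, a2⟩, a3, a4⟩ := re_im_of_mem_cornerPiece hr h1
  obtain ⟨⟨b1, b2⟩, b3, b4⟩ := re_im_of_mem_cornerPiece hr h2
  clear h1 h2
  fin_cases j <;> fin_cases k <;> simp [quarterTurn, squareCorner] at a1 a2 a3 a4 b1 b2 b3 b4 hjk <;>
    linarith

theorem cornerPiece_subset_closedSquare {L r : ℝ} (hr : 0 < r) (hL : 2 * halfSide r < L) (j : Fin 4) :
    cornerPiece (squareCorner L j) (quarterTurn j) r ⊆ closedSquare L := by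
  intro w h
  obtain ⟨⟨a1, a2⟩, a3, a4⟩ := re_im_of_mem_cornerPiece hr h
  have hd := halfSide_pos hr
  clear h
  fin_cases j <;> simp [quarterTurn, squareCorner] at a1 a2 a3 a4 <;>
    refine ⟨⟨?_, ?_⟩, ?_, ?_⟩ <;> linarith

/-- In the difference of square and corner pieces, the straight sides of the corners cancel the ends
of the sides of the square. There remain four arcs and four segments of length `L - 2 * halfSide r`,
and each flux is bounded by a length. -/
theorem caccioppoliPerimeter_chippedSquare_le {L r : ℝ} (hr : 0 < r) (hL : 2 * halfSide r < L) :
    caccioppoliPerimeter (chippedSquare L r) ≤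
      ENNReal.ofReal (4 * (L - 2 * halfSide r) + 2 * Real.pi * r / 3) := by
  have hd := halfSide_pos hr
  refine iSup_le fun φ => iSup_le fun hφ => iSup_le fun _ => iSup_le fun h1 => ?_
  refine ENNReal.ofReal_le_ofReal ?_
  have hK := fun j => isCompact_cornerPiece hr (squareCorner L j) (norm_quarterTurn j)
  rw [chippedSquare, setIntegral_sdiff (isCompact_iUnion hK).isClosed.measurableSet
    ((continuous_planeDiv hφ).continuousOn.integrableOn_compact (isCompact_closedSquare L))
    (iUnion_subset fun j => cornerPiece_subset_closedSquare hr hL j),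
    setIntegral_iUnion_cornerPiece hr (aedisjoint_cornerPiece_squareCorner hr hL)
      (continuous_planeDiv hφ), integral_planeDiv_closedSquare (by linarith) hφ]
  simp only [integral_planeDiv_cornerPiece hr hφ _ (norm_quarterTurn _),
    Finset.sum_add_distrib, Finset.sum_sub_distrib]
  -- The second straight side of corner `j + 1` is the final stretch of side `j`, run through
  -- backwards.
  have hrev : ∀ j, sideFlux φ (squareCorner L (j + 1)) (I * quarterTurn (j + 1)) 0 (halfSide r) =
      - sideFlux φ (squareCorner L j) (quarterTurn j) (L - halfSide r) L := fun j => by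
    rw [← sideFlux_reverse, squareCorner_succ, ← I_mul_quarterTurn, ← mul_assoc, I_mul_I, neg_one_mul]
  have hs := Equiv.sum_comp (Equiv.addRight (1 : Fin 4))
    fun j => sideFlux φ (squareCorner L j) (I * quarterTurn j) 0 (halfSide r)
  simp only [Equiv.coe_addRight, hrev, Finset.sum_neg_distrib] at hs
  rw [← hs]
  have hsplit : ∀ j, sideFlux φ (squareCorner L j) (quarterTurn j) 0 L =
      sideFlux φ (squareCorner L j) (quarterTurn j) 0 (halfSide r) +
      sideFlux φ (squareCorner L j) (quarterTurn j) (halfSide r) (L - halfSide r) +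
      sideFlux φ (squareCorner L j) (quarterTurn j) (L - halfSide r) L := fun j => by
    rw [sideFlux_add hφ.continuous, sideFlux_add hφ.continuous]
  simp only [hsplit, Finset.sum_add_distrib]
  have b1 : -∑ j, cornerFlux φ (squareCorner L j) (quarterTurn j) r ≤ 2 * Real.pi * r / 3 := by
    rw [← Finset.sum_neg_distrib]
    refine (Finset.sum_le_sum fun j _ => (neg_le_abs _).trans
      (abs_cornerFlux_le hr h1 _ (norm_quarterTurn j))).trans_eq ?_
    simp; ring
  have b2 : -∑ j, sideFlux φ (squareCorner L j) (quarterTurn j) (halfSide r) (L - halfSide r) ≤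
      4 * (L - 2 * halfSide r) := by
    rw [← Finset.sum_neg_distrib]
    refine (Finset.sum_le_sum fun j _ => (neg_le_abs _).trans
      (abs_sideFlux_le h1 _ (norm_quarterTurn j) (by linarith))).trans_eq ?_
    simp; ring
  linarith

/-! ### Square lattices and the competitor -/

theorem IsLatticeBasis.countable {G : AddSubgroup ℂ} {g g' : ℂ} (h : IsLatticeBasis G g g') :
    Countable G := by
  have : (G : Set ℂ) ⊆ range fun q : ℤ × ℤ => q.1 • g + q.2 • g' := by
    intro x hx
    rw [← h.2, SetLike.mem_coe, AddSubgroup.mem_closure_pair] at hx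
    obtain ⟨m, n, h⟩ := hx
    exact ⟨(m, n), h⟩
  exact ((countable_range _).mono this).to_subtype

/-- The square lattice generated by `g` and `I * g`. -/
def squareLattice (g : ℂ) : AddSubgroup ℂ := AddSubgroup.closure {g, I * g}

theorem mem_squareLattice {g h : ℂ} :
    h ∈ squareLattice g ↔ ∃ m n : ℤ, h = g * (m + n * I) := by
  rw [squareLattice, AddSubgroup.mem_closure_pair]
  refine exists_congr fun m => exists_congr fun n => ?_
  rw [eq_comm]
  simp only [zsmul_eq_mul]
  rw [show (m : ℂ) * g + n * (I * g) = g * (m + n * I) by ring]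

theorem isLatticeBasis_squareLattice {g : ℂ} (hg : g ≠ 0) :
    IsLatticeBasis (squareLattice g) g (I * g) := by
  refine ⟨?_, rfl⟩
  rw [LinearIndependent.pair_iff]
  intro s t h
  simp only [real_smul] at h
  have h1 : ((s : ℂ) + t * I) * g = 0 := by linear_combination h
  have h2 := (mul_eq_zero.1 h1).resolve_right hg
  have h3 := congrArg Complex.re h2
  have h4 := congrArg Complex.im h2
  simp at h3 h4
  exact ⟨h3, h4⟩

theorem mem_parallelogram_square {z g w : ℂ} (hg : g ≠ 0) :
    w ∈ parallelogram z g (I * g) ↔ ((w - z) / g).re ∈ Icc 0 1 ∧ ((w - z) / g).im ∈ Icc 0 1 := by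
  constructor
  · rintro ⟨s, hs, t, ht, rfl⟩
    have : (z + s • g + t • (I * g) - z) / g = s + t * I := by
      simp only [real_smul]; field_simp; ring
    rw [this]; simpa using ⟨hs, ht⟩
  · rintro ⟨hs, ht⟩
    refine ⟨_, hs, _, ht, ?_⟩
    simp only [real_smul]
    have h1 : (w - z) / g * g = w - z := div_mul_cancel₀ _ hg
    have h2 := Complex.re_add_im ((w - z) / g)
    linear_combination -h1 - g * h2

theorem volume_setOf_re_div_eq {g : ℂ} (hg : g ≠ 0) (z : ℂ) (a : ℝ) :
    volume {w : ℂ | ((w - z) / g).re = a} = 0 ∧ volume {w : ℂ | ((w - z) / g).im = a} = 0 := by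
  have hn : 0 < ‖g‖ := norm_pos_iff.2 hg
  have hn' : (‖g‖ : ℂ) ≠ 0 := by exact_mod_cast hn.ne'
  have hu : ‖(starRingEnd ℂ) g / ‖g‖‖ = 1 := by
    rw [norm_div, RCLike.norm_conj, norm_real, norm_norm, div_self hn.ne']
  have e : ∀ w, (w - z) / g = ((‖g‖⁻¹ : ℝ) : ℂ) * ((starRingEnd ℂ) g / ‖g‖ * (w - z)) := by
    intro w
    have h1 : (starRingEnd ℂ) g * g = (‖g‖ : ℂ) ^ 2 := Complex.conj_mul' g
    push_cast
    field_simp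
    linear_combination (-(w - z)) * h1
  have h := measurePreserving_mul_sub hu z
  have hemb := measurableEmbedding_mul_sub hu z
  have hinv : ∀ x, ‖g‖⁻¹ * x = a ↔ x = ‖g‖ * a := fun x => by
    rw [inv_mul_eq_iff_eq_mul₀ hn.ne']
  simp only [e, re_ofReal_mul, im_ofReal_mul, hinv]
  constructor
  · exact (h.measure_preimage_emb hemb {w | w.re = ‖g‖ * a}).trans (volume_re_eq _)
  · exact (h.measure_preimage_emb hemb {w | w.im = ‖g‖ * a}).trans (volume_im_eq _)

theorem isCompact_parallelogram (z g g' : ℂ) : IsCompact (parallelogram z g g') := by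
  have : parallelogram z g g' = (fun q : ℝ × ℝ => z + q.1 • g + q.2 • g') '' (Icc 0 1 ×ˢ Icc 0 1) := by
    ext w
    constructor
    · rintro ⟨s, hs, t, ht, rfl⟩
      exact ⟨(s, t), ⟨hs, ht⟩, rfl⟩
    · rintro ⟨⟨s, t⟩, ⟨hs, ht⟩, rfl⟩
      exact ⟨s, hs, t, ht, rfl⟩
  rw [this]
  exact (isCompact_Icc.prod isCompact_Icc).image (by fun_prop)

theorem exists_squareLattice_vadd_mem {g : ℂ} (hg : g ≠ 0) (z w : ℂ) :
    ∃ h ∈ squareLattice g, h + w ∈ parallelogram z g (I * g) := by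
  set v := (w - z) / g with hv
  refine ⟨g * ((-⌊v.re⌋ : ℤ) + (-⌊v.im⌋ : ℤ) * I), mem_squareLattice.2 ⟨_, _, rfl⟩, ?_⟩
  rw [mem_parallelogram_square hg]
  have : (g * ((-⌊v.re⌋ : ℤ) + (-⌊v.im⌋ : ℤ) * I) + w - z) / g =
      v + ((-⌊v.re⌋ : ℤ) + (-⌊v.im⌋ : ℤ) * I) := by
    rw [hv]; field_simp; ring
  rw [this]
  simp
  have h1 := Int.floor_le v.re
  have h2 := Int.lt_floor_add_one v.re
  have h3 := Int.floor_le v.im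
  have h4 := Int.lt_floor_add_one v.im
  refine ⟨⟨?_, ?_⟩, ?_, ?_⟩ <;> linarith

theorem isAddFundamentalDomain_squareLattice {g : ℂ} (hg : g ≠ 0) (z : ℂ) :
    IsAddFundamentalDomain (squareLattice g) (parallelogram z g (I * g)) volume := by
  refine ⟨(isCompact_parallelogram _ _ _).isClosed.measurableSet.nullMeasurableSet,
    Eventually.of_forall fun w => ?_, ?_⟩
  · obtain ⟨h, hh, hw⟩ := exists_squareLattice_vadd_mem hg z w
    exact ⟨⟨h, hh⟩, hw⟩
  · rintro ⟨h, hh⟩ ⟨h', hh'⟩ hne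
    obtain ⟨m, n, rfl⟩ := mem_squareLattice.1 hh
    obtain ⟨m', n', rfl⟩ := mem_squareLattice.1 hh'
    -- Distinct translates overlap only on the countably many lines of the grid.
    have hnull : volume ((⋃ k : ℤ, {w : ℂ | ((w - z) / g).re = k}) ∪
        ⋃ k : ℤ, {w : ℂ | ((w - z) / g).im = k}) = 0 :=
      measure_union_null (measure_iUnion_null fun k => (volume_setOf_re_div_eq hg z k).1)
        (measure_iUnion_null fun k => (volume_setOf_re_div_eq hg z k).2)
    refine measure_mono_null ?_ hnull
    rintro w ⟨⟨a, ha, rfl⟩, ⟨b, hb, hab⟩⟩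
    have hab' : g * (m' + n' * I) + b = g * (m + n * I) + a := hab
    change g * (m + n * I) + a ∈ _
    rw [mem_parallelogram_square hg] at ha hb
    have e1 : (g * (m + n * I) + a - z) / g = (a - z) / g + (m + n * I) := by field_simp; ring
    have e2 : (g * (m + n * I) + a - z) / g = (b - z) / g + (m' + n' * I) := by
      rw [← hab']; field_simp; ring
    set v := (g * (m + n * I) + a - z) / g with hv
    have r1 : v.re = ((a - z) / g).re + m := by rw [e1]; simp
    have r2 : v.re = ((b - z) / g).re + m' := by rw [e2]; simp
    have i1 : v.im = ((a - z) / g).im + n := by rw [e1]; simp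
    have i2 : v.im = ((b - z) / g).im + n' := by rw [e2]; simp
    have key : ∀ {x s t : ℝ} {m m' : ℤ}, s ∈ Icc (0 : ℝ) 1 → t ∈ Icc (0 : ℝ) 1 → x = s + m → x = t + m' →
        m ≠ m' → ∃ k : ℤ, x = k := by
      intro x s t m m' hs ht h1 h2 hmm
      rcases lt_or_gt_of_ne hmm with h | h
      · have : (m : ℝ) + 1 ≤ m' := by exact_mod_cast h
        exact ⟨m', le_antisymm (by linarith [hs.2]) (by linarith [ht.1])⟩
      · have : (m' : ℝ) + 1 ≤ m := by exact_mod_cast h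
        exact ⟨m, le_antisymm (by linarith [ht.2]) (by linarith [hs.1])⟩
    by_cases hm : m = m'
    · have hn : n ≠ n' := by
        rintro rfl
        exact hne (by subst hm; rfl)
      exact Or.inr (mem_iUnion.2 (key ha.2 hb.2 i1 i2 hn))
    · exact Or.inl (mem_iUnion.2 (key ha.1 hb.1 r1 r2 hm))

theorem biUnion_vadd_eq_iUnion (G : AddSubgroup ℂ) (K : Set ℂ) :
    ⋃ h ∈ G, h +ᵥ K = ⋃ h : G, (h : ℂ) +ᵥ K := by
  ext w; simp

theorem nullMeasurableSet_vadd {A : Set ℂ} (hA : NullMeasurableSet A volume) (g : ℂ) :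
    NullMeasurableSet (g +ᵥ A) volume := hA.vadd g

/-- The part of a fundamental domain covered by a set with disjoint translates. -/
theorem volume_inter_biUnion_vadd {G : AddSubgroup ℂ} [Countable G] {D K : Set ℂ}
    (hD : IsAddFundamentalDomain G D volume) (hK : NullMeasurableSet K volume)
    (hdisj : ∀ g ∈ G, ∀ h ∈ G, g ≠ h → volume ((g +ᵥ K) ∩ (h +ᵥ K)) = 0) :
    volume (D ∩ ⋃ h ∈ G, h +ᵥ K) = volume K := by
  rw [biUnion_vadd_eq_iUnion, hD.measure_eq_tsum K, inter_iUnion, measure_iUnion₀]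
  · refine tsum_congr fun h => ?_
    rw [inter_comm]; rfl
  · intro g h hne
    refine measure_mono_null (inter_subset_inter inter_subset_right inter_subset_right) ?_
    exact hdisj g g.2 h h.2 fun h => hne (Subtype.ext h)
  · exact fun h => hD.nullMeasurableSet.inter (nullMeasurableSet_vadd hK h)

theorem vadd_biUnion_vadd {G : AddSubgroup ℂ} {g : ℂ} (hg : g ∈ G) (K : Set ℂ) :
    g +ᵥ (⋃ h ∈ G, h +ᵥ K) = ⋃ h ∈ G, h +ᵥ K := by
  ext w
  simp only [mem_vadd_set_iff_neg_vadd_mem, mem_iUnion, vadd_eq_add, exists_prop]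
  constructor
  · rintro ⟨h, hh, hw⟩
    exact ⟨g + h, G.add_mem hg hh, by rwa [neg_add, add_assoc, add_left_comm]⟩
  · rintro ⟨h, hh, hw⟩
    refine ⟨h - g, G.sub_mem hh hg, ?_⟩
    rwa [show -(h - g) + (-g + w) = -h + w by ring]

/-- The tiling by the translates of `K` and of the rest of a fundamental domain. -/
def complementTiling (G : AddSubgroup ℂ) (hG : ∃ g g' : ℂ, IsLatticeBasis G g g') (D K : Set ℂ)
    (hD : IsAddFundamentalDomain G D volume) (hK : NullMeasurableSet K volume)
    (hdisj : ∀ g ∈ G, ∀ h ∈ G, g ≠ h → volume ((g +ᵥ K) ∩ (h +ᵥ K)) = 0) : PeriodicTwoTiling where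
  lattice := G
  isLattice := hG
  tile := ![K, D \ ⋃ h ∈ G, h +ᵥ K]
  measurable := by
    obtain ⟨g, g', hb⟩ := hG
    have := hb.countable
    refine Fin.forall_fin_two.2 ⟨hK, ?_⟩
    refine hD.nullMeasurableSet.diff ?_
    rw [biUnion_vadd_eq_iUnion]
    exact .iUnion fun h => nullMeasurableSet_vadd hK _
  disjoint := by
    -- The union of the translates of `K` is invariant under `G`, so translates of the remainder
    -- miss it altogether.
    have h01 : ∀ g ∈ G, ∀ h ∈ G, (g +ᵥ K) ∩ (h +ᵥ (D \ ⋃ h ∈ G, h +ᵥ K)) = ∅ := by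
      intro g hg h hh
      rw [vadd_set_sdiff, vadd_biUnion_vadd hh, ← disjoint_iff_inter_eq_empty]
      exact Set.disjoint_sdiff_right.mono_left (subset_iUnion₂_of_subset g hg le_rfl)
    refine Fin.forall_fin_two.2 ⟨Fin.forall_fin_two.2 ⟨?_, ?_⟩, Fin.forall_fin_two.2 ⟨?_, ?_⟩⟩
    · exact fun g hg h hh hne => hdisj g hg h hh fun e => hne (by rw [e])
    · intro g hg h hh _
      simp [h01 g hg h hh]
    · intro g hg h hh _
      simp [inter_comm, h01 h hh g hg]
    · intro g hg h hh hne
      refine measure_mono_null (inter_subset_inter (vadd_set_mono sdiff_subset)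
        (vadd_set_mono sdiff_subset)) ?_
      exact hD.aedisjoint (i := ⟨g, hg⟩) (j := ⟨h, hh⟩) fun e => hne (by rw [Subtype.mk.injEq] at e; rw [e])
  cover := by
    refine measure_mono_null ?_ hD.ae_covers
    intro w hw hcov
    obtain ⟨⟨g, hg⟩, hgw⟩ := hcov
    refine hw ?_
    by_cases hK : w ∈ ⋃ h ∈ G, h +ᵥ K
    · exact mem_iUnion.2 ⟨0, hK⟩
    · refine mem_iUnion.2 ⟨1, mem_iUnion₂.2 ⟨-g, G.neg_mem hg, ?_⟩⟩
      change w ∈ -g +ᵥ (D \ ⋃ h ∈ G, h +ᵥ K)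
      rw [vadd_set_sdiff, vadd_biUnion_vadd (G.neg_mem hg)]
      refine ⟨?_, hK⟩
      rw [mem_vadd_set_iff_neg_vadd_mem, neg_neg]
      exact hgw

/-- The tiling with the two generators exchanged. -/
def PeriodicTwoTiling.swap (T : PeriodicTwoTiling) : PeriodicTwoTiling where
  lattice := T.lattice
  isLattice := T.isLattice
  tile k := T.tile (k + 1)
  measurable k := T.measurable (k + 1)
  disjoint k j g hg h hh hne := T.disjoint (k + 1) (j + 1) g hg h hh fun e => hne (by
    rw [Prod.mk.injEq] at e ⊢; exact ⟨add_right_cancel e.1, e.2⟩)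
  cover := by
    rw [← T.cover]
    congr 2
    exact (Equiv.addRight (1 : Fin 2)).surjective.iUnion_comp
      fun k => ⋃ g ∈ T.lattice, g +ᵥ T.tile k

theorem PeriodicTwoTiling.perimeter_swap (T : PeriodicTwoTiling) : T.swap.perimeter = T.perimeter := by
  rw [perimeter, perimeter, Fin.sum_univ_two, Fin.sum_univ_two, add_comm]; rfl

theorem abs_le_halfSide_of_mem_curvedSquare {r : ℝ} (hr : 0 < r) {w : ℂ} (h : w ∈ curvedSquare r) :
    |w.re| ≤ halfSide r ∧ |w.im| ≤ halfSide r :=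
  ⟨le_halfSide_of_sq_add_sq_le hr (abs_nonneg _) h,
    le_halfSide_of_sq_add_sq_le hr (abs_nonneg w.re) (by
      have : (|w.re| + r / 2) ^ 2 + (|w.im| + r / 2) ^ 2 ≤ r ^ 2 := h
      linarith)⟩

theorem disjoint_vadd_curvedSquare {L r : ℝ} (hr : 0 < r) (hL : 2 * halfSide r < L) :
    ∀ g ∈ squareLattice L, ∀ h ∈ squareLattice L, g ≠ h →
      volume ((g +ᵥ curvedSquare r) ∩ (h +ᵥ curvedSquare r)) = 0 := by
  intro g hg h hh hne
  obtain ⟨m, n, rfl⟩ := mem_squareLattice.1 hg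
  obtain ⟨m', n', rfl⟩ := mem_squareLattice.1 hh
  have hd := halfSide_pos hr
  have key : ∀ {m m' : ℤ} {x x' : ℝ}, |x| ≤ halfSide r → |x'| ≤ halfSide r →
      L * m + x = L * m' + x' → m = m' := by
    intro m m' x x' hx hx' he
    rw [abs_le] at hx hx'
    by_contra hmm
    rcases lt_or_gt_of_ne hmm with h | h
    · have : (m : ℝ) + 1 ≤ m' := by exact_mod_cast h
      nlinarith [hx.1, hx.2, hx'.1, hx'.2]
    · have : (m' : ℝ) + 1 ≤ m := by exact_mod_cast h
      nlinarith [hx.1, hx.2, hx'.1, hx'.2]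
  rw [disjoint_iff_inter_eq_empty.1, measure_empty]
  rw [Set.disjoint_left]
  rintro _ ⟨a, ha, rfl⟩ ⟨b, hb, hab⟩
  have hab' : (L : ℂ) * (m' + n' * I) + b = L * (m + n * I) + a := hab
  obtain ⟨a1, a2⟩ := abs_le_halfSide_of_mem_curvedSquare hr ha
  obtain ⟨b1, b2⟩ := abs_le_halfSide_of_mem_curvedSquare hr hb
  have h1 := congrArg Complex.re hab'
  have h2 := congrArg Complex.im hab'
  simp at h1 h2
  obtain rfl := key b1 a1 h1
  obtain rfl := key b2 a2 h2
  exact hne rfl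

theorem parallelogram_eq_closedSquare {L : ℝ} :
    parallelogram 0 L (I * L) = closedSquare L ∨ L ≤ 0 := by
  by_cases hL : L ≤ 0
  · exact Or.inr hL
  · left
    have hL' : 0 < L := not_le.1 hL
    ext w
    rw [mem_parallelogram_square (by exact_mod_cast hL'.ne'), sub_zero, div_ofReal_re, div_ofReal_im]
    simp only [closedSquare, mem_reProdIm, mem_Icc, le_div_iff₀ hL', zero_mul, div_le_one hL']

/-- A curvilinear square reaches only `halfSide r < L / 2` from its center in each coordinate, so of
all the translates just those centered at the four corners meet the square, each in a quarter. -/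
theorem closedSquare_inter_biUnion {L r : ℝ} (hr : 0 < r) (hL : 2 * halfSide r < L) :
    chippedSquare L r = closedSquare L \ ⋃ h ∈ squareLattice L, h +ᵥ curvedSquare r := by
  have hd := halfSide_pos hr
  have hL0 : 0 < L := by linarith
  ext w
  refine and_congr_right fun hw => not_congr ?_
  simp only [mem_iUnion, exists_prop]
  constructor
  · rintro ⟨j, hj⟩
    refine ⟨squareCorner L j, ?_, ?_⟩
    · rw [mem_squareLattice]
      fin_cases j
      · exact ⟨0, 0, by simp [squareCorner]⟩
      · exact ⟨1, 0, by simp [squareCorner]⟩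
      · exact ⟨1, 1, by simp [squareCorner]; ring⟩
      · exact ⟨0, 1, by simp [squareCorner]⟩
    · rw [mem_vadd_set_iff_neg_vadd_mem, curvedSquare_eq_iUnion]
      refine mem_iUnion.2 ⟨j, ?_⟩
      rw [mem_cornerPiece] at hj ⊢
      rwa [vadd_eq_add, neg_add_eq_sub, sub_zero]
  · rintro ⟨h, hh, hwh⟩
    obtain ⟨m, n, rfl⟩ := mem_squareLattice.1 hh
    rw [mem_vadd_set_iff_neg_vadd_mem, vadd_eq_add, neg_add_eq_sub] at hwh
    obtain ⟨⟨w1, w2⟩, w3, w4⟩ := hw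
    obtain ⟨a1, a2⟩ := abs_le_halfSide_of_mem_curvedSquare hr hwh
    have hwh' := hwh
    simp only [curvedSquare, mem_ofPred_eq] at hwh'
    simp only [sub_re, sub_im, ofReal_re, ofReal_im, zero_mul, add_re, add_im, intCast_re, intCast_im,
      mul_re, mul_im, I_re, I_im, mul_zero, mul_one, sub_zero, zero_add, add_zero] at a1 a2 hwh'
    have key : ∀ {x : ℝ} {m : ℤ}, 0 ≤ x → x ≤ L → |x - L * m| ≤ halfSide r →
        (m = 0 ∧ |x - L * m| = x) ∨ (m = 1 ∧ |x - L * m| = L - x) := by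
      intro x m h0 h1 h2
      have h3 := abs_le.1 h2
      have m0 : -1 < m := by
        by_contra hcon
        have : (m : ℝ) ≤ -1 := by exact_mod_cast not_lt.1 hcon
        nlinarith [h3.1, h3.2]
      have m2 : m < 2 := by
        by_contra hcon
        have : (2 : ℝ) ≤ m := by exact_mod_cast not_lt.1 hcon
        nlinarith [h3.1, h3.2]
      rcases (by omega : m = 0 ∨ m = 1) with rfl | rfl
      · left; refine ⟨rfl, ?_⟩; simp [abs_of_nonneg h0]
      · right; refine ⟨rfl, ?_⟩
        rw [Int.cast_one, mul_one, abs_sub_comm, abs_of_nonneg (by linarith)]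
    simp only [Fin.exists_fin_succ, mem_cornerPiece, quarterTurn, squareQuarter, squareCorner]
    simp
    rcases key w1 w2 a1 with ⟨rfl, e1⟩ | ⟨rfl, e1⟩ <;> rcases key w3 w4 a2 with ⟨rfl, e2⟩ | ⟨rfl, e2⟩ <;>
      rw [e1, e2] at hwh'
    · exact Or.inl ⟨w1, w3, hwh'⟩
    · exact Or.inr (Or.inr (Or.inr ⟨w4, w1, by linarith⟩))
    · exact Or.inr (Or.inl ⟨w3, w2, by linarith⟩)
    · exact Or.inr (Or.inr (Or.inl ⟨w2, w4, by linarith⟩))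

theorem volume_closedSquare {L : ℝ} (hL : 0 ≤ L) : volume (closedSquare L) = ENNReal.ofReal (L ^ 2) := by
  have h := (volume_preserving_equiv_real_prod).measure_preimage_emb
    measurableEquivRealProd.measurableEmbedding (Icc 0 L ×ˢ Icc 0 L)
  rw [Measure.volume_eq_prod, Measure.prod_prod, Real.volume_Icc, sub_zero, ← ENNReal.ofReal_mul hL] at h
  rw [pow_two, ← h]
  congr 1

/-- The square competitor with prescribed areas. -/
theorem exists_squareTiling {A₁ A₂ : ℝ} (h₁ : 0 < A₁) (h₂ : 0 < A₂)
    (h : A₁ / (A₁ + A₂) < (2 + √3) * squareConst / 2) :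
    ∃ T : PeriodicTwoTiling, volume (T.tile 0) = ENNReal.ofReal A₁ ∧
      volume (T.tile 1) = ENNReal.ofReal A₂ ∧
      T.perimeter ≤ ENNReal.ofReal (2 * √(A₁ + A₂) + 2 * √(squareConst * A₁)) := by
  have hc := squareConst_pos
  have h3 : √3 ^ 2 = 3 := Real.sq_sqrt (by norm_num)
  obtain ⟨b1, b2⟩ := sqrt_three_bounds
  set L := √(A₁ + A₂) with hLdef
  set r := √(A₁ / squareConst) with hrdef
  have hr : 0 < r := Real.sqrt_pos.2 (by positivity)
  have hr2 : squareConst * r ^ 2 = A₁ := by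
    rw [hrdef, Real.sq_sqrt (by positivity), mul_div_cancel₀ _ hc.ne']
  have hL0 : 0 < L := Real.sqrt_pos.2 (by positivity)
  have hL2 : L ^ 2 = A₁ + A₂ := Real.sq_sqrt (by positivity)
  -- The hypothesis on the ratio is equivalent to this: `(2 * halfSide r)² = (4 - 2√3) r²`, and `(2
  -- + √3)(2 - √3) = 1`.
  have hLr : 2 * halfSide r < L := by
    refine lt_of_pow_lt_pow_left₀ 2 hL0.le ?_
    rw [hL2]
    rw [div_lt_iff₀ (by positivity), ← hr2] at h
    rw [hr2] at h
    have h4 : (2 - √3) * A₁ < squareConst / 2 * (A₁ + A₂) := by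
      have := mul_lt_mul_of_pos_left h (by linarith : 0 < 2 - √3)
      refine this.trans_eq ?_
      linear_combination (-(squareConst * (A₁ + A₂)) / 2) * h3
    rw [halfSide]
    have h5 : (2 * ((√3 - 1) * r / 2)) ^ 2 * squareConst = (4 - 2 * √3) * A₁ := by
      rw [← hr2]; linear_combination (squareConst * r ^ 2) * h3
    nlinarith
  have hLne : (L : ℂ) ≠ 0 := by exact_mod_cast hL0.ne'
  have hpar : parallelogram 0 L (I * L) = closedSquare L :=
    parallelogram_eq_closedSquare.resolve_right (not_le.2 hL0)
  have hD := isAddFundamentalDomain_squareLattice hLne 0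
  rw [hpar] at hD
  have hbasis := isLatticeBasis_squareLattice hLne
  have hcount := hbasis.countable
  have hKc := isCompact_curvedSquare hr
  have hK := hKc.isClosed.measurableSet.nullMeasurableSet (μ := volume)
  have hdisj := disjoint_vadd_curvedSquare hr hLr
  have hvK : volume (curvedSquare r) = ENNReal.ofReal A₁ := by
    rw [← hr2, ← volume_real_curvedSquare hr, measureReal_def,
      ENNReal.ofReal_toReal hKc.measure_lt_top.ne]
  refine ⟨complementTiling (squareLattice L) ⟨_, _, hbasis⟩ (closedSquare L) (curvedSquare r) hD hK
    hdisj, hvK, ?_, ?_⟩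
  · change volume (closedSquare L \ ⋃ h ∈ squareLattice L, h +ᵥ curvedSquare r) = _
    have hu : NullMeasurableSet (⋃ h ∈ squareLattice (L : ℂ), h +ᵥ curvedSquare r) volume := by
      rw [biUnion_vadd_eq_iUnion]
      exact .iUnion fun h => nullMeasurableSet_vadd hK _
    have h1 := measure_inter_add_sdiff₀ (closedSquare L) hu
    rw [volume_inter_biUnion_vadd hD hK hdisj, hvK, volume_closedSquare hL0.le, hL2,
      ENNReal.ofReal_add h₁.le h₂.le] at h1
    exact (ENNReal.add_right_inj ENNReal.ofReal_ne_top).1 h1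
  · rw [PeriodicTwoTiling.perimeter, Fin.sum_univ_two]
    change 1 / 2 * (caccioppoliPerimeter (curvedSquare r) + caccioppoliPerimeter
      (closedSquare L \ ⋃ h ∈ squareLattice L, h +ᵥ curvedSquare r)) ≤ _
    rw [← closedSquare_inter_biUnion hr hLr]
    have hsq : √(squareConst * A₁) = squareConst * r := by
      rw [← hr2, show squareConst * (squareConst * r ^ 2) = (squareConst * r) ^ 2 by ring,
        Real.sqrt_sq (by positivity)]
    have hhalf : (1 / 2 : ℝ≥0∞) = ENNReal.ofReal (1 / 2) := by
      rw [ENNReal.ofReal_div_of_pos two_pos]; simp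
    have hpi := Real.pi_pos
    calc _ ≤ 1 / 2 * (ENNReal.ofReal (2 * Real.pi * r / 3) +
          ENNReal.ofReal (4 * (L - 2 * halfSide r) + 2 * Real.pi * r / 3)) := by
          gcongr
          · exact caccioppoliPerimeter_curvedSquare_le hr
          · exact caccioppoliPerimeter_chippedSquare_le hr hLr
      _ = _ := by
          rw [← ENNReal.ofReal_add (by positivity)
            (add_nonneg (mul_nonneg (by norm_num) (by linarith)) (by positivity)), hhalf,
            ← ENNReal.ofReal_mul (by norm_num), hsq]
          congr 1
          rw [halfSide, squareConst]; ring

/-- The perimeter of an isoperimetric tiling is at most that of the square tiling with the same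
areas, when the latter exists, and it is smaller otherwise. -/
theorem PeriodicTwoTiling.Isoperimetric.perimeter_le {T : PeriodicTwoTiling} (hT : T.Isoperimetric)
    {A₁ A₂ : ℝ} (h₁ : 0 < A₁) (h₂ : 0 < A₂) (v₁ : volume (T.tile 0) = ENNReal.ofReal A₁)
    (v₂ : volume (T.tile 1) = ENNReal.ofReal A₂) :
    T.perimeter ≤ ENNReal.ofReal (2 * √(A₁ + A₂) + 2 * √(squareConst * A₁)) ∧
      (A₁ / (A₁ + A₂) < (2 + √3) * squareConst / 2 ∨
        T.perimeter < ENNReal.ofReal (2 * √(A₁ + A₂) + 2 * √(squareConst * A₁))) := by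
  by_cases h : A₁ / (A₁ + A₂) < (2 + √3) * squareConst / 2
  · obtain ⟨T', e1, e2, hp⟩ := exists_squareTiling h₁ h₂ h
    refine ⟨(hT T' ?_).trans hp, Or.inl h⟩
    exact Fin.forall_fin_two.2 ⟨e1.trans v₁.symm, e2.trans v₂.symm⟩
  · have hc := squareConst_bounds
    have h3 := sqrt_three_bounds
    have hA : 0 < A₁ + A₂ := by positivity
    -- Any bound above one half would do: it makes `A₁ > A₂` and puts the ratio of the exchanged
    -- areas below the threshold.
    have hlow : (0.58 : ℝ) < (2 + √3) * squareConst / 2 := by nlinarith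
    have h4 : 0.58 * (A₁ + A₂) < A₁ := by
      have := hlow.trans_le (not_lt.1 h)
      rwa [lt_div_iff₀ hA] at this
    have h5 : A₂ / (A₂ + A₁) < (2 + √3) * squareConst / 2 := by
      refine lt_trans ?_ hlow
      rw [div_lt_iff₀ (by positivity)]; linarith
    -- With the roles exchanged, the smaller area goes to the curvilinear squares, and the term
    -- `2√(c A₂)` is strictly smaller than `2√(c A₁)`.
    obtain ⟨T', e1, e2, hp⟩ := exists_squareTiling h₂ h₁ h5
    have hle : T.perimeter ≤ ENNReal.ofReal (2 * √(A₂ + A₁) + 2 * √(squareConst * A₂)) := by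
      refine (hT T'.swap ?_).trans (by rwa [T'.perimeter_swap])
      exact Fin.forall_fin_two.2 ⟨e2.trans v₁.symm, e1.trans v₂.symm⟩
    have hlt : √(squareConst * A₂) < √(squareConst * A₁) :=
      Real.sqrt_lt_sqrt (mul_nonneg squareConst_pos.le h₂.le)
        (mul_lt_mul_of_pos_left (by linarith) squareConst_pos)
    have hlt2 : T.perimeter < ENNReal.ofReal (2 * √(A₁ + A₂) + 2 * √(squareConst * A₁)) := by
      refine hle.trans_lt ((ENNReal.ofReal_lt_ofReal_iff ?_).2 ?_)
      · have := Real.sqrt_nonneg (squareConst * A₂)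
        have := Real.sqrt_nonneg (A₁ + A₂)
        linarith
      · rw [add_comm A₂ A₁]; linarith
    exact ⟨hlt2.le, Or.inr hlt2⟩

/-! ### The equality case and the shape of the first tile -/

/-- The value `2√(A₁ + A₂) + 2√(c A₁)` bounds the perimeter from above by comparison; it is at most
half the total length, which in turn is at most the perimeter. So all agree, and the strict
alternative in `perimeter_le` is impossible. -/
theorem isoperimetric_rectangle_chipped {T : PeriodicTwoTiling} (hT : T.Isoperimetric)
    (hnd : T.NonDegenerate) {p : ℝ} (hp : 0 < p) (P : CurvedPolygon 4) (hκ : ∀ i, P.curv i = p)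
    (hin : ∀ i, inner ℝ (P.vertex (i + 1) - P.vertex i) (P.vertex (i + 2) - P.vertex (i + 1)) = 0)
    {R : Set ℂ} (hR : P.Encloses R) (hTR : T.tile 0 =ᵐ[volume] R)
    (Q : CurvedPolygon 8) (hκ' : ∀ i : Fin 8, Q.curv i = if Even (i : ℕ) then 0 else -p)
    (hdir : ∀ i : Fin 8, Even (i : ℕ) → Q.dir (i + 4) = -Q.dir i)
    {R' : Set ℂ} (hR' : Q.Encloses R') (hTR' : T.tile 1 =ᵐ[volume] R') :
    0 < volume.real R ∧ 0 < volume.real R' ∧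
    ((∀ i, p * P.len i = Real.pi / 6) ∧ (∀ i : Fin 8, ¬ Even (i : ℕ) → p * Q.len i = Real.pi / 6) ∧
      (∀ i : Fin 8, Even (i : ℕ) → Q.len i = Q.len 0) ∧
      volume.real R = squareConst * p⁻¹ ^ 2 ∧
      volume.real R + volume.real R' = (Q.len 0 + (√3 - 1) * p⁻¹) ^ 2) ∧
    volume.real R / (volume.real R + volume.real R') < (2 + √3) * squareConst / 2 ∧
    T.perimeter = ENNReal.ofReal
      (2 * √(volume.real R + volume.real R') + 2 * √(squareConst * volume.real R)) := by
  have v₁ : volume (T.tile 0) = ENNReal.ofReal (volume.real R) := by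
    rw [measure_congr hTR, measureReal_def, ENNReal.ofReal_toReal hR.isCompact.measure_lt_top.ne]
  have v₂ : volume (T.tile 1) = ENNReal.ofReal (volume.real R') := by
    rw [measure_congr hTR', measureReal_def, ENNReal.ofReal_toReal hR'.isCompact.measure_lt_top.ne]
  have h₁ : 0 < volume.real R := by
    have := hnd 0; rwa [v₁, ENNReal.ofReal_pos] at this
  have h₂ : 0 < volume.real R' := by
    have := hnd 1; rwa [v₂, ENNReal.ofReal_pos] at this
  obtain ⟨hle, hor⟩ := hT.perimeter_le h₁ h₂ v₁ v₂
  obtain ⟨hI, hIeq⟩ := rectangle_chipped_length hp P hκ hin hR h₁ Q hκ' hdir hR' h₂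
  have l₁ : 0 ≤ ∑ i, P.len i := Finset.sum_nonneg fun i _ => (P.len_pos i).le
  have l₂ : 0 ≤ ∑ i, Q.len i := Finset.sum_nonneg fun i _ => (Q.len_pos i).le
  have hge : ENNReal.ofReal ((∑ i, P.len i + ∑ i, Q.len i) / 2) ≤ T.perimeter := by
    have hhalf : (1 / 2 : ℝ≥0∞) = ENNReal.ofReal (1 / 2) := by
      rw [ENNReal.ofReal_div_of_pos two_pos]; simp
    rw [PeriodicTwoTiling.perimeter, Fin.sum_univ_two, caccioppoliPerimeter_congr hTR,
      caccioppoliPerimeter_congr hTR', show (∑ i, P.len i + ∑ i, Q.len i) / 2 =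
        1 / 2 * (∑ i, P.len i + ∑ i, Q.len i) by ring, ENNReal.ofReal_mul (by norm_num),
      ENNReal.ofReal_add l₁ l₂, ← hhalf]
    gcongr
    · exact hR.length_le_caccioppoliPerimeter
    · exact hR'.length_le_caccioppoliPerimeter
  have hge2 := (ENNReal.ofReal_le_ofReal hI).trans hge
  have heq := le_antisymm hle hge2
  refine ⟨h₁, h₂, hIeq (le_antisymm hI ?_), ?_, heq⟩
  · rw [heq] at hge
    exact (ENNReal.ofReal_le_ofReal_iff (by positivity)).1 hge
  · exact hor.resolve_right heq.not_lt

/-- A linear functional separating a point of `R` from `K` attains its maximum over the compact set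
`R` at a frontier point, which would have to lie in `K`. -/
theorem subset_of_frontier_subset_convex {R K : Set ℂ} (hR : IsCompact R) (hK : Convex ℝ K)
    (hKc : IsClosed K) (h : frontier R ⊆ K) : R ⊆ K := by
  intro x hx
  by_contra hxK
  obtain ⟨f, u, hfu, hux⟩ := geometric_hahn_banach_closed_point hK hKc hxK
  obtain ⟨y, hyR, hy⟩ := hR.exists_isMaxOn ⟨x, hx⟩ f.continuous.continuousOn
  have hfy : u < f y := hux.trans_le (hy hx)
  have hyf : y ∉ interior R := by
    intro hyi
    have hloc : IsLocalMax f y := by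
      filter_upwards [mem_interior_iff_mem_nhds.1 hyi] with z hz using hy hz
    have h0 : f = 0 := hloc.hasFDerivAt_eq_zero f.hasFDerivAt
    have hmem : y ∈ R := hyR
    have : (f : ℂ →L[ℝ] ℝ) y = f x := by rw [h0]; rfl
    -- Only an empty `K` can be separated by the zero functional. Then `R` has empty frontier, so it
    -- is empty or the whole plane.
    by_cases hKe : K.Nonempty
    · obtain ⟨k, hk⟩ := hKe
      have := hfu k hk
      rw [h0] at this hux
      exact absurd (this.trans hux) (lt_irrefl _)
    · have hfe : frontier R = ∅ := subset_empty_iff.1 (h.trans (not_nonempty_iff_eq_empty.1 hKe).le)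
      rcases frontier_eq_empty_iff.1 hfe with h1 | h1
      · rw [h1] at hx; exact hx
      · rw [h1] at hR
        exact noncompact_univ ℂ hR
  exact absurd (hfu y (h ⟨subset_closure hyR, hyf⟩)) (not_lt.2 hfy.le)

/-- A region whose boundary lies on the boundary of a convex set is this convex set. -/
theorem eq_of_frontier_subset_convex {R K : Set ℂ} (hR : IsCompact R) (hcl : closure (interior R) = R)
    (hne : R.Nonempty) (hK : Convex ℝ K) (hKc : IsClosed K) (h : frontier R ⊆ K)
    (hd : Disjoint (interior K) (frontier R)) : R = K := by
  have hRK := subset_of_frontier_subset_convex hR hK hKc h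
  have hint : (interior R).Nonempty := by
    rw [← hcl] at hne
    exact closure_nonempty_iff.1 hne
  have hint' : (interior K).Nonempty := hint.mono (interior_mono hRK)
  refine subset_antisymm hRK ?_
  rcases hK.interior.isPreconnected.subset_interior_or_disjoint hd with h1 | h1
  · rw [← hKc.closure_eq, ← hK.closure_interior_eq_closure_of_nonempty_interior hint', ← hcl]
    exact closure_mono h1
  · obtain ⟨x, hx⟩ := hint
    exact absurd (interior_subset hx) (Set.disjoint_left.1 h1 (interior_mono hRK hx))

/-- The curvilinear square with center `O` and axes directed by `F` and `I * F`. -/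
def placedSquare (O F : ℂ) (r : ℝ) : Set ℂ := (fun w => (starRingEnd ℂ) F * (w - O)) ⁻¹' curvedSquare r

/-- The center of the `j`-th arc of `placedSquare O F r`. -/
noncomputable def arcCenter (O F : ℂ) (r : ℝ) (j : Fin 4) : ℂ :=
  O - (r / 2 : ℝ) * ((1 + I) * (quarterTurn j * F))

theorem mul_conj_self_of_norm {u : ℂ} (hu : ‖u‖ = 1) : u * (starRingEnd ℂ) u = 1 := by
  rw [mul_comm, conj_mul_self_of_norm hu]

/-- Among the four discs, the one opposite to the quadrant of a point is the most restrictive. This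
makes convexity evident. -/
theorem placedSquare_eq_iInter {r : ℝ} (hr : 0 ≤ r) (O : ℂ) {F : ℂ} (hF : ‖F‖ = 1) :
    placedSquare O F r = ⋂ j, Metric.closedBall (arcCenter O F r j) r := by
  ext w
  set v := (starRingEnd ℂ) F * (w - O) with hv
  have hw : w - O = F * v := by rw [hv, ← mul_assoc, mul_conj_self_of_norm hF, one_mul]
  have hball : ∀ j, w ∈ Metric.closedBall (arcCenter O F r j) r ↔
      normSq (v + (r / 2 : ℝ) * ((1 + I) * quarterTurn j)) ≤ r ^ 2 := by
    intro j
    rw [Metric.mem_closedBall, dist_eq_norm, arcCenter, normSq_eq_norm_sq,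
      show w - (O - (r / 2 : ℝ) * ((1 + I) * (quarterTurn j * F))) =
        F * (v + (r / 2 : ℝ) * ((1 + I) * quarterTurn j)) by linear_combination hw,
      norm_mul, hF, one_mul, sq_le_sq₀ (norm_nonneg _) hr]
  simp only [mem_iInter, hball, Fin.forall_fin_succ]
  change v ∈ curvedSquare r ↔ _
  simp [quarterTurn, curvedSquare, normSq_apply]
  rcases abs_cases v.re with ⟨h1, h2⟩ | ⟨h1, h2⟩ <;> rcases abs_cases v.im with ⟨h3, h4⟩ | ⟨h3, h4⟩ <;>
    rw [h1, h3] <;> constructor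
  all_goals first
    | (intro h; refine ⟨?_, ?_, ?_, ?_⟩ <;> nlinarith)
    | (rintro ⟨a1, a2, a3, a4⟩; nlinarith)

theorem convex_placedSquare {r : ℝ} (hr : 0 ≤ r) (O : ℂ) {F : ℂ} (hF : ‖F‖ = 1) :
    Convex ℝ (placedSquare O F r) := by
  rw [placedSquare_eq_iInter hr O hF]
  exact convex_iInter fun j => convex_closedBall _ _

theorem isClosed_placedSquare {r : ℝ} (hr : 0 ≤ r) (O : ℂ) {F : ℂ} (hF : ‖F‖ = 1) :
    IsClosed (placedSquare O F r) := by
  rw [placedSquare_eq_iInter hr O hF]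
  exact isClosed_iInter fun j => Metric.isClosed_closedBall

theorem notMem_interior_placedSquare {r : ℝ} (hr : 0 < r) (O : ℂ) {F : ℂ} (hF : ‖F‖ = 1) {j : Fin 4}
    {w : ℂ} (h : ‖w - arcCenter O F r j‖ = r) : w ∉ interior (placedSquare O F r) := by
  intro hw
  rw [placedSquare_eq_iInter hr.le O hF] at hw
  have := interior_mono (iInter_subset _ j) hw
  rw [interior_closedBall _ hr.ne', Metric.mem_ball, dist_eq_norm, h] at this
  exact lt_irrefl _ this

theorem exp_pi_div_six : exp ((Real.pi / 6 : ℝ) * I) = (√3 / 2 : ℝ) + (1 / 2 : ℝ) * I := by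
  rw [Complex.exp_mul_I, ← Complex.ofReal_cos, ← Complex.ofReal_sin, Real.cos_pi_div_six,
    Real.sin_pi_div_six]

theorem exp_pi_div_two_real : exp ((Real.pi / 2 : ℝ) * I) = I := by
  push_cast; exact Complex.exp_pi_div_two_mul_I

theorem exp_add_pi_div_two_mul_I (x : ℝ) :
    exp ((x + Real.pi / 2 : ℝ) * I) = I * exp ((x : ℝ) * I) := by
  rw [ofReal_add, add_mul, Complex.exp_add, exp_pi_div_two_real, mul_comm]

theorem sqrt_three_sq_complex : ((√3 : ℝ) : ℂ) ^ 2 = 3 := by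
  exact_mod_cast Real.sq_sqrt (by norm_num : (0 : ℝ) ≤ 3)

/-- The points of the boundary arc of the corner piece, by the angle at the center of the arc. -/
theorem arc_mem_squareQuarter {r : ℝ} (hr : 0 < r) {φ : ℝ} (h : φ ∈ Icc (Real.pi / 6) (Real.pi / 3)) :
    r * exp ((φ : ℝ) * I) - (r / 2 : ℝ) * (1 + I) ∈ squareQuarter r := by
  have hpi := Real.pi_pos
  have e : r * exp ((φ : ℝ) * I) - (r / 2 : ℝ) * (1 + I) =
      (r * Real.cos φ - r / 2 : ℝ) + (r * Real.sin φ - r / 2 : ℝ) * I := by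
    rw [Complex.exp_mul_I, ← Complex.ofReal_cos, ← Complex.ofReal_sin]; push_cast; ring
  have hc : 1 / 2 ≤ Real.cos φ := by
    rw [← Real.cos_pi_div_three]
    exact Real.cos_le_cos_of_nonneg_of_le_pi (by linarith [h.1]) (by linarith) h.2
  have hs : 1 / 2 ≤ Real.sin φ := by
    rw [← Real.sin_pi_div_six]
    exact Real.sin_le_sin_of_le_of_le_pi_div_two (by linarith) (by linarith [h.2]) h.1
  have hsc := Real.sin_sq_add_cos_sq φ
  have hre : ∀ a b : ℝ, ((a : ℂ) + b * I).re = a := fun a b => by simp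
  have him : ∀ a b : ℝ, ((a : ℂ) + b * I).im = b := fun a b => by simp
  rw [e, squareQuarter, mem_ofPred_eq, hre, him]
  refine ⟨by nlinarith, by nlinarith, le_of_eq ?_⟩
  linear_combination r ^ 2 * hsc

namespace CurvedPolygon

/-- The center of a circular edge. -/
noncomputable def center {n : ℕ} [NeZero n] (P : CurvedPolygon n) (i : Fin n) : ℂ :=
  P.vertex i + I * P.dir i / P.curv i

theorem point_eq_center_sub {n : ℕ} [NeZero n] (P : CurvedPolygon n) {i : Fin n} (h : P.curv i ≠ 0)
    (s : ℝ) : P.point i s = P.center i - I * P.tangent i s / P.curv i := arcPoint_curved _ _ h s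

variable {p : ℝ} {P : CurvedPolygon 4}

theorem dir_succ_of_square (hκ : ∀ i, P.curv i = p) (hθ : ∀ i, p * P.len i = Real.pi / 6) (i : Fin 4) :
    P.dir (i + 1) = I * P.dir i := by
  rw [P.dir_succ, hκ, hθ, show Real.pi / 6 + Real.pi / 3 = Real.pi / 2 by ring, exp_pi_div_two_real,
    mul_comm]

theorem vertex_succ_of_square (hp : 0 < p) (hκ : ∀ i, P.curv i = p)
    (hθ : ∀ i, p * P.len i = Real.pi / 6) (i : Fin 4) :
    P.vertex (i + 1) - P.vertex i =
      I * P.dir i * (p⁻¹ : ℝ) * (1 - exp ((Real.pi / 6 : ℝ) * I)) := by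
  have hk : P.curv i ≠ 0 := by rw [hκ]; exact hp.ne'
  rw [← P.point_len, P.point_eq_center_sub hk, center, tangent, arcTangent, hκ, hθ]
  push_cast; ring

/-- The angles `π / 6` place the four arcs on the four circles bounding a convex curvilinear square;
a region whose boundary lies in a convex set but misses its interior fills it. -/
theorem Encloses.eq_placedSquare (hp : 0 < p) (hκ : ∀ i, P.curv i = p)
    (hθ : ∀ i, p * P.len i = Real.pi / 6) {R : Set ℂ} (hR : P.Encloses R) :
    ∃ O F : ℂ, ‖F‖ = 1 ∧ (∀ j, P.dir j = quarterTurn j * (F * exp ((2 * Real.pi / 3 : ℝ) * I))) ∧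
      (∀ j, P.center j = arcCenter O F p⁻¹ j) ∧ R = placedSquare O F p⁻¹ := by
  have hr : 0 < p⁻¹ := inv_pos.2 hp
  have hpi := Real.pi_pos
  set r := p⁻¹ with hrdef
  -- Relative to `F`, the first arc is seen from its center under angles from `π / 6` to `π / 3`, so
  -- its initial tangent has angle `π / 6 + π / 2 = 2π / 3`.
  set F := P.dir 0 * exp ((-(2 * Real.pi / 3) : ℝ) * I) with hFdef
  have hF : ‖F‖ = 1 := by rw [hFdef, norm_mul, P.norm_dir, norm_exp_ofReal_mul_I, one_mul]
  have hFD : P.dir 0 = F * exp ((2 * Real.pi / 3 : ℝ) * I) := by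
    rw [hFdef, mul_assoc, ← Complex.exp_add, ← add_mul, ← ofReal_add, neg_add_cancel]; simp
  -- The solution of `arcCenter O F r 0 = P.center 0`.
  set O := P.center 0 + (r / 2 : ℝ) * ((1 + I) * F) with hOdef
  have hdir : ∀ j, P.dir j = quarterTurn j * (F * exp ((2 * Real.pi / 3 : ℝ) * I)) := by
    have h1 := P.dir_succ_of_square hκ hθ 0
    have h2 := P.dir_succ_of_square hκ hθ 1
    have h3 := P.dir_succ_of_square hκ hθ 2
    rw [← hFD]
    have e1 : (0 : Fin 4) + 1 = 1 := rfl
    have e2 : (1 : Fin 4) + 1 = 2 := rfl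
    have e3 : (2 : Fin 4) + 1 = 3 := rfl
    rw [e1] at h1
    rw [e2, h1, ← mul_assoc, I_mul_I] at h2
    rw [e3, h2] at h3
    intro j
    fin_cases j
    · simp [quarterTurn]
    · simpa [quarterTurn] using h1
    · simpa [quarterTurn] using h2
    · simpa [quarterTurn] using h3
  have hcs : ∀ i, P.center (i + 1) - P.center i =
      arcCenter O F r (i + 1) - arcCenter O F r i := by
    intro i
    have hv := P.vertex_succ_of_square hp hκ hθ i
    have h23 : exp ((2 * Real.pi / 3 : ℝ) * I) = I * exp ((Real.pi / 6 : ℝ) * I) := by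
      rw [← exp_add_pi_div_two_mul_I]; congr 3; ring
    have hpr : ∀ z : ℂ, z / (p : ℂ) = z * (r : ℂ) := fun z => by
      rw [hrdef, div_eq_mul_inv]; push_cast; rfl
    rw [center, center, hκ, hκ, hpr, hpr, P.dir_succ_of_square hκ hθ, arcCenter, arcCenter,
      ← I_mul_quarterTurn]
    rw [hdir i, h23, exp_pi_div_six] at hv ⊢
    have h3 := sqrt_three_sq_complex
    have hI := I_sq
    rw [← hrdef] at hv
    push_cast at hv ⊢
    linear_combination hv + quarterTurn i * F * r * (-(√3 / 2 + 1 / 2 * I) ^ 2 +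
      I * (√3 / 2 + 1 / 2 * I) + 1 / 4) * hI + quarterTurn i * F * r / 4 * h3
  have hc : ∀ j, P.center j = arcCenter O F r j := by
    have h0 : P.center 0 = arcCenter O F r 0 := by
      rw [arcCenter, hOdef]; simp [quarterTurn]
    have e1 : (0 : Fin 4) + 1 = 1 := rfl
    have e2 : (1 : Fin 4) + 1 = 2 := rfl
    have e3 : (2 : Fin 4) + 1 = 3 := rfl
    have h1 := hcs 0
    have h2 := hcs 1
    have h3 := hcs 2
    rw [e1] at h1; rw [e2] at h2; rw [e3] at h3
    have g1 : P.center 1 = arcCenter O F r 1 := by linear_combination h1 + h0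
    have g2 : P.center 2 = arcCenter O F r 2 := by linear_combination h2 + g1
    have g3 : P.center 3 = arcCenter O F r 3 := by linear_combination h3 + g2
    intro j; fin_cases j <;> assumption
  refine ⟨O, F, hF, hdir, hc, ?_⟩
  have hfr : ∀ w ∈ frontier R, w ∈ placedSquare O F r ∧ ∃ j, ‖w - arcCenter O F r j‖ = r := by
    intro w hw
    rw [hR.frontier_eq] at hw
    obtain ⟨j, hj⟩ := mem_iUnion.1 hw
    obtain ⟨s, ⟨hs0, hs1⟩, rfl⟩ := hj
    change P.point j s ∈ _ ∧ ∃ j', ‖P.point j s - _‖ = r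
    have hk : P.curv j ≠ 0 := by rw [hκ]; exact hp.ne'
    have hpt : P.point j s - arcCenter O F r j = - (I * P.tangent j s * (r : ℂ)) := by
      rw [P.point_eq_center_sub hk, hc, hκ, hrdef]; push_cast; ring
    refine ⟨?_, j, ?_⟩
    · change (starRingEnd ℂ) F * (P.point j s - O) ∈ curvedSquare r
      rw [curvedSquare_eq_iUnion]
      refine mem_iUnion.2 ⟨j, ?_⟩
      rw [mem_cornerPiece, sub_zero]
      have hφ : Real.pi / 6 + p * s ∈ Icc (Real.pi / 6) (Real.pi / 3) := by
        have := mul_le_mul_of_nonneg_left hs1 hp.le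
        rw [hθ] at this
        have := mul_nonneg hp.le hs0
        constructor <;> linarith
      convert arc_mem_squareQuarter hr hφ using 1
      have e1 : P.tangent j s = quarterTurn j * F * (I * exp ((Real.pi / 6 + p * s : ℝ) * I)) := by
        have e0 : exp ((2 * Real.pi / 3 : ℝ) * I) * exp ((p * s : ℝ) * I) =
            I * exp ((Real.pi / 6 + p * s : ℝ) * I) := by
          rw [← exp_add_pi_div_two_mul_I, ← Complex.exp_add, ← add_mul, ← ofReal_add]
          congr 3; ring
        rw [tangent, arcTangent, hdir, hκ, ← e0]
        ring
      have e2 : P.point j s - O = quarterTurn j * F *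
          (r * exp ((Real.pi / 6 + p * s : ℝ) * I) - (r / 2 : ℝ) * (1 + I)) := by
        rw [e1, arcCenter] at hpt
        linear_combination hpt - (quarterTurn j * F * r * exp ((Real.pi / 6 + p * s : ℝ) * I)) * I_sq
      rw [e2]
      linear_combination (r * exp ((Real.pi / 6 + p * s : ℝ) * I) - (r / 2 : ℝ) * (1 + I)) *
        (F * (starRingEnd ℂ) F) * conj_mul_self_of_norm (norm_quarterTurn j) +
        (r * exp ((Real.pi / 6 + p * s : ℝ) * I) - (r / 2 : ℝ) * (1 + I)) * mul_conj_self_of_norm hF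
    · rw [hpt, norm_neg, norm_mul, norm_mul, P.norm_tangent, norm_I, norm_real,
        Real.norm_of_nonneg hr.le]; ring
  refine eq_of_frontier_subset_convex hR.isCompact hR.closure_interior
    ⟨P.point 0 0, hR.isCompact.isClosed.frontier_subset
      (hR.point_mem_frontier ⟨le_rfl, (P.len_pos 0).le⟩)⟩ (convex_placedSquare hr.le O hF)
    (isClosed_placedSquare hr.le O hF) (fun w hw => (hfr w hw).1) ?_
  rw [Set.disjoint_right]
  intro w hw
  obtain ⟨j, hj⟩ := (hfr w hw).2
  exact notMem_interior_placedSquare hr O hF hj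

end CurvedPolygon

/-! ### Neighbouring tiles and first and second order contact -/

namespace PeriodicTwoTiling

variable {T : PeriodicTwoTiling}

theorem countable_lattice (T : PeriodicTwoTiling) : Countable T.lattice := by
  obtain ⟨g, g', h⟩ := T.isLattice
  exact h.countable

theorem volume_inter_vadd_eq_zero {R : Fin 2 → Set ℂ} (hTR : ∀ k, T.tile k =ᵐ[volume] R k)
    {k j : Fin 2} {g h : ℂ} (hg : g ∈ T.lattice) (hh : h ∈ T.lattice) (hne : (k, g) ≠ (j, h)) :
    volume ((g +ᵥ R k) ∩ (h +ᵥ R j)) = 0 := by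
  rw [← T.disjoint k j g hg h hh hne]
  exact measure_congr (ae_eq_set_inter ((vadd_set_ae_eq _).2 (hTR k).symm) ((vadd_set_ae_eq _).2 (hTR j).symm))

/-- Local finiteness by area: translates that come near `q` lie in a fixed disc, overlap in null
sets and have the same positive area. -/
theorem finite_setOf_vadd_inter {R : Fin 2 → Set ℂ} (hTR : ∀ k, T.tile k =ᵐ[volume] R k)
    (hRc : ∀ k, IsCompact (R k)) (hpos : ∀ k, 0 < volume (R k)) (k : Fin 2) (q : ℂ) :
    {h : T.lattice | (((h : ℂ) +ᵥ R k) ∩ Metric.closedBall q 1).Nonempty}.Finite := by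
  obtain ⟨M, hM⟩ := (hRc k).isBounded.exists_norm_le
  have hm : ∀ h : T.lattice, MeasurableSet (((h : ℂ) +ᵥ R k) ∩ Metric.closedBall q (1 + 2 * M)) :=
    fun h => ((hRc k).isClosed.vadd _).measurableSet.inter Metric.isClosed_closedBall.measurableSet
  have hfin := Measure.finite_const_le_meas_of_disjoint_iUnion₀ (μ := volume) (ε := volume (R k))
    (hpos k) (As := fun h : T.lattice => ((h : ℂ) +ᵥ R k) ∩ Metric.closedBall q (1 + 2 * M))
    (fun h => (hm h).nullMeasurableSet) (fun g h hne => by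
      refine measure_mono_null (inter_subset_inter inter_subset_left inter_subset_left) ?_
      exact volume_inter_vadd_eq_zero hTR g.2 h.2 fun e => hne (Subtype.ext (Prod.ext_iff.1 e).2))
    (ne_top_of_le_ne_top (isCompact_closedBall q (1 + 2 * M)).measure_lt_top.ne
      (measure_mono (iUnion_subset fun _ => inter_subset_right)))
  refine hfin.subset ?_
  rintro h ⟨_, ⟨a, ha, rfl⟩, hx⟩
  have hsub : ((h : ℂ) +ᵥ R k) ⊆ Metric.closedBall q (1 + 2 * M) := by
    rintro _ ⟨b, hb, rfl⟩
    have h1 : dist ((h : ℂ) + a) q ≤ 1 := hx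
    change dist ((h : ℂ) + b) q ≤ _
    refine (dist_triangle _ ((h : ℂ) + a) _).trans ?_
    have h2 : dist ((h : ℂ) + b) (h + a) ≤ M + M := by
      rw [dist_add_left, dist_eq_norm]
      exact (norm_sub_le _ _).trans (add_le_add (hM b hb) (hM a ha))
    linarith
  change volume (R k) ≤ volume (((h : ℂ) +ᵥ R k) ∩ _)
  rw [inter_eq_left.2 hsub, measure_vadd]

/-- A boundary point of a tile lies in another tile. -/
theorem exists_adjacent_tile {R : Fin 2 → Set ℂ} (hTR : ∀ k, T.tile k =ᵐ[volume] R k)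
    (hRc : ∀ k, IsCompact (R k)) (hpos : ∀ k, 0 < volume (R k)) {q : ℂ} {k₀ : Fin 2}
    (hq : q ∈ frontier (R k₀)) :
    ∃ k, ∃ h ∈ T.lattice, q ∈ h +ᵥ R k ∧ Disjoint (interior (R k₀)) (h +ᵥ interior (R k)) := by
  have := T.countable_lattice
  -- The tiles near `q` other than `R k₀` itself. They are finitely many, so their union is closed.
  let S : Fin 2 → Set T.lattice := fun k =>
    {h | (((h : ℂ) +ᵥ R k) ∩ Metric.closedBall q 1).Nonempty ∧ (k, (h : ℂ)) ≠ (k₀, 0)}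
  have hS : ∀ k, (S k).Finite := fun k =>
    (finite_setOf_vadd_inter hTR hRc hpos k q).subset fun h hh => hh.1
  let C : Set ℂ := ⋃ k, ⋃ h ∈ S k, (h : ℂ) +ᵥ R k
  have hC : IsClosed C := isClosed_iUnion_of_finite fun k =>
    (hS k).isClosed_biUnion fun h _ => (hRc k).isClosed.vadd _
  -- Otherwise a nonempty open set next to `q`, outside `R k₀`, would be left uncovered.
  have hqC : q ∈ C := by
    by_contra hqC
    obtain ⟨ε, hε, hball⟩ := Metric.isOpen_iff.1 hC.isOpen_compl q hqC
    set U := (Metric.ball q (min ε 1)) \ R k₀ with hU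
    have hUo : IsOpen U := Metric.isOpen_ball.sdiff (hRc k₀).isClosed
    have hqcl : q ∈ closure (R k₀)ᶜ := by
      rw [closure_compl]; exact hq.2
    have hUne : U.Nonempty := by
      obtain ⟨x, hx1, hx2⟩ := mem_closure_iff.1 hqcl (Metric.ball q (min ε 1)) Metric.isOpen_ball
        (Metric.mem_ball_self (by positivity))
      exact ⟨x, hx1, hx2⟩
    have hnull : volume (⋃ k, ⋃ g ∈ T.lattice, g +ᵥ R k)ᶜ = 0 := by
      rw [← T.cover]
      refine measure_congr (EventuallyEq.compl ?_)
      refine Filter.EventuallyEq.countable_iUnion fun k => ?_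
      rw [biUnion_vadd_eq_iUnion, biUnion_vadd_eq_iUnion]
      exact Filter.EventuallyEq.countable_iUnion fun g => (vadd_set_ae_eq _).2 (hTR k).symm
    have hUn : volume U = 0 := by
      refine measure_mono_null ?_ hnull
      rintro x ⟨hx1, hx2⟩ hx
      obtain ⟨k, hx⟩ := mem_iUnion.1 hx
      obtain ⟨h, hh, hx⟩ := mem_iUnion₂.1 hx
      rw [Metric.mem_ball, lt_min_iff] at hx1
      by_cases hne : (k, h) = (k₀, 0)
      · obtain ⟨rfl, rfl⟩ := Prod.mk.injEq .. ▸ hne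
        rw [zero_vadd] at hx
        exact hx2 hx
      · refine hball (Metric.mem_ball.2 hx1.1) (mem_iUnion.2 ⟨k, mem_iUnion₂.2 ⟨⟨h, hh⟩, ?_, hx⟩⟩)
        exact ⟨⟨x, hx, hx1.2.le⟩, hne⟩
    exact hUne.ne_empty ((hUo.measure_eq_zero_iff volume).1 hUn)
  obtain ⟨k, hk⟩ := mem_iUnion.1 hqC
  obtain ⟨h, hh, hqh⟩ := mem_iUnion₂.1 hk
  refine ⟨k, h, h.2, hqh, ?_⟩
  have hop : IsOpen (interior (R k₀) ∩ ((h : ℂ) +ᵥ interior (R k))) :=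
    isOpen_interior.inter (isOpen_interior.vadd _)
  rw [Set.disjoint_iff_inter_eq_empty, ← hop.measure_eq_zero_iff volume]
  have h0 := volume_inter_vadd_eq_zero hTR T.lattice.zero_mem h.2 hh.2.symm
  rw [zero_vadd] at h0
  exact measure_mono_null (inter_subset_inter interior_subset (vadd_set_mono interior_subset)) h0

end PeriodicTwoTiling

theorem exists_small_smul_mem {s : Set ℂ} (hs : s ∈ 𝓝 (0 : ℂ)) (f : ℝ → ℂ) (hf : Continuous f)
    (h0 : f 0 = 0) : ∃ ε > 0, ∀ t ∈ Ioo 0 ε, f t ∈ s := by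
  have : ∀ᶠ t in 𝓝[>] (0 : ℝ), f t ∈ s := by
    have h1 : Tendsto f (𝓝 0) (𝓝 0) := by simpa [h0] using hf.tendsto 0
    exact (h1.mono_left nhdsWithin_le_nhds).eventually hs
  obtain ⟨ε, hε, h⟩ := mem_nhdsGT_iff_exists_Ioo_subset.1 this
  exact ⟨ε, hε, fun t ht => h ht⟩

/-- Two curved half planes `⟪n, w⟫ > κ/2 |w|²` that do not meet near the origin lie on opposite
sides, and their curvatures are compatible. -/
theorem eq_neg_and_curv_of_disjoint {n n' : ℂ} (hn : ‖n‖ = 1) (hn' : ‖n'‖ = 1) {κ κ' : ℝ}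
    (h : ∀ᶠ w in 𝓝 (0 : ℂ), ¬ (0 < inner ℝ n w - κ / 2 * ‖w‖ ^ 2 ∧ 0 < inner ℝ n' w - κ' / 2 * ‖w‖ ^ 2)) :
    n' = -n ∧ 0 ≤ κ + κ' := by
  have hnn : inner ℝ n n = 1 := by rw [real_inner_self_eq_norm_sq, hn]; norm_num
  have hnn' : inner ℝ n' n' = 1 := by rw [real_inner_self_eq_norm_sq, hn']; norm_num
  have h1 : n' = -n := by
    by_contra hne
    -- If the normals are not opposite, `n + n'` points strictly into both half planes.
    have hpos : 0 < 1 + inner ℝ n n' := by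
      have h2 : 0 < ‖n + n'‖ ^ 2 := by
        have : n + n' ≠ 0 := fun h0 => hne (by linear_combination h0)
        have := norm_pos_iff.2 this
        positivity
      rw [← real_inner_self_eq_norm_sq, inner_add_left, inner_add_right, inner_add_right, hnn, hnn',
        real_inner_comm n n'] at h2
      have := real_inner_comm n n'
      linarith
    set a := 1 + inner ℝ n n' with ha
    set m := ‖n + n'‖ ^ 2 with hm
    obtain ⟨ε, hε, hsm⟩ := exists_small_smul_mem h (fun t : ℝ => t • (n + n')) (by fun_prop) (by simp)
    set b := (|κ| + |κ'|) / 2 * m with hb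
    have hb0 : 0 ≤ b := by positivity
    set t := min (ε / 2) (a / (2 * (b + 1))) with ht
    have ht0 : 0 < t := by positivity
    have hte : t < ε := (min_le_left _ _).trans_lt (by linarith)
    have hta : t * b < a := by
      have : t ≤ a / (2 * (b + 1)) := min_le_right _ _
      rw [le_div_iff₀ (by positivity)] at this
      nlinarith
    refine hsm t ⟨ht0, hte⟩ ?_
    have hns : ‖t • (n + n')‖ ^ 2 = t ^ 2 * m := by
      rw [norm_smul, mul_pow, Real.norm_eq_abs, sq_abs]
    have key : ∀ c : ℝ, |c| ≤ |κ| + |κ'| → c / 2 * (t ^ 2 * m) < t * a := by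
      intro c hc
      have hm0 : 0 ≤ m := by positivity
      have h5 : c / 2 * m ≤ b := by
        rw [hb]; exact mul_le_mul_of_nonneg_right (by linarith [le_abs_self c]) hm0
      have h6 : t * (c / 2 * m) ≤ t * b := mul_le_mul_of_nonneg_left h5 ht0.le
      nlinarith
    constructor
    · rw [hns, inner_smul_right, inner_add_right, hnn]
      have := key κ (by linarith [abs_nonneg κ'])
      linarith
    · rw [hns, inner_smul_right, inner_add_right, hnn', real_inner_comm n n']
      have := key κ' (by linarith [abs_nonneg κ])
      linarith
  refine ⟨h1, ?_⟩
  by_contra hneg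
  have hneg : κ + κ' < 0 := not_le.1 hneg
  subst h1
  -- The two boundaries leave the origin like the parabolas `κ / 2` and `-κ' / 2` over the common
  -- tangent. `β` is the mean of these coefficients, and `δ` is half the gap between them.
  set β := (κ - κ') / 4 with hβ
  obtain ⟨ε, hε, hsm⟩ := exists_small_smul_mem h (fun t : ℝ => t • (I * n) + (β * t ^ 2) • n)
    (by fun_prop) (by simp)
  set δ := -(κ + κ') / 4 with hδ
  have hδ0 : 0 < δ := by rw [hδ]; linarith
  set b := (|κ| + |κ'|) / 2 * β ^ 2 with hb
  have hb0 : 0 ≤ b := by positivity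
  set t := min (ε / 2) (min 1 (δ / (2 * (b + 1)))) with ht
  have ht0 : 0 < t := by positivity
  have ht1 : t ≤ 1 := (min_le_right _ _).trans (min_le_left _ _)
  have hte : t < ε := (min_le_left _ _).trans_lt (by linarith)
  have htb : t * b < δ := by
    have : t ≤ δ / (2 * (b + 1)) := (min_le_right _ _).trans (min_le_right _ _)
    rw [le_div_iff₀ (by positivity)] at this
    nlinarith
  have htb2 : t ^ 2 * b < δ := by nlinarith
  refine hsm t ⟨ht0, hte⟩ ?_
  have hi : inner ℝ n (I * n) = 0 := by
    simp [Complex.inner]; ring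
  have hi2 : inner ℝ (I * n) n = 0 := by rw [real_inner_comm, hi]
  have hin : ‖I * n‖ = 1 := by rw [norm_mul, norm_I, hn, one_mul]
  have hns : ‖t • (I * n) + (β * t ^ 2) • n‖ ^ 2 = t ^ 2 + β ^ 2 * t ^ 4 := by
    rw [norm_add_sq_real, inner_smul_left, inner_smul_right, hi2, norm_smul, norm_smul, hn, hin,
      Real.norm_eq_abs, Real.norm_eq_abs, mul_one, mul_one, sq_abs, sq_abs]
    simp; ring
  have hnw : inner ℝ n (t • (I * n) + (β * t ^ 2) • n) = β * t ^ 2 := by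
    rw [inner_add_right, inner_smul_right, inner_smul_right, hi, hnn]; ring
  have key : ∀ c : ℝ, |c| ≤ |κ| + |κ'| → c / 2 * (β ^ 2 * t ^ 4) < δ * t ^ 2 := by
    intro c hc
    have h5 : c / 2 * β ^ 2 ≤ b := by
      rw [hb]; exact mul_le_mul_of_nonneg_right (by linarith [le_abs_self c]) (sq_nonneg _)
    have h6 : t ^ 2 * (c / 2 * β ^ 2) ≤ t ^ 2 * b := mul_le_mul_of_nonneg_left h5 (sq_nonneg t)
    have h7 : t ^ 2 * (c / 2 * β ^ 2) < δ := h6.trans_lt htb2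
    have h8 : 0 < t ^ 2 := by positivity
    nlinarith
  constructor
  · rw [hns, hnw]
    have h5 := key κ (by linarith [abs_nonneg κ'])
    have : β * t ^ 2 = κ / 2 * t ^ 2 + δ * t ^ 2 := by rw [hβ, hδ]; ring
    linarith
  · rw [hns, inner_neg_left, hnw]
    have h5 := key κ' (by linarith [abs_nonneg κ])
    have : -(β * t ^ 2) = κ' / 2 * t ^ 2 + δ * t ^ 2 := by rw [hβ, hδ]; ring
    linarith

namespace CurvedPolygon

/-- Along a common boundary point of two regions with disjoint interiors, the tangents are opposite
and the curvatures are compatible. -/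
theorem Encloses.tangent_eq_neg {m n : ℕ} [NeZero m] [NeZero n] {P : CurvedPolygon m}
    {Q : CurvedPolygon n} {R S : Set ℂ} (hR : P.Encloses R) (hS : Q.Encloses S) {h : ℂ}
    (hd : Disjoint (interior S) (h +ᵥ interior R)) {i : Fin n} {j : Fin m} {s t : ℝ}
    (hs : s ∈ Ioo 0 (Q.len i)) (ht : t ∈ Ioo 0 (P.len j)) (he : Q.point i s = h + P.point j t) :
    P.tangent j t = -Q.tangent i s ∧ 0 ≤ Q.curv i + P.curv j := by
  have hI : ∀ {z : ℂ}, ‖z‖ = 1 → ‖I * z‖ = 1 := fun hz => by rw [norm_mul, norm_I, hz, one_mul]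
  have := eq_neg_and_curv_of_disjoint (hI (Q.norm_tangent i s)) (hI (P.norm_tangent j t))
    (κ := Q.curv i) (κ' := P.curv j) (by
      filter_upwards [hR.eventually_mem_interior_iff ht, hS.eventually_mem_interior_iff hs] with w h1 h2
      rintro ⟨h3, h4⟩
      refine Set.disjoint_left.1 hd (h2.1 h3) ⟨_, h1.1 h4, ?_⟩
      change h + (P.point j t + w) = _
      rw [he]; ring)
  refine ⟨?_, this.2⟩
  have h2 := congrArg (fun z => -I * z) this.1
  linear_combination h2 + (Q.tangent i s + P.tangent j t) * I_sq

end CurvedPolygon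

theorem quarterTurn_pow_four (j : Fin 4) : quarterTurn j ^ 4 = 1 := by
  fin_cases j <;> simp [quarterTurn, Even.neg_pow (by decide : Even 4)]

/-- The fourth power absorbs an unknown quarter turn, and angles in an interval shorter than `π / 2`
are still determined by it. -/
theorem eq_of_exp_four_mul_eq {a b : ℝ} (ha : a ∈ Ioo 0 (Real.pi / 3)) (hb : b ∈ Ioo 0 (Real.pi / 3))
    (h : exp ((a : ℝ) * I) ^ 4 = exp ((b : ℝ) * I) ^ 4) : a = b := by
  have hpi := Real.pi_pos
  have h1 : exp ((4 * (a - b) : ℝ) * I) = 1 := by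
    rw [← Complex.exp_nat_mul, ← Complex.exp_nat_mul] at h
    rw [show ((4 * (a - b) : ℝ) : ℂ) * I = (4 : ℕ) * (a * I) - (4 : ℕ) * (b * I) by push_cast; ring,
      Complex.exp_sub, h, div_self (Complex.exp_ne_zero _)]
  obtain ⟨k, hk⟩ := (exp_two_pi_sub _).1 h1
  have k0 : -1 < k := by
    by_contra hcon
    have : (k : ℝ) ≤ -1 := by exact_mod_cast not_lt.1 hcon
    nlinarith [ha.1, ha.2, hb.1, hb.2]
  have k1 : k < 1 := by
    by_contra hcon
    have : (1 : ℝ) ≤ k := by exact_mod_cast not_lt.1 hcon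
    nlinarith [ha.1, ha.2, hb.1, hb.2]
  have : k = 0 := by omega
  rw [this] at hk
  simp at hk
  linarith

/-! ### Concave edges of the octagon face arcs of the first tile -/

section Matching

variable {T : PeriodicTwoTiling} {p : ℝ} {P : CurvedPolygon 4} {Q : CurvedPolygon 8} {R R' : Set ℂ}

/-- Almost every point of a concave edge of the second tile lies in the interior of an edge of a
translate of the first tile. -/
theorem exists_matching_point (hnd : T.NonDegenerate) (hp : 0 < p)
    (hR : P.Encloses R) (hTR : T.tile 0 =ᵐ[volume] R)
    (hκ' : ∀ i : Fin 8, Q.curv i = if Even (i : ℕ) then 0 else -p)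
    (hR' : Q.Encloses R') (hTR' : T.tile 1 =ᵐ[volume] R') {i : Fin 8} (hi : ¬ Even (i : ℕ))
    {a b : ℝ} (ha : 0 ≤ a) (hab : a < b) (hb : b ≤ Q.len i) :
    ∃ s ∈ Ioo a b, ∃ j, ∃ t ∈ Ioo 0 (P.len j), ∃ h ∈ T.lattice, Q.point i s = h + P.point j t ∧
      P.tangent j t = -Q.tangent i s := by
  have := T.countable_lattice
  -- All translates of all vertices: a countable set, which is avoided so that the contact takes
  -- place inside edges.
  let V : Set ℂ := range fun x : T.lattice × (Fin 4 ⊕ Fin 8) => (x.1 : ℂ) + Sum.elim P.vertex Q.vertex x.2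
  have hB : {s | s ∈ Ioo 0 (Q.len i) ∧ Q.point i s ∈ V}.Countable := by
    refine MapsTo.countable_of_injOn (f := Q.point i) (t := V) (fun s hs => hs.2) ?_ (countable_range _)
    intro s hs t ht hst
    exact (Q.eq_of_point_eq hs.1 ⟨ht.1.1.le, ht.1.2.le⟩ hst).2
  obtain ⟨s, hs, hsB⟩ : ∃ s ∈ Ioo a b, s ∉ {s | s ∈ Ioo 0 (Q.len i) ∧ Q.point i s ∈ V} := by
    obtain ⟨s, h1, h2⟩ := (hB.dense_compl ℝ).exists_mem_open isOpen_Ioo (nonempty_Ioo.2 hab)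
    exact ⟨s, h2, h1⟩
  have hs' : s ∈ Ioo 0 (Q.len i) := ⟨ha.trans_lt hs.1, hs.2.trans_le hb⟩
  have hsV : Q.point i s ∉ V := fun h => hsB ⟨hs', h⟩
  have hTRk : ∀ k, T.tile k =ᵐ[volume] (![R, R'] k : Set ℂ) := Fin.forall_fin_two.2 ⟨hTR, hTR'⟩
  have hRc : ∀ k, IsCompact (![R, R'] k) := Fin.forall_fin_two.2 ⟨hR.isCompact, hR'.isCompact⟩
  have hpos : ∀ k, 0 < volume (![R, R'] k) := fun k => by
    rw [← measure_congr (hTRk k)]; exact hnd k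
  obtain ⟨k, h, hh, hq, hd⟩ := PeriodicTwoTiling.exists_adjacent_tile hTRk hRc hpos (k₀ := 1)
    (hR'.point_mem_frontier (i := i) ⟨hs'.1.le, hs'.2.le⟩)
  change Disjoint (interior R') _ at hd
  have hqcl : Q.point i s ∈ closure (interior R') := by
    rw [hR'.closure_interior]
    exact hR'.isCompact.isClosed.frontier_subset (hR'.point_mem_frontier ⟨hs'.1.le, hs'.2.le⟩)
  -- The point is a limit of interior points of `R'`, and these avoid the open interior of the
  -- neighbour; so it is a boundary point of the neighbour as well.
  have hni : Q.point i s ∉ h +ᵥ interior (![R, R'] k) := fun hmem =>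
    Set.disjoint_left.1 (hd.closure_left (isOpen_interior.vadd h)) hqcl hmem
  obtain ⟨y, hy, hyq⟩ := hq
  change h + y = _ at hyq
  have hyi : y ∉ interior (![R, R'] k) := fun hmem => hni ⟨y, hmem, hyq⟩
  have hyf : y ∈ frontier (![R, R'] k) := ⟨subset_closure hy, hyi⟩
  have hneg : Q.curv i = -p := by rw [hκ', if_neg hi]
  have hvert : ∀ {n : ℕ} [NeZero n] (S : CurvedPolygon n) (j : Fin n) (t : ℝ),
      (∀ j, h + S.vertex j ∈ V) → t ∈ Icc 0 (S.len j) → y = S.point j t → t ∈ Ioo 0 (S.len j) := by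
    intro n _ S j t hV ht hyt
    refine ⟨lt_of_le_of_ne ht.1 fun h0 => ?_, lt_of_le_of_ne ht.2 fun h1 => ?_⟩
    · refine hsV ?_
      rw [← hyq, hyt, ← h0, S.point_zero]; exact hV _
    · refine hsV ?_
      rw [← hyq, hyt, h1, S.point_len]; exact hV _
  revert hyf hd
  refine Fin.cases ?_ (fun k => ?_) k
  · intro hd hyf
    change y ∈ frontier R at hyf
    rw [hR.frontier_eq] at hyf
    obtain ⟨j, t, ht, hyt⟩ := mem_iUnion.1 hyf
    have ht' := hvert P j t (fun j => ⟨(⟨h, hh⟩, Sum.inl j), rfl⟩) ht hyt.symm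
    have he : Q.point i s = h + P.point j t := by rw [← hyq, ← hyt]; rfl
    exact ⟨s, hs, j, t, ht', h, hh, he, (hR.tangent_eq_neg hR' hd hs' ht' he).1⟩
  · intro hd hyf
    obtain rfl : k = 0 := Subsingleton.elim _ _
    change y ∈ frontier R' at hyf
    rw [hR'.frontier_eq] at hyf
    obtain ⟨j, t, ht, hyt⟩ := mem_iUnion.1 hyf
    have ht' := hvert Q j t (fun j => ⟨(⟨h, hh⟩, Sum.inr j), rfl⟩) ht hyt.symm
    have he : Q.point i s = h + Q.point j t := by rw [← hyq, ← hyt]; rfl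
    -- A translate of the octagon cannot be the neighbour: its edges have curvature `0` or `-p`, and
    -- adding `-p` gives a negative sum.
    have h1 := (hR'.tangent_eq_neg hR' hd hs' ht' he).2
    rw [hneg, hκ'] at h1
    split_ifs at h1 <;> linarith

/-- The concave edges of the second tile match whole edges of translates of the first one. -/
theorem exists_matching_edge (hnd : T.NonDegenerate) (hp : 0 < p) (hκ : ∀ i, P.curv i = p)
    (hθ : ∀ i, p * P.len i = Real.pi / 6) {D : ℂ} (hdir : ∀ j, P.dir j = quarterTurn j * D)
    (hR : P.Encloses R) (hTR : T.tile 0 =ᵐ[volume] R)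
    (hκ' : ∀ i : Fin 8, Q.curv i = if Even (i : ℕ) then 0 else -p)
    (hR' : Q.Encloses R') (hTR' : T.tile 1 =ᵐ[volume] R') {i : Fin 8} (hi : ¬ Even (i : ℕ))
    (hθ' : p * Q.len i = Real.pi / 6) :
    ∃ j, Q.center i - P.center j ∈ T.lattice ∧ -Q.dir i = P.dir j * exp ((Real.pi / 6 : ℝ) * I) := by
  have hpi := Real.pi_pos
  have hneg : Q.curv i = -p := by rw [hκ', if_neg hi]
  -- The contact determines `α = p (s + t)`, the angle between the initial directions of the facing
  -- arcs up to sign. As `0 < p t < π / 6`, it confines `p s` to a window of length `π / 6`.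
  have key : ∀ {a b : ℝ}, 0 ≤ a → a < b → b ≤ Q.len i → ∃ s ∈ Ioo a b, ∃ α : ℝ,
      α ∈ Ioo (p * s) (p * s + Real.pi / 6) ∧ α ∈ Ioo 0 (Real.pi / 3) ∧
      ∃ j, Q.center i - P.center j ∈ T.lattice ∧ -Q.dir i = P.dir j * exp ((α : ℝ) * I) := by
    intro a b ha hab hb
    obtain ⟨s, hs, j, t, ht, h, hh, he, htan⟩ :=
      exists_matching_point hnd hp hR hTR hκ' hR' hTR' hi ha hab hb
    have ht1 : p * t < Real.pi / 6 := by rw [← hθ j]; exact mul_lt_mul_of_pos_left ht.2 hp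
    have ht0 : 0 < p * t := mul_pos hp ht.1
    have hs1 : p * s < Real.pi / 6 := by
      rw [← hθ']; exact mul_lt_mul_of_pos_left (hs.2.trans_le hb) hp
    have hs0 : 0 < p * s := mul_pos hp (ha.trans_lt hs.1)
    refine ⟨s, hs, p * s + p * t, ⟨by linarith, by linarith⟩, ⟨by linarith, by linarith⟩, j, ?_, ?_⟩
    · have e1 := Q.point_eq_center_sub (i := i) (by rw [hneg]; linarith) s
      have e2 := P.point_eq_center_sub (i := j) (by rw [hκ]; exact hp.ne') t
      rw [hneg] at e1
      rw [hκ, htan] at e2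
      rw [e1, e2] at he
      have : Q.center i - P.center j = h := by
        push_cast at he
        rw [div_neg] at he
        linear_combination he
      rw [this]; exact hh
    · have e1 : P.dir j * exp ((p * t : ℝ) * I) = -(Q.dir i * exp ((-p * s : ℝ) * I)) := by
        have := htan
        rw [CurvedPolygon.tangent, CurvedPolygon.tangent, arcTangent, arcTangent, hκ, hneg] at this
        exact this
      have e2 : exp ((-p * s : ℝ) * I) * exp ((p * s : ℝ) * I) = 1 := by
        rw [← Complex.exp_add, ← add_mul, ← ofReal_add]; simp
      rw [ofReal_add, add_mul, Complex.exp_add]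
      linear_combination (-exp ((p * s : ℝ) * I)) * e1 + Q.dir i * e2
  obtain ⟨s₀, hs₀, α, h1, h2, j, hj, hdj⟩ := key le_rfl (Q.len_pos i) le_rfl
  -- The angle is the same at every contact point of the edge, since the arcs of the first tile
  -- start in directions that differ by quarter turns.
  have huniq : ∀ {β : ℝ} {j' : Fin 4}, β ∈ Ioo 0 (Real.pi / 3) →
      -Q.dir i = P.dir j' * exp ((β : ℝ) * I) → α = β := by
    intro β j' hβ hj'
    refine eq_of_exp_four_mul_eq h2 hβ ?_
    have hD : D ≠ 0 := by
      have := P.norm_dir 0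
      rw [hdir, norm_mul, norm_quarterTurn, one_mul] at this
      rw [← norm_ne_zero_iff, this]; exact one_ne_zero
    have h3 := hdj.symm.trans hj'
    rw [hdir, hdir] at h3
    have h4 := congrArg (fun z => z ^ 4) h3
    simp only [mul_pow, quarterTurn_pow_four, one_mul] at h4
    exact mul_left_cancel₀ (pow_ne_zero 4 hD) h4
  -- If `α < π / 6`, a contact point close to the end of the edge violates `p s < α`; if `α > π /
  -- 6`, one close to the start violates `α < p s + π / 6`.
  have hα : α = Real.pi / 6 := by
    rcases lt_trichotomy α (Real.pi / 6) with hlt | heq | hgt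
    · exfalso
      have hlt' : α / p < Q.len i := by rw [div_lt_iff₀ hp]; linarith
      obtain ⟨s, hs, β, b1, b2, j', -, hj'⟩ := key (div_nonneg h2.1.le hp.le) hlt' le_rfl
      have := huniq b2 hj'
      have h5 := hs.1
      rw [div_lt_iff₀ hp] at h5
      linarith [b1.1]
    · exact heq
    · exfalso
      have hpos : 0 < min (Q.len i) ((α - Real.pi / 6) / p) :=
        lt_min (Q.len_pos i) (div_pos (by linarith) hp)
      obtain ⟨s, hs, β, b1, b2, j', -, hj'⟩ := key le_rfl hpos (min_le_left _ _)
      have := huniq b2 hj'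
      have h5 := hs.2.trans_le (min_le_right _ _)
      rw [lt_div_iff₀ hp] at h5
      linarith [b1.2]
  exact ⟨j, hj, hα ▸ hdj⟩

end Matching

/-! ### Identification of the lattice and of the second tile -/

theorem volume_parallelogram_square (z : ℂ) {g : ℂ} (hg : g ≠ 0) :
    volume (parallelogram z g (I * g)) = ENNReal.ofReal (‖g‖ ^ 2) := by
  have hn : 0 < ‖g‖ := norm_pos_iff.2 hg
  have hn' : (‖g‖ : ℂ) ≠ 0 := by exact_mod_cast hn.ne'
  have hu : ‖(starRingEnd ℂ) g / ‖g‖‖ = 1 := by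
    rw [norm_div, RCLike.norm_conj, norm_real, norm_norm, div_self hn.ne']
  rw [← volume_closedSquare hn.le, ← (measurePreserving_mul_sub hu z).measure_preimage_emb
    (measurableEmbedding_mul_sub hu z) (closedSquare ‖g‖)]
  congr 1
  ext w
  have e : (starRingEnd ℂ) g / ‖g‖ * (w - z) = (‖g‖ : ℂ) * ((w - z) / g) := by
    have h1 : (starRingEnd ℂ) g * g = (‖g‖ : ℂ) ^ 2 := Complex.conj_mul' g
    field_simp
    linear_combination (w - z) * h1
  rw [mem_parallelogram_square hg, mem_preimage, e, closedSquare, mem_reProdIm, re_ofReal_mul,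
    im_ofReal_mul]
  simp only [mem_Icc, mul_nonneg_iff_of_pos_left hn, mul_le_iff_le_one_right hn]

namespace PeriodicTwoTiling

/-- A square sublattice of the right covolume is the whole lattice of the tiling. -/
theorem lattice_eq_squareLattice {T : PeriodicTwoTiling} (hnd : T.NonDegenerate) {g : ℂ} (hg : g ≠ 0)
    (hle : squareLattice g ≤ T.lattice)
    (hvol : volume (T.tile 0) + volume (T.tile 1) = ENNReal.ofReal (‖g‖ ^ 2)) :
    T.lattice = squareLattice g := by
  refine le_antisymm (fun x hx => ?_) hle
  by_contra hxH
  have hcount : Countable (squareLattice g) := (isLatticeBasis_squareLattice hg).countable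
  -- With an extra lattice vector `x`, the tiles `E₁`, `E₂` and `x + E₁` would have disjoint
  -- translates under the sublattice, although their total area exceeds that of its fundamental
  -- domain.
  let kk : Fin 3 → Fin 2 := ![0, 1, 0]
  let xx : Fin 3 → ℂ := ![0, 0, x]
  have hxx : ∀ a, xx a ∈ T.lattice := by
    intro a; fin_cases a
    · exact T.lattice.zero_mem
    · exact T.lattice.zero_mem
    · exact hx
  let S : Set ℂ := ⋃ a, xx a +ᵥ T.tile (kk a)
  have hSm : ∀ a, NullMeasurableSet (xx a +ᵥ T.tile (kk a)) volume := fun a =>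
    nullMeasurableSet_vadd (T.measurable _) _
  have hne : ∀ h ∈ squareLattice g, ∀ h' ∈ squareLattice g, ∀ a b, (h ≠ h' ∨ a ≠ b) →
      volume ((h +ᵥ (xx a +ᵥ T.tile (kk a))) ∩ (h' +ᵥ (xx b +ᵥ T.tile (kk b)))) = 0 := by
    intro h hh h' hh' a b hab
    rw [vadd_vadd, vadd_vadd]
    refine T.disjoint _ _ _ (T.lattice.add_mem (hle hh) (hxx a)) _
      (T.lattice.add_mem (hle hh') (hxx b)) fun he => ?_
    rw [Prod.mk.injEq] at he
    obtain ⟨h1, h2⟩ := he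
    have hx1 : h + x ≠ h' := fun e => hxH (by
      have := (squareLattice g).sub_mem hh' hh
      rwa [← e, add_sub_cancel_left] at this)
    have hx2 : h ≠ h' + x := fun e => hxH (by
      have := (squareLattice g).sub_mem hh hh'
      rwa [e, add_sub_cancel_left] at this)
    fin_cases a <;> fin_cases b <;> simp [kk, xx] at h1 h2 hab <;>
      first | exact hab h2 | exact hx1 h2 | exact hx2 h2
  have hmeas : NullMeasurableSet S volume := .iUnion hSm
  have hmle := (isAddFundamentalDomain_squareLattice hg 0).measure_le_of_pairwise_disjoint hmeas (by
    rintro ⟨h, hh⟩ ⟨h', hh'⟩ hhh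
    refine measure_mono_null (inter_subset_inter inter_subset_left inter_subset_left) ?_
    change volume ((h +ᵥ S) ∩ (h' +ᵥ S)) = 0
    rw [vadd_set_iUnion, vadd_set_iUnion, iUnion_inter_iUnion]
    refine measure_iUnion_null fun a => measure_iUnion_null fun b => ?_
    exact hne h hh h' hh' a b (Or.inl fun e => hhh (Subtype.ext e)))
  have hSv : volume S = volume (T.tile 0) + volume (T.tile 1) + volume (T.tile 0) := by
    rw [measure_iUnion₀ _ hSm, tsum_fintype, Fin.sum_univ_three]
    · simp only [measure_vadd]; rfl
    · intro a b hab
      have := hne 0 (zero_mem _) 0 (zero_mem _) a b (Or.inr hab)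
      rwa [zero_vadd, zero_vadd] at this
  rw [volume_parallelogram_square 0 hg, hSv, hvol] at hmle
  have h1 : ENNReal.ofReal (‖g‖ ^ 2) < ENNReal.ofReal (‖g‖ ^ 2) + volume (T.tile 0) :=
    ENNReal.lt_add_right ENNReal.ofReal_ne_top (hnd 0).ne'
  exact absurd hmle (not_le.2 h1)

/-- The second tile, if it is contained in a fundamental domain, is the part of it not covered by
the translates of the first one. -/
theorem tile_one_eq_sdiff {T : PeriodicTwoTiling} {D : Set ℂ}
    (hD : IsAddFundamentalDomain T.lattice D volume) (hsub : T.tile 1 ≤ᵐ[volume] D)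
    (hDfin : volume D ≠ ∞) (hvol : volume (T.tile 0) + volume (T.tile 1) = volume D) :
    T.tile 1 =ᵐ[volume] (D \ ⋃ h ∈ T.lattice, h +ᵥ T.tile 0 : Set ℂ) := by
  have := T.countable_lattice
  have hdisj : ∀ g ∈ T.lattice, ∀ h ∈ T.lattice, g ≠ h →
      volume ((g +ᵥ T.tile 0) ∩ (h +ᵥ T.tile 0)) = 0 := fun g hg h hh hne =>
    T.disjoint 0 0 g hg h hh fun e => hne (Prod.ext_iff.1 e).2
  have hu : NullMeasurableSet (⋃ h ∈ T.lattice, h +ᵥ T.tile 0) volume := by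
    rw [biUnion_vadd_eq_iUnion]
    exact .iUnion fun h => nullMeasurableSet_vadd (T.measurable 0) _
  have h1 := measure_inter_add_sdiff₀ D hu
  rw [volume_inter_biUnion_vadd hD (T.measurable 0) hdisj, ← hvol] at h1
  have hfin0 : volume (T.tile 0) ≠ ∞ := ne_top_of_le_ne_top hDfin (hvol ▸ le_self_add)
  -- The complement in `D` has the area of the second tile, so an inclusion up to null sets is
  -- enough.
  have h2 := (ENNReal.add_right_inj hfin0).1 h1
  have hae : T.tile 1 ≤ᵐ[volume] (D \ ⋃ h ∈ T.lattice, h +ᵥ T.tile 0 : Set ℂ) := by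
    have h3 : ∀ᵐ w : ℂ, w ∈ T.tile 1 → w ∉ ⋃ h ∈ T.lattice, h +ᵥ T.tile 0 := by
      have h4 : volume (T.tile 1 ∩ ⋃ h ∈ T.lattice, h +ᵥ T.tile 0) = 0 := by
        rw [biUnion_vadd_eq_iUnion, inter_iUnion]
        refine measure_iUnion_null fun h => ?_
        have := T.disjoint 1 0 0 T.lattice.zero_mem h h.2 (by simp)
        rwa [zero_vadd] at this
      rw [ae_iff]
      convert h4 using 2
      ext w; simp
    filter_upwards [hsub, h3] with w hw1 hw2 hw
    exact ⟨hw1 hw, hw2 hw⟩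
  exact ae_eq_of_ae_subset_of_measure_ge hae h2.le (T.measurable 1)
    (by rw [h2]; exact ne_top_of_le_ne_top hDfin (hvol ▸ le_add_self))

end PeriodicTwoTiling

/-! ### Coordinates of the extremal octagon -/

/-- The indices of the concave edges. -/
def concaveIndex : Fin 4 → Fin 8 := ![1, 3, 5, 7]

theorem not_even_concaveIndex (m : Fin 4) : ¬ Even (concaveIndex m : ℕ) := by
  fin_cases m <;> decide

theorem even_concaveIndex_succ (m : Fin 4) : Even ((concaveIndex m + 1 : Fin 8) : ℕ) := by
  fin_cases m <;> decide

theorem concaveIndex_succ (m : Fin 4) : concaveIndex (m + 1) = concaveIndex m + 2 := by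
  fin_cases m <;> decide

theorem exists_eq_concaveIndex (i : Fin 8) :
    ∃ m, i = concaveIndex m ∨ i = concaveIndex m + 1 := by
  revert i; decide

section Octagon

variable {p : ℝ} {Q : CurvedPolygon 8}

theorem octagon_dir_succ_odd (hκ : ∀ i : Fin 8, Q.curv i = if Even (i : ℕ) then 0 else -p)
    (hθ : ∀ i : Fin 8, ¬ Even (i : ℕ) → p * Q.len i = Real.pi / 6) {i : Fin 8} (hi : ¬ Even (i : ℕ)) :
    Q.dir (i + 1) = Q.dir i * exp ((Real.pi / 6 : ℝ) * I) := by
  rw [Q.dir_succ, hκ, if_neg hi, neg_mul, hθ i hi]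
  congr 4; ring

theorem octagon_dir_succ_even (hκ : ∀ i : Fin 8, Q.curv i = if Even (i : ℕ) then 0 else -p)
    {i : Fin 8} (hi : Even (i : ℕ)) : Q.dir (i + 1) = Q.dir i * exp ((Real.pi / 3 : ℝ) * I) := by
  rw [Q.dir_succ, hκ, if_pos hi, zero_mul, zero_add]

theorem octagon_dir_add_two (hκ : ∀ i : Fin 8, Q.curv i = if Even (i : ℕ) then 0 else -p)
    (hθ : ∀ i : Fin 8, ¬ Even (i : ℕ) → p * Q.len i = Real.pi / 6) (i : Fin 8) :
    Q.dir (i + 2) = I * Q.dir i := by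
  have h2 : i + 2 = i + 1 + 1 := by rw [add_assoc]; rfl
  have e : exp ((Real.pi / 3 : ℝ) * I) * exp ((Real.pi / 6 : ℝ) * I) = I := by
    rw [← Complex.exp_add, ← add_mul, ← ofReal_add,
      show Real.pi / 3 + Real.pi / 6 = Real.pi / 2 by ring, exp_pi_div_two_real]
  by_cases hi : Even (i : ℕ)
  · have hi1 : ¬ Even ((i + 1 : Fin 8) : ℕ) := by revert hi; revert i; decide
    rw [h2, octagon_dir_succ_odd hκ hθ hi1, octagon_dir_succ_even hκ hi, mul_assoc, e, mul_comm]
  · have hi1 : Even ((i + 1 : Fin 8) : ℕ) := by revert hi; revert i; decide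
    rw [h2, octagon_dir_succ_even hκ hi1, octagon_dir_succ_odd hκ hθ hi, mul_assoc,
      mul_comm (exp _), e, mul_comm]

/-- The corner cut off by the `m`-th concave edge. -/
noncomputable def cutCorner (Q : CurvedPolygon 8) (r : ℝ) (m : Fin 4) : ℂ :=
  Q.center (concaveIndex m) + (r / 2 : ℝ) * ((1 + I) * Q.dir (concaveIndex m + 1))

/-- In the frame at the cut corner, a concave edge is the arc of a corner piece run through
clockwise, from angle `π / 3` down to `π / 6`. -/
theorem octagon_point_concave (hp : 0 < p)
    (hκ : ∀ i : Fin 8, Q.curv i = if Even (i : ℕ) then 0 else -p)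
    (hθ : ∀ i : Fin 8, ¬ Even (i : ℕ) → p * Q.len i = Real.pi / 6) (m : Fin 4) (s : ℝ) :
    Q.point (concaveIndex m) s = cutCorner Q p⁻¹ m + Q.dir (concaveIndex m + 1) *
      ((p⁻¹ : ℝ) * exp ((Real.pi / 3 - p * s : ℝ) * I) - (p⁻¹ / 2 : ℝ) * (1 + I)) := by
  have hi := not_even_concaveIndex m
  have hneg : Q.curv (concaveIndex m) = -p := by rw [hκ, if_neg hi]
  have e : exp ((Real.pi / 6 : ℝ) * I) * exp ((Real.pi / 3 - p * s : ℝ) * I) =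
      I * exp ((-p * s : ℝ) * I) := by
    rw [← exp_add_pi_div_two_mul_I, ← Complex.exp_add, ← add_mul, ← ofReal_add]
    congr 3; ring
  rw [Q.point_eq_center_sub (by rw [hneg]; linarith), hneg, cutCorner, octagon_dir_succ_odd hκ hθ hi,
    CurvedPolygon.tangent, arcTangent, hneg]
  push_cast at e ⊢
  rw [div_neg, div_eq_mul_inv]
  linear_combination (-(Q.dir (concaveIndex m) * (p : ℂ)⁻¹)) * e

theorem octagon_point_flat (hp : 0 < p)
    (hκ : ∀ i : Fin 8, Q.curv i = if Even (i : ℕ) then 0 else -p)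
    (hθ : ∀ i : Fin 8, ¬ Even (i : ℕ) → p * Q.len i = Real.pi / 6) (m : Fin 4) (s : ℝ) :
    Q.point (concaveIndex m + 1) s = cutCorner Q p⁻¹ m + Q.dir (concaveIndex m + 1) *
      (halfSide p⁻¹ + s : ℝ) := by
  have h0 : Q.curv (concaveIndex m + 1) = 0 := by rw [hκ, if_pos (even_concaveIndex_succ m)]
  have h1 := octagon_point_concave hp hκ hθ m (Q.len (concaveIndex m))
  rw [Q.point_len, hθ _ (not_even_concaveIndex m), show Real.pi / 3 - Real.pi / 6 = Real.pi / 6 by ring,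
    exp_pi_div_six] at h1
  rw [CurvedPolygon.point, h0, arcPoint_flat, h1, halfSide]
  push_cast; ring

/-- A side of the completed square is a flat edge and one `halfSide` at each end, which explains the
term `(√3 - 1) * p⁻¹`. -/
theorem cutCorner_succ (hp : 0 < p)
    (hκ : ∀ i : Fin 8, Q.curv i = if Even (i : ℕ) then 0 else -p)
    (hθ : ∀ i : Fin 8, ¬ Even (i : ℕ) → p * Q.len i = Real.pi / 6)
    (hℓ : ∀ i : Fin 8, Even (i : ℕ) → Q.len i = Q.len 0) (m : Fin 4) :
    cutCorner Q p⁻¹ (m + 1) = cutCorner Q p⁻¹ m + Q.dir (concaveIndex m + 1) *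
      (Q.len 0 + (√3 - 1) * p⁻¹ : ℝ) := by
  have h1 := octagon_point_flat hp hκ hθ m (Q.len 0)
  have h2 := octagon_point_concave hp hκ hθ (m + 1) 0
  have hidx : concaveIndex m + 1 + 1 = concaveIndex (m + 1) := by
    rw [concaveIndex_succ, add_assoc]; rfl
  have hd : Q.dir (concaveIndex (m + 1) + 1) = I * Q.dir (concaveIndex m + 1) := by
    rw [concaveIndex_succ, add_right_comm, octagon_dir_add_two hκ hθ]
  rw [← hℓ _ (even_concaveIndex_succ m), Q.point_len, hidx, hℓ _ (even_concaveIndex_succ m)] at h1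
  rw [Q.point_zero, h1, hd, mul_zero, sub_zero, exp_pi_div_three, halfSide] at h2
  push_cast at h2 ⊢
  linear_combination -h2 + (Q.dir (concaveIndex m + 1) * (p : ℂ)⁻¹ * (-√3 / 2 + 1 / 2)) * I_sq

theorem cutCorner_eq (hp : 0 < p)
    (hκ : ∀ i : Fin 8, Q.curv i = if Even (i : ℕ) then 0 else -p)
    (hθ : ∀ i : Fin 8, ¬ Even (i : ℕ) → p * Q.len i = Real.pi / 6)
    (hℓ : ∀ i : Fin 8, Even (i : ℕ) → Q.len i = Q.len 0) (m : Fin 4) :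
    Q.dir (concaveIndex m + 1) = Q.dir 2 * quarterTurn m ∧
    cutCorner Q p⁻¹ m = cutCorner Q p⁻¹ 0 +
      Q.dir 2 * squareCorner (Q.len 0 + (√3 - 1) * p⁻¹) m := by
  have hstep : ∀ m, (Q.dir (concaveIndex m + 1) = Q.dir 2 * quarterTurn m ∧
      cutCorner Q p⁻¹ m = cutCorner Q p⁻¹ 0 +
        Q.dir 2 * squareCorner (Q.len 0 + (√3 - 1) * p⁻¹) m) →
      (Q.dir (concaveIndex (m + 1) + 1) = Q.dir 2 * quarterTurn (m + 1) ∧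
      cutCorner Q p⁻¹ (m + 1) = cutCorner Q p⁻¹ 0 +
        Q.dir 2 * squareCorner (Q.len 0 + (√3 - 1) * p⁻¹) (m + 1)) := by
    rintro m ⟨h1, h2⟩
    refine ⟨?_, ?_⟩
    · rw [concaveIndex_succ, add_right_comm, octagon_dir_add_two hκ hθ, h1, ← I_mul_quarterTurn]
      ring
    · rw [cutCorner_succ hp hκ hθ hℓ, h2, squareCorner_succ, h1]; ring
  have h0 : Q.dir (concaveIndex 0 + 1) = Q.dir 2 * quarterTurn 0 ∧
      cutCorner Q p⁻¹ 0 = cutCorner Q p⁻¹ 0 +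
        Q.dir 2 * squareCorner (Q.len 0 + (√3 - 1) * p⁻¹) 0 := by
    refine ⟨?_, by simp [squareCorner]⟩
    simp [quarterTurn]; rfl
  have h1 := hstep 0 h0
  have h2 := hstep 1 h1
  have h3 := hstep 2 h2
  fin_cases m
  · exact h0
  · exact h1
  · exact h2
  · exact h3

/-- The octagon is contained in the square whose corners it lacks. -/
theorem octagon_subset_parallelogram (hp : 0 < p)
    (hκ : ∀ i : Fin 8, Q.curv i = if Even (i : ℕ) then 0 else -p)
    (hθ : ∀ i : Fin 8, ¬ Even (i : ℕ) → p * Q.len i = Real.pi / 6)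
    (hℓ : ∀ i : Fin 8, Even (i : ℕ) → Q.len i = Q.len 0) {R : Set ℂ} (hR : Q.Encloses R) {g : ℂ}
    (hg : g = Q.dir 2 * (Q.len 0 + (√3 - 1) * p⁻¹ : ℝ)) :
    R ⊆ parallelogram (cutCorner Q p⁻¹ 0) g (I * g) := by
  have hr : 0 < p⁻¹ := inv_pos.2 hp
  have hd := halfSide_pos hr
  set L := Q.len 0 + (√3 - 1) * p⁻¹ with hL
  have hLd : L = Q.len 0 + 2 * halfSide p⁻¹ := by rw [hL, halfSide]; ring
  have hlen := Q.len_pos 0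
  have hL0 : 0 < L := by linarith
  have hdir0 : Q.dir 2 ≠ 0 := by
    rw [← norm_ne_zero_iff, Q.norm_dir]; exact one_ne_zero
  have hLne : (L : ℂ) ≠ 0 := by exact_mod_cast hL0.ne'
  have hg0 : g ≠ 0 := by rw [hg]; exact mul_ne_zero hdir0 hLne
  have hmem : ∀ (m : Fin 4) (q : ℂ), q.re ∈ Icc 0 L → q.im ∈ Icc 0 L →
      cutCorner Q p⁻¹ m + Q.dir (concaveIndex m + 1) * q ∈
        parallelogram (cutCorner Q p⁻¹ 0) g (I * g) := by
    rintro m q ⟨h1, h2⟩ ⟨h3, h4⟩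
    obtain ⟨e1, e2⟩ := cutCorner_eq hp hκ hθ hℓ m
    rw [mem_parallelogram_square hg0, e1, e2, hg]
    have e3 : (cutCorner Q p⁻¹ 0 + Q.dir 2 * squareCorner L m + Q.dir 2 * quarterTurn m * q -
        cutCorner Q p⁻¹ 0) / (Q.dir 2 * (L : ℂ)) = (squareCorner L m + quarterTurn m * q) / (L : ℂ) := by
      field_simp; ring
    rw [← hL, e3, div_ofReal_re, div_ofReal_im]
    have key : ∀ x : ℝ, 0 ≤ x → x ≤ L → x / L ∈ Icc (0 : ℝ) 1 := fun x hx hx' =>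
      ⟨div_nonneg hx hL0.le, (div_le_one hL0).2 hx'⟩
    fin_cases m <;> refine ⟨key _ ?_ ?_, key _ ?_ ?_⟩ <;> simp [squareCorner, quarterTurn] <;> linarith
  -- The square is convex, so only the edges have to be located.
  refine subset_of_frontier_subset_convex hR.isCompact ?_ (isCompact_parallelogram _ _ _).isClosed ?_
  · have h : parallelogram (cutCorner Q p⁻¹ 0) g (I * g) =
        (fun w => cutCorner Q p⁻¹ 0 + w) '' ((LinearMap.mulLeft ℝ g) '' (Icc 0 1 ×ℂ Icc 0 1)) := by
      rw [image_image]
      ext w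
      constructor
      · rintro ⟨s, hs, t, ht, rfl⟩
        refine ⟨s + t * I, by simpa [mem_reProdIm] using ⟨hs, ht⟩, ?_⟩
        simp only [LinearMap.mulLeft_apply, real_smul]; ring
      · rintro ⟨v, ⟨h1, h2⟩, rfl⟩
        refine ⟨_, h1, _, h2, ?_⟩
        simp only [LinearMap.mulLeft_apply, real_smul]
        linear_combination (-g) * Complex.re_add_im v
    rw [h]
    exact ((convex_reProdIm (convex_Icc 0 1) (convex_Icc 0 1)).linear_image _).translate _
  · rw [hR.frontier_eq]
    refine iUnion_subset fun i => ?_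
    rintro _ ⟨s, ⟨hs0, hs1⟩, rfl⟩
    obtain ⟨m, rfl | rfl⟩ := exists_eq_concaveIndex i
    · change Q.point _ s ∈ _
      rw [octagon_point_concave hp hκ hθ]
      have hps : p * s ≤ Real.pi / 6 := by
        rw [← hθ _ (not_even_concaveIndex m)]; exact mul_le_mul_of_nonneg_left hs1 hp.le
      have hps0 : 0 ≤ p * s := mul_nonneg hp.le hs0
      obtain ⟨a1, a2, a3⟩ := arc_mem_squareQuarter hr
        (φ := Real.pi / 3 - p * s) ⟨by linarith, by linarith⟩
      refine hmem m _ ⟨a1, ?_⟩ ⟨a2, ?_⟩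
      · exact (le_halfSide_of_sq_add_sq_le hr a2 a3).trans (by linarith)
      · exact (le_halfSide_of_sq_add_sq_le hr a1 (by linarith)).trans (by linarith)
    · change Q.point _ s ∈ _
      rw [octagon_point_flat hp hκ hθ]
      rw [hℓ _ (even_concaveIndex_succ m)] at hs1
      refine hmem m _ ?_ ?_
      · rw [ofReal_re]; constructor <;> linarith
      · rw [ofReal_im]; exact ⟨le_rfl, hL0.le⟩

end Octagon

/-! ### Standard form of the tiling -/

theorem placedSquare_quarterTurn (O F : ℂ) (r : ℝ) (j : Fin 4) :
    placedSquare O (F * quarterTurn j) r = placedSquare O F r := by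
  ext w
  change (starRingEnd ℂ) (F * quarterTurn j) * (w - O) ∈ curvedSquare r ↔
    (starRingEnd ℂ) F * (w - O) ∈ curvedSquare r
  rw [map_mul, mul_comm ((starRingEnd ℂ) F), mul_assoc]
  generalize (starRingEnd ℂ) F * (w - O) = v
  simp only [curvedSquare, mem_ofPred_eq]
  fin_cases j <;> simp [quarterTurn, add_comm]

theorem vadd_placedSquare (k O F : ℂ) (r : ℝ) :
    k +ᵥ placedSquare O F r = placedSquare (k + O) F r := by
  ext w
  rw [mem_vadd_set_iff_neg_vadd_mem]
  change (starRingEnd ℂ) F * (-k + w - O) ∈ curvedSquare r ↔ (starRingEnd ℂ) F * (w - (k + O)) ∈ curvedSquare r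
  rw [show -k + w - O = w - (k + O) by ring]

/-- The standard form of the tilings in the theorem: a square lattice, a curvilinear square placed
at the corners of a fundamental square, and the rest of this square. -/
structure PeriodicTwoTiling.IsSquareTiling (T : PeriodicTwoTiling) (z e k : ℂ) (L r : ℝ) : Prop where
  norm_dir : ‖e‖ = 1
  side_pos : 0 < L
  radius_pos : 0 < r
  lattice_eq : T.lattice = squareLattice (e * L)
  offset_mem : k ∈ T.lattice
  tile_zero : T.tile 0 =ᵐ[volume] (k +ᵥ placedSquare z e r : Set ℂ)
  tile_one : T.tile 1 =ᵐ[volume] (parallelogram z (e * L) (I * (e * L)) \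
    ⋃ h ∈ T.lattice, h +ᵥ T.tile 0 : Set ℂ)
  volume_zero : volume.real (T.tile 0) = squareConst * r ^ 2
  volume_add : volume.real (T.tile 0) + volume.real (T.tile 1) = L ^ 2

/-- Equality in the isoperimetric inequality fixes both shapes; matching edges puts the four cut
corners of the octagon into one class modulo the lattice, and comparing areas shows that the square
lattice they span is everything. -/
theorem PeriodicTwoTiling.exists_isSquareTiling {T : PeriodicTwoTiling} (hnd : T.NonDegenerate)
    (hT : T.Isoperimetric) (h48 : T.IsType48) :
    (∃ z e k L r, T.IsSquareTiling z e k L r) ∧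
    (∃ (p : ℝ) (R₁ R₂ : Set ℂ), T.tile 0 =ᵐ[volume] R₁ ∧ T.tile 1 =ᵐ[volume] R₂ ∧
        IsCurvilinearSquare p R₁ ∧ IsChippedSquare p R₂) ∧
    0 < volume.real (T.tile 0) ∧ 0 < volume.real (T.tile 1) ∧
    volume.real (T.tile 0) / (volume.real (T.tile 0) + volume.real (T.tile 1)) <
      (2 + √3) * squareConst / 2 ∧
    T.perimeter = ENNReal.ofReal (2 * √(volume.real (T.tile 0) + volume.real (T.tile 1)) +
      2 * √(squareConst * volume.real (T.tile 0))) := by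
  obtain ⟨p, R, R', hTR, hTR', ⟨hp, P, hR, hκ, hin⟩, -, Q, hR', hκ', hpar⟩ := h48
  obtain ⟨v₁, v₂, ⟨hθ, hθ', hℓ, hA₁, hA⟩, hratio, hper⟩ :=
    isoperimetric_rectangle_chipped hT hnd hp P hκ hin hR hTR Q hκ' hpar hR' hTR'
  have hr : 0 < p⁻¹ := inv_pos.2 hp
  have e₁ : volume.real (T.tile 0) = volume.real R := by
    rw [measureReal_def, measureReal_def, measure_congr hTR]
  have e₂ : volume.real (T.tile 1) = volume.real R' := by
    rw [measureReal_def, measureReal_def, measure_congr hTR']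
  have f₁ : volume (T.tile 0) = ENNReal.ofReal (volume.real R) := by
    rw [measure_congr hTR, measureReal_def, ENNReal.ofReal_toReal hR.isCompact.measure_lt_top.ne]
  have f₂ : volume (T.tile 1) = ENNReal.ofReal (volume.real R') := by
    rw [measure_congr hTR', measureReal_def, ENNReal.ofReal_toReal hR'.isCompact.measure_lt_top.ne]
  rw [e₁, e₂]
  refine ⟨?_, ⟨p, R, R', hTR, hTR', ⟨hp, P, hR, hκ, fun i => ?_⟩, hp, Q, hR', hκ', fun i _ =>
    octagon_dir_add_two hκ' hθ' i, fun i => ?_⟩, v₁, v₂, hratio, hper⟩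
  rotate_left
  · have h1 := P.vertex_succ_of_square hp hκ hθ i
    have h2 := P.vertex_succ_of_square hp hκ hθ (i + 1)
    rw [P.dir_succ_of_square hκ hθ, add_assoc] at h2
    have h3 : (1 : Fin 4) + 1 = 2 := rfl
    rw [h3] at h2
    rw [h2, h1]; ring
  · by_cases hi : Even (i : ℕ)
    · have hi2 : Even ((i + 2 : Fin 8) : ℕ) := by revert hi; revert i; decide
      rw [hℓ _ hi, hℓ _ hi2]
    · have hi2 : ¬ Even ((i + 2 : Fin 8) : ℕ) := by revert hi; revert i; decide
      have := (hθ' _ hi2).trans (hθ' _ hi).symm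
      exact mul_left_cancel₀ hp.ne' this
  obtain ⟨O, F, hF, hdir, hcen, hRO⟩ := hR.eq_placedSquare hp hκ hθ
  set L := Q.len 0 + (√3 - 1) * p⁻¹ with hL
  have hL0 : 0 < L := by
    have h1 := Q.len_pos 0
    have h2 : 0 < (√3 - 1) * p⁻¹ := mul_pos (by linarith [sqrt_three_bounds.1]) hr
    linarith
  -- A concave edge and the arc it faces have centers that agree up to a lattice vector, and their
  -- directions agree up to a quarter turn; hence the cut corner is the center of a translate of the
  -- first tile.
  have hmatch : ∀ m, cutCorner Q p⁻¹ m - O ∈ T.lattice ∧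
      ∃ j, Q.dir (concaveIndex m + 1) = F * quarterTurn j := by
    intro m
    have hi := not_even_concaveIndex m
    obtain ⟨j, hj, hdj⟩ := exists_matching_edge hnd hp hκ hθ hdir hR hTR hκ' hR' hTR' hi (hθ' _ hi)
    have hd : Q.dir (concaveIndex m + 1) = F * quarterTurn j := by
      have h1 : exp ((2 * Real.pi / 3 : ℝ) * I) * exp ((Real.pi / 6 : ℝ) * I) *
          exp ((Real.pi / 6 : ℝ) * I) = -1 := by
        rw [← Complex.exp_add, ← Complex.exp_add, ← add_mul, ← add_mul, ← ofReal_add, ← ofReal_add,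
          show 2 * Real.pi / 3 + Real.pi / 6 + Real.pi / 6 = Real.pi by ring, Complex.exp_pi_mul_I]
      rw [hdir] at hdj
      rw [octagon_dir_succ_odd hκ' hθ' hi]
      linear_combination (-exp ((Real.pi / 6 : ℝ) * I)) * hdj - quarterTurn j * F * h1
    refine ⟨?_, j, hd⟩
    rw [hcen, arcCenter] at hj
    rw [cutCorner, hd]
    convert hj using 1
    ring
  obtain ⟨z0, j, hj⟩ := hmatch 0
  have hdir2 : Q.dir 2 = F * quarterTurn j := hj
  set g := Q.dir 2 * (L : ℂ) with hg
  have hdir0 : Q.dir 2 ≠ 0 := by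
    rw [← norm_ne_zero_iff, Q.norm_dir]; exact one_ne_zero
  have hg0 : g ≠ 0 := mul_ne_zero hdir0 (by exact_mod_cast hL0.ne')
  have hng : ‖g‖ = L := by rw [hg, norm_mul, Q.norm_dir, norm_real, Real.norm_of_nonneg hL0.le, one_mul]
  have hdiff : ∀ m, Q.dir 2 * squareCorner L m ∈ T.lattice := by
    intro m
    have h1 := T.lattice.sub_mem (hmatch m).1 z0
    rw [(cutCorner_eq hp hκ' hθ' hℓ m).2, ← hL] at h1
    convert h1 using 1
    ring
  have hle : squareLattice g ≤ T.lattice := by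
    rw [squareLattice, AddSubgroup.closure_le]
    rintro x (rfl | rfl)
    · have := hdiff 1
      rwa [squareCorner, Matrix.cons_val_one, Matrix.cons_val_zero] at this
    · have := hdiff 3
      have h4 : squareCorner L 3 = L * I := rfl
      rw [h4] at this
      rw [SetLike.mem_coe, hg]
      convert this using 1
      ring
  have hvol : volume (T.tile 0) + volume (T.tile 1) = ENNReal.ofReal (‖g‖ ^ 2) := by
    rw [f₁, f₂, ← ENNReal.ofReal_add v₁.le v₂.le, hng, hA]
  have hlat := T.lattice_eq_squareLattice hnd hg0 hle hvol
  have hD : IsAddFundamentalDomain T.lattice (parallelogram (cutCorner Q p⁻¹ 0) g (I * g)) volume := by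
    rw [hlat]; exact isAddFundamentalDomain_squareLattice hg0 _
  have hsub := octagon_subset_parallelogram hp hκ' hθ' hℓ hR' (g := g) rfl
  -- The first generator may be any of the translates, so its center `O` differs from the chosen
  -- corner of the square by a lattice vector, the offset.
  refine ⟨cutCorner Q p⁻¹ 0, Q.dir 2, O - cutCorner Q p⁻¹ 0, L, p⁻¹, Q.norm_dir 2, hL0, hr, hlat, ?_, ?_,
    T.tile_one_eq_sdiff hD ?_ (isCompact_parallelogram _ _ _).measure_lt_top.ne ?_, ?_, ?_⟩
  · have := T.lattice.neg_mem z0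
    rwa [neg_sub] at this
  · rw [hdir2, placedSquare_quarterTurn, vadd_placedSquare, sub_add_cancel, ← hRO]
    exact hTR
  · exact hTR'.le.trans (Eventually.of_forall fun _ hw => hsub hw)
  · rw [hvol, volume_parallelogram_square _ hg0]
  · rw [e₁, hA₁]
  · rw [e₁, e₂, hA]

/-! ### Congruence of square tilings -/

section Congruence

variable {u : ℂ} {z z' : ℂ}

/-- The orientation preserving isometry with rotation part `u` that sends `z` to `z'`. -/
noncomputable def motion (hu : ‖u‖ = 1) (z z' : ℂ) : ℂ ≃ᵢ ℂ :=
  ((IsometryEquiv.subRight z).trans (rotation ⟨u, by simp [Submonoid.unitSphere, hu]⟩).toIsometryEquiv).trans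
    (IsometryEquiv.addLeft z')

theorem motion_apply (hu : ‖u‖ = 1) (w : ℂ) : motion hu z z' w = z' + u * (w - z) := rfl

theorem motion_image (hu : ‖u‖ = 1) (A : Set ℂ) :
    motion hu z z' '' A = (fun w => (starRingEnd ℂ) u * (w - (z' - u * z))) ⁻¹' A := by
  have h1 := conj_mul_self_of_norm hu
  have h2 := mul_conj_self_of_norm hu
  ext w
  constructor
  · rintro ⟨v, hv, rfl⟩
    rw [mem_preimage, motion_apply]
    convert hv using 1
    linear_combination v * h1
  · intro hw
    refine ⟨_, hw, ?_⟩
    rw [motion_apply]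
    linear_combination (w - z' + u * z) * h2

theorem motion_image_ae_eq (hu : ‖u‖ = 1) {A B : Set ℂ} (h : A =ᵐ[volume] B) :
    motion hu z z' '' A =ᵐ[volume] motion hu z z' '' B := by
  rw [motion_image, motion_image]
  exact (measurePreserving_mul_sub (by rw [RCLike.norm_conj, hu]) _).quasiMeasurePreserving.preimage_ae_eq h

theorem motion_image_vadd (hu : ‖u‖ = 1) (h : ℂ) (A : Set ℂ) :
    motion hu z z' '' (h +ᵥ A) = (u * h) +ᵥ motion hu z z' '' A := by
  ext w
  constructor
  · rintro ⟨_, ⟨a, ha, rfl⟩, rfl⟩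
    refine ⟨motion hu z z' a, ⟨a, ha, rfl⟩, ?_⟩
    simp only [motion_apply, vadd_eq_add]; ring
  · rintro ⟨_, ⟨a, ha, rfl⟩, rfl⟩
    refine ⟨h + a, ⟨a, ha, rfl⟩, ?_⟩
    simp only [motion_apply, vadd_eq_add]; ring

theorem motion_image_placedSquare (hu : ‖u‖ = 1) (e : ℂ) (r : ℝ) :
    motion hu z z' '' placedSquare z e r = placedSquare z' (u * e) r := by
  rw [motion_image]
  ext w
  change (starRingEnd ℂ) e * ((starRingEnd ℂ) u * (w - (z' - u * z)) - z) ∈ curvedSquare r ↔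
    (starRingEnd ℂ) (u * e) * (w - z') ∈ curvedSquare r
  have h1 := conj_mul_self_of_norm hu
  rw [show (starRingEnd ℂ) e * ((starRingEnd ℂ) u * (w - (z' - u * z)) - z) =
    (starRingEnd ℂ) (u * e) * (w - z') by rw [map_mul]; linear_combination ((starRingEnd ℂ) e * z) * h1]

theorem motion_image_parallelogram (hu : ‖u‖ = 1) (g g' : ℂ) :
    motion hu z z' '' parallelogram z g g' = parallelogram z' (u * g) (u * g') := by
  ext w
  constructor
  · rintro ⟨_, ⟨s, hs, t, ht, rfl⟩, rfl⟩
    refine ⟨s, hs, t, ht, ?_⟩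
    simp only [motion_apply, real_smul]; ring
  · rintro ⟨s, hs, t, ht, rfl⟩
    refine ⟨_, ⟨s, hs, t, ht, rfl⟩, ?_⟩
    simp only [motion_apply, real_smul]; ring

theorem mul_mem_squareLattice {g : ℂ} {h : ℂ} (hh : h ∈ squareLattice g) (u : ℂ) :
    u * h ∈ squareLattice (u * g) := by
  obtain ⟨m, n, rfl⟩ := mem_squareLattice.1 hh
  exact mem_squareLattice.2 ⟨m, n, by ring⟩

end Congruence

namespace PeriodicTwoTiling

/-- The offset `k` is a lattice vector, so it disappears in the union over the lattice. -/
theorem biUnion_vadd_ae_eq {T : PeriodicTwoTiling} {k : ℂ} (hk : k ∈ T.lattice) {S : Set ℂ}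
    (h : T.tile 0 =ᵐ[volume] (k +ᵥ S : Set ℂ)) :
    (⋃ h ∈ T.lattice, h +ᵥ T.tile 0 : Set ℂ) =ᵐ[volume] (⋃ h ∈ T.lattice, h +ᵥ S : Set ℂ) := by
  have := T.countable_lattice
  have h1 : (⋃ h ∈ T.lattice, h +ᵥ S : Set ℂ) = ⋃ h ∈ T.lattice, h +ᵥ (k +ᵥ S) := by
    rw [← vadd_biUnion_vadd hk S]
    simp only [vadd_set_iUnion, vadd_vadd, add_comm]
  rw [h1, biUnion_vadd_eq_iUnion, biUnion_vadd_eq_iUnion]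
  exact Filter.EventuallyEq.countable_iUnion fun g => (vadd_set_ae_eq _).2 h

/-- Square tilings with the same parameters are congruent. -/
theorem IsSquareTiling.congruent {T T' : PeriodicTwoTiling} {z e k z' e' k' : ℂ} {L r : ℝ}
    (h : T.IsSquareTiling z e k L r) (h' : T'.IsSquareTiling z' e' k' L r) : T.Congruent T' := by
  -- The rotation taking the direction `e` to `e'`; together with `z ↦ z'` it maps one fundamental
  -- square onto the other.
  set u := e' * (starRingEnd ℂ) e with hu_def
  have hu : ‖u‖ = 1 := by rw [hu_def, norm_mul, RCLike.norm_conj, h.norm_dir, h'.norm_dir, one_mul]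
  have hue : u * e = e' := by
    rw [hu_def, mul_assoc, conj_mul_self_of_norm h.norm_dir, mul_one]
  have hmem : ∀ g ∈ T.lattice, u * g ∈ T'.lattice := by
    intro g hg
    rw [h.lattice_eq] at hg
    rw [h'.lattice_eq, ← hue, mul_assoc]
    exact mul_mem_squareLattice hg u
  have hmem' : ∀ g ∈ T'.lattice, (starRingEnd ℂ) u * g ∈ T.lattice := by
    intro g hg
    rw [h'.lattice_eq] at hg
    have h1 : e * (L : ℂ) = (starRingEnd ℂ) u * (e' * L) := by
      rw [← hue]; linear_combination (-(e * (L : ℂ))) * conj_mul_self_of_norm hu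
    rw [h.lattice_eq, h1]
    exact mul_mem_squareLattice hg _
  have hcancel : ∀ g, u * ((starRingEnd ℂ) u * g) = g := fun g => by
    rw [← mul_assoc, mul_conj_self_of_norm hu, one_mul]
  -- The first generators sit at the offsets `k` and `k'`, so the lattice vectors correspond after
  -- correcting by both.
  have t0 : ∀ g, motion hu z z' '' (g +ᵥ T.tile 0) =ᵐ[volume]
      ((u * (g + k) - k') +ᵥ T'.tile 0 : Set ℂ) := by
    intro g
    have h1 := motion_image_ae_eq hu (z := z) (z' := z') ((vadd_set_ae_eq g).2 h.tile_zero)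
    rw [vadd_vadd, motion_image_vadd hu (g + k) (placedSquare z e r), motion_image_placedSquare, hue] at h1
    have h2 := (vadd_set_ae_eq (u * (g + k) - k')).2 h'.tile_zero
    rw [vadd_vadd, sub_add_cancel] at h2
    exact h1.trans h2.symm
  have t1 : ∀ g, motion hu z z' '' (g +ᵥ T.tile 1) =ᵐ[volume] ((u * g) +ᵥ T'.tile 1 : Set ℂ) := by
    intro g
    rw [motion_image_vadd]
    refine (vadd_set_ae_eq _).2 ?_
    have a1 := h.tile_one.trans ((ae_eq_refl _).diff (biUnion_vadd_ae_eq h.offset_mem h.tile_zero))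
    have a2 := h'.tile_one.trans ((ae_eq_refl _).diff (biUnion_vadd_ae_eq h'.offset_mem h'.tile_zero))
    have a3 := motion_image_ae_eq hu (z := z) (z' := z') a1
    refine a3.trans (EventuallyEq.trans (Eventually.of_forall fun w => ?_) a2.symm)
    have hset : motion hu z z' '' (parallelogram z (e * L) (I * (e * L)) \
        ⋃ h ∈ T.lattice, h +ᵥ placedSquare z e r) =
        parallelogram z' (e' * L) (I * (e' * L)) \ ⋃ h ∈ T'.lattice, h +ᵥ placedSquare z' e' r := by
      rw [image_sdiff (motion hu z z').injective, motion_image_parallelogram]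
      congr 1
      · rw [← hue]; congr 1 <;> ring
      · simp only [image_iUnion, motion_image_vadd, motion_image_placedSquare, hue]
        ext w
        simp only [mem_iUnion, exists_prop]
        constructor
        · rintro ⟨a, ha, hw⟩
          exact ⟨u * a, hmem a ha, hw⟩
        · rintro ⟨a, ha, hw⟩
          exact ⟨_, hmem' a ha, by rwa [hcancel]⟩
    rw [hset]
  refine ⟨motion hu z z', Fin.forall_fin_two.2 ⟨⟨?_, ?_⟩, ⟨?_, ?_⟩⟩⟩
  · exact fun g hg => ⟨_, T'.lattice.sub_mem (hmem _ (T.lattice.add_mem hg h.offset_mem)) h'.offset_mem,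
      t0 g⟩
  · intro g' hg'
    refine ⟨(starRingEnd ℂ) u * (g' + k') - k,
      T.lattice.sub_mem (hmem' _ (T'.lattice.add_mem hg' h'.offset_mem)) h.offset_mem, ?_⟩
    have := t0 ((starRingEnd ℂ) u * (g' + k') - k)
    rwa [sub_add_cancel, hcancel, add_sub_cancel_right] at this
  · exact fun g hg => ⟨_, hmem g hg, t1 g⟩
  · intro g' hg'
    refine ⟨_, hmem' g' hg', ?_⟩
    have := t1 ((starRingEnd ℂ) u * g')
    rwa [hcancel] at this

end PeriodicTwoTiling

/-! ### The theorem -/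

theorem theorem3p4 :
    (∀ T : PeriodicTwoTiling, T.NonDegenerate → T.Isoperimetric → T.IsType48 →
      -- square lattice and square fundamental domain, curvilinear square and chipped square
      (∃ z g g' : ℂ, IsLatticeBasis T.lattice g g' ∧ ‖g‖ = ‖g'‖ ∧ inner ℝ g g' = 0 ∧
        IsAddFundamentalDomain T.lattice (parallelogram z g g') volume ∧
        T.tile 1 =ᵐ[volume]
          (parallelogram z g g' \ ⋃ h ∈ T.lattice, h +ᵥ T.tile 0 : Set ℂ)) ∧
      (∃ (p : ℝ) (R₁ R₂ : Set ℂ), T.tile 0 =ᵐ[volume] R₁ ∧ T.tile 1 =ᵐ[volume] R₂ ∧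
        IsCurvilinearSquare p R₁ ∧ IsChippedSquare p R₂) ∧
      -- the area ratio
      0 < volume.real (T.tile 0) / (volume.real (T.tile 0) + volume.real (T.tile 1)) ∧
      volume.real (T.tile 0) / (volume.real (T.tile 0) + volume.real (T.tile 1)) <
        (2 + √3) * (1 - √3 + Real.pi / 3) / 2 ∧
      -- the perimeter
      T.perimeter = ENNReal.ofReal
        (2 * √(Real.pi / 3 + 1 - √3) * √(volume.real (T.tile 0)) +
          2 * √(volume.real (T.tile 0) + volume.real (T.tile 1)))) ∧
    -- uniqueness up to isometries, given the two areas
    (∀ T T' : PeriodicTwoTiling,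
      T.NonDegenerate → T.Isoperimetric → T.IsType48 →
      T'.NonDegenerate → T'.Isoperimetric → T'.IsType48 →
      (∀ k, volume (T.tile k) = volume (T'.tile k)) → T.Congruent T') := by
  refine ⟨fun T hnd hT h48 => ?_, fun T T' hnd hT h48 hnd' hT' h48' hv => ?_⟩
  · obtain ⟨⟨z, e, k, L, r, h⟩, hshape, v₁, v₂, hratio, hper⟩ := T.exists_isSquareTiling hnd hT h48
    have hg0 : e * (L : ℂ) ≠ 0 := by
      refine mul_ne_zero ?_ (by exact_mod_cast h.side_pos.ne')
      rw [← norm_ne_zero_iff, h.norm_dir]; exact one_ne_zero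
    refine ⟨⟨z, e * L, I * (e * L), ?_, ?_, ?_, ?_, h.tile_one⟩, hshape, by positivity, ?_, ?_⟩
    · rw [h.lattice_eq]; exact isLatticeBasis_squareLattice hg0
    · rw [norm_mul I, norm_I, one_mul]
    · simp only [Complex.inner, mul_re, mul_im, I_re, I_im, conj_re, conj_im]; ring
    · rw [h.lattice_eq]; exact isAddFundamentalDomain_squareLattice hg0 z
    · refine hratio.trans_eq ?_
      rw [squareConst]; ring
    · rw [hper, Real.sqrt_mul squareConst_pos.le, squareConst]
      congr 1; ring
  · obtain ⟨⟨z, e, k, L, r, h⟩, -⟩ := T.exists_isSquareTiling hnd hT h48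
    obtain ⟨⟨z', e', k', L', r', h'⟩, -⟩ := T'.exists_isSquareTiling hnd' hT' h48'
    have hv' : ∀ k, volume.real (T.tile k) = volume.real (T'.tile k) := fun k => by
      rw [measureReal_def, measureReal_def, hv]
    -- The areas determine both parameters: `A₁ = c r²` and `A₁ + A₂ = L²`.
    have hr : r = r' := by
      have h1 := h.volume_zero.symm.trans ((hv' 0).trans h'.volume_zero)
      exact (sq_eq_sq₀ h.radius_pos.le h'.radius_pos.le).1 (mul_left_cancel₀ squareConst_pos.ne' h1)
    have hL : L = L' := by
      have h1 := h.volume_add.symm.trans (by rw [hv' 0, hv' 1, h'.volume_add])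
      exact (sq_eq_sq₀ h.side_pos.le h'.side_pos.le).1 h1
    subst hr hL
    exact h.congruent h'
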